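/- **Setting (TTP-2).** There are $n\ge 10$ teams, $n\equiv 2\pmod 4$, with symmetric distances $d\ge 0$ between their home venues, $d(v,v)=0$, satisfying the triangle inequality. A feasible schedule is a double round-robin on $2(n-1)$ days: every team plays exactly one game per day, every ordered pair of distinct teams meets exactly once at the venue of its first team, no two teams meet on two consecutive days, and no team has three consecutive home games or three consecutive away games. Each team starts and ends at its own venue and travels directly between the venues of consecutive games; the total travel is the sum of the distances traveled by all teams. **The tournament.** Write $m=n/2$, let the teams be numbered $1,\dots,n$, and let super-team $u_i=\{2i-1,2i\}$ $(1\le i\le m)$. A pair $(a,b)$ is a game of $a$ and $b$ at the venue of $a$; $\overline G$ is $G$ with home and away exchanged. Put $P(x,y)=\{(2x-1,2y-1),(2x,2y)\}$ and $X(x,y)=\{(2x-1,2y),(2x,2y-1)\}$. There are $m-2$ slots of four days, then a last slot of six days. In slot $s$ the position $c\in\{1,\dots,m-2\}$ is occupied by $u_j$ with $j\equiv c-s+1 \pmod{m-2}$, $1\le j\le m-2$. * *Normal super-games.* For $1\le c\le (m-5)/2$ the super-teams at positions $c$ and $m-2-c$ meet. If $x\to y$ denotes the edge between their indices, directed from position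 $c$ iff $c+s$ is odd, the four days are $P(y,x),X(y,x),P(x,y),X(x,y)$. * *Left super-games.* In slot $1$ there is a normal super-game with edge $m-2\to m-1$. In slot $2\le s\le m-3$ the four days are $P(y,x),X(x,y),P(x,y),X(y,x)$ with $(x,y)=(m-1-s,m-1)$ for even $s$ and $(x,y)=(m-1,m-1-s)$ for odd $s$. In slot $m-2$ the same holds with $(x,y)=(m-1,1)$, except that the games of team $n-3$ on the second and fourth day are reversed. * *Right super-games.* Let $u_x,u_y$ be at positions $(m-3)/2,(m-1)/2$, and let $R_1=\{(n,2x-1),(2y,2x),(2y-1,n-1)\}$, $R_2=\{(2y,2x-1),(n-1,2x),(2y-1,n)\}$, $R_3=\{(n-1,2x),(2y-1,2x-1),(2y,n)\}$, $R_4=\{(n,2x),(2y,2x-1),(2y-1,n-1)\}$. For $s<(m-1)/2$ the four days are $R_4,R_3,\overline{R_4},\overline{R_3}$ if $(m-3)/2+s$ is odd, and $\overline{R_2},\overline{R_1},R_2,R_1$ otherwise; for $s=(m-1)/2$ they are $R_1,R_3,\overline{R_1},\overline{R_3}$; for $s>(m-1)/2$ they are $R_1,R_2,\overline{R_1},\overline{R_2}$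 if $(m-3)/2+s$ is odd, and $\overline{R_3},\overline{R_4},R_3,R_4$ otherwise. * *Last slot.* On day 2 the games $(2i,2i-1)$ and on day 6 the games $(2i-1,2i)$, $1\le i\le m-2$. For $1\le h\le (m-5)/2$: day 1 $(4h+3,4h+1),(4h,4h+2)$; day 3 $(4h+1,4h),(4h+3,4h+2)$; day 4 $(4h+1,4h+3),(4h+2,4h)$; day 5 $(4h,4h+1),(4h+2,4h+3)$. Moreover day 1 $(3,1),(n-6,n-4),(2,n-5)$; day 3 $(3,2),(n-5,n-6),(1,n-4)$; day 4 $(1,3),(n-4,n-6),(n-5,2)$; day 5 $(2,3),(n-6,n-5),(n-4,1)$. The last four teams play: day 1 $(n-2,n-3),(n,n-1)$; day 2 $(n-3,n),(n-1,n-2)$; day 3 $(n,n-2),(n-3,n-1)$; day 4 $(n,n-3),(n-2,n-1)$; day 5 $(n-1,n-3),(n-2,n)$; day 6 $(n-3,n-2),(n-1,n)$. **The numbering.** Let $M$ be a minimum weight perfect matching of the complete graph on the teams, and $C$ a Hamiltonian cycle found by Christofides' algorithm (a shortcut of an Eulerian circuit of $T+J$, where $T$ is a minimum spanning tree and $J$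 a minimum weight perfect matching of the odd-degree vertices of $T$). With $D(v)=\sum_u d(v,u)$, number the teams $t_1,\dots,t_n$ so that $\{t_{2i-1},t_{2i}\}\in M$ for $1\le i\le m$; $D(t_{n-1})+D(t_n)$ is the smallest and $D(t_{n-3})+D(t_{n-2})$ the second smallest of the values $D(t_{2i-1})+D(t_{2i})$; and $t_2,t_4,\dots,t_{n-4}$ appear in this cyclic order in $C$. The algorithm returns the tournament above with team $i$ replaced by $t_i$; all remaining choices are arbitrary. **Theorem.** The algorithm has an output, and every schedule that it can output is a feasible TTP-2 schedule whose total travel is at most $(1+9/n)$ times the total travel of any feasible TTP-2 schedule. That is, the approximation ratio of the algorithm is $1+9/n$. -/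

import Mathlib

namespace TTP

/-! ### Schedules of the traveling tournament problem -/

/-- A schedule assigns to every day the finite set of games of that day. A game is a pair
(home team, away team). The days that matter are `1, …, 2 * (n - 1)`. -/
abbrev Schedule (V : Type*) := ℕ → Finset (V × V)

variable {V : Type*}

/-- Team `v` plays a home game on day `k`. -/
def PlaysHome (S : Schedule V) (k : ℕ) (v : V) : Prop := ∃ u, (v, u) ∈ S k

/-- Team `v` plays an away game on day `k`. -/
def PlaysAway (S : Schedule V) (k : ℕ) (v : V) : Prop := ∃ u, (u, v) ∈ S k

/-- Feasibility of a schedule for TTP-`K` with `n` teams. -/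
structure IsFeasible (K n : ℕ) (S : Schedule V) : Prop where
  /-- Games are between different teams. -/
  ne_of_mem : ∀ k ∈ Finset.Icc 1 (2 * (n - 1)), ∀ g ∈ S k, g.1 ≠ g.2
  /-- Fixed-game-time: every team plays exactly one game on each of the `2 * (n - 1)` days. -/
  one_game : ∀ k ∈ Finset.Icc 1 (2 * (n - 1)), ∀ v, ∃! g, g ∈ S k ∧ (g.1 = v ∨ g.2 = v)
  /-- Double round-robin: every ordered pair of teams meets exactly once, at the home venue of the
  first team. -/
  double_round_robin : ∀ u v, u ≠ v → ∃! k, k ∈ Finset.Icc 1 (2 * (n - 1)) ∧ (u, v) ∈ S k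
  /-- No-repeat: no two teams meet on two consecutive days. -/
  no_repeat : ∀ k, 1 ≤ k → k + 1 ≤ 2 * (n - 1) → ∀ u v, (u, v) ∈ S k →
    (u, v) ∉ S (k + 1) ∧ (v, u) ∉ S (k + 1)
  /-- Bounded-by-`K`, home games: no `K + 1` consecutive home games. -/
  bounded_home : ∀ k, 1 ≤ k → k + K ≤ 2 * (n - 1) → ∀ v, ∃ j ≤ K, ¬ PlaysHome S (k + j) v
  /-- Bounded-by-`K`, away games: no `K + 1` consecutive away games. -/
  bounded_away : ∀ k, 1 ≤ k → k + K ≤ 2 * (n - 1) → ∀ v, ∃ j ≤ K, ¬ PlaysAway S (k + j) v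

open scoped Classical in
/-- The team at whose venue team `v` is on day `k`. On day `0` (before the tournament), on day
`2 * (n - 1) + 1` (after it) and on the days of its home games, `v` is at its own venue. -/
noncomputable def location (n : ℕ) (S : Schedule V) (v : V) (k : ℕ) : V :=
  if h : k ∈ Finset.Icc 1 (2 * (n - 1)) ∧ PlaysAway S k v then h.2.choose else v

/-- The total distance traveled by all teams; `dist u v` is the distance between the home venues of
`u` and `v`. -/
noncomputable def travel [Fintype V] [PseudoMetricSpace V] (n : ℕ) (S : Schedule V) : ℝ :=
  ∑ v : V, ∑ k ∈ Finset.range (2 * (n - 1) + 1), dist (location n S v k) (location n S v (k + 1))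

/-! ### The Zhao–Xiao tournament on teams `1, …, n`

Here `m = n / 2`, and super-team `i` (`1 ≤ i ≤ m`) consists of teams `2 * i - 1` and `2 * i`. -/

/-- The two games of super-team `x` at home against super-team `y`, in parallel. -/
def par (x y : ℕ) : Finset (ℕ × ℕ) := {(2 * x - 1, 2 * y - 1), (2 * x, 2 * y)}

/-- The two games of super-team `x` at home against super-team `y`, crosswise. -/
def cross (x y : ℕ) : Finset (ℕ × ℕ) := {(2 * x - 1, 2 * y), (2 * x, 2 * y - 1)}

/-- Exchange home and away. -/
def rev (G : Finset (ℕ × ℕ)) : Finset (ℕ × ℕ) := G.image Prod.swap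

/-- The games of the normal super-game with edge from `x` to `y` on the `r`-th of its four days:
`x` plays away, away, home, home. -/
def normalGames (x y : ℕ) : ℕ → Finset (ℕ × ℕ)
  | 1 => par y x
  | 2 => cross y x
  | 3 => par x y
  | 4 => cross x y
  | _ => ∅

/-- The games of the left super-game with edge from `x` to `y` on the `r`-th of its four days:
`x` plays away, home, home, away. -/
def leftGames (x y : ℕ) : ℕ → Finset (ℕ × ℕ)
  | 1 => par y x
  | 2 => cross x y
  | 3 => par x y
  | 4 => cross y x
  | _ => ∅

/-- The special left super-game with edge from super-team `m - 1 = {n - 3, n - 2}` to super-team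
`1 = {1, 2}`: the left super-game with the games of team `n - 3` on the second and on the fourth
day reversed. -/
def specialLeftGames (n : ℕ) : ℕ → Finset (ℕ × ℕ)
  | 1 => {(1, n - 3), (2, n - 2)}
  | 2 => {(2, n - 3), (n - 2, 1)}
  | 3 => {(n - 3, 1), (n - 2, 2)}
  | 4 => {(n - 3, 2), (1, n - 2)}
  | _ => ∅

/-- The four types of days in a right super-game of super-teams `x`, `y` and `m = {n - 1, n}`. -/
def rightType (n x y : ℕ) : ℕ → Finset (ℕ × ℕ)
  | 1 => {(n, 2 * x - 1), (2 * y, 2 * x), (2 * y - 1, n - 1)}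
  | 2 => {(2 * y, 2 * x - 1), (n - 1, 2 * x), (2 * y - 1, n)}
  | 3 => {(n - 1, 2 * x), (2 * y - 1, 2 * x - 1), (2 * y, n)}
  | 4 => {(n, 2 * x), (2 * y, 2 * x - 1), (2 * y - 1, n - 1)}
  | _ => ∅

/-- Four days of the types `A`, `B`, reversed `A`, reversed `B`. -/
def fourDays (A B : Finset (ℕ × ℕ)) : ℕ → Finset (ℕ × ℕ)
  | 1 => A
  | 2 => B
  | 3 => rev A
  | 4 => rev B
  | _ => ∅

/-- The super-team at position `c` (`1 ≤ c ≤ m - 2`) in slot `s` (`1 ≤ s ≤ m - 2`). Super-team `c`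
starts at position `c` and moves to the next position (cyclically) after every slot. -/
def occupant (m s c : ℕ) : ℕ := (c + (m - 2) - s) % (m - 2) + 1

/-- The games on the `r`-th day (`1 ≤ r ≤ 4`) of slot `s` between positions `c` and `m - 2 - c`;
the edge is directed from position `c` iff `c + s` is odd. -/
def columnGames (m s c r : ℕ) : Finset (ℕ × ℕ) :=
  if Odd (c + s) then normalGames (occupant m s c) (occupant m s (m - 2 - c)) r
  else normalGames (occupant m s (m - 2 - c)) (occupant m s c) r

/-- The games on the `r`-th day of slot `s` of super-team `m - 1` and the super-team `m - 1 - s`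
at position `m - 2`. -/
def leftmostGames (m s r : ℕ) : Finset (ℕ × ℕ) :=
  if s = 1 then normalGames (m - 2) (m - 1) r
  else if s = m - 2 then specialLeftGames (2 * m) r
  else if Even s then leftGames (m - 1 - s) (m - 1) r
  else leftGames (m - 1) (m - 1 - s) r

/-- The games on the `r`-th day of slot `s` of super-team `m` and the super-teams `x` and `y` at
positions `(m - 3) / 2` and `(m - 1) / 2`; the edge is directed from `x` to `y` iff
`(m - 3) / 2 + s` is odd. -/
def rightGames (m s r : ℕ) : Finset (ℕ × ℕ) :=
  let R := rightType (2 * m) (occupant m s ((m - 3) / 2)) (occupant m s ((m - 1) / 2))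
  if s = (m - 1) / 2 then fourDays (R 1) (R 3) r
  else if s < (m - 1) / 2 then
    if Odd ((m - 3) / 2 + s) then fourDays (R 4) (R 3) r
    else fourDays (rev (R 2)) (rev (R 1)) r
  else
    if Odd ((m - 3) / 2 + s) then fourDays (R 1) (R 2) r
    else fourDays (rev (R 3)) (rev (R 4)) r

/-- All games on the `r`-th day of slot `s`. -/
def slotGames (m s r : ℕ) : Finset (ℕ × ℕ) :=
  (Finset.Icc 1 ((m - 5) / 2)).biUnion (fun c => columnGames m s c r) ∪
    leftmostGames m s r ∪ rightGames m s r

/-- The games in the last slot between the teams of super-team `j = 2 * h + 1`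
(`3 ≤ j ≤ m - 4`) and their opponents `4 * h` and `4 * h + 3` in the adjacent super-teams. -/
def lastInner (h : ℕ) : ℕ → Finset (ℕ × ℕ)
  | 1 => {(4 * h + 3, 4 * h + 1), (4 * h, 4 * h + 2)}
  | 3 => {(4 * h + 1, 4 * h), (4 * h + 3, 4 * h + 2)}
  | 4 => {(4 * h + 1, 4 * h + 3), (4 * h + 2, 4 * h)}
  | 5 => {(4 * h, 4 * h + 1), (4 * h + 2, 4 * h + 3)}
  | _ => ∅

/-- The games in the last slot of teams `1`, `2`, `n - 5`, `n - 4` against teams of other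
super-teams. -/
def lastOuter (n : ℕ) : ℕ → Finset (ℕ × ℕ)
  | 1 => {(3, 1), (n - 6, n - 4), (2, n - 5)}
  | 3 => {(3, 2), (n - 5, n - 6), (1, n - 4)}
  | 4 => {(1, 3), (n - 4, n - 6), (n - 5, 2)}
  | 5 => {(2, 3), (n - 6, n - 5), (n - 4, 1)}
  | _ => ∅

/-- The games in the last slot within the super-teams `1, …, m - 2`. -/
def lastMates (m : ℕ) : ℕ → Finset (ℕ × ℕ)
  | 2 => (Finset.Icc 1 (m - 2)).image (fun i => (2 * i, 2 * i - 1))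
  | 6 => (Finset.Icc 1 (m - 2)).image (fun i => (2 * i - 1, 2 * i))
  | _ => ∅

/-- The double round-robin of the teams `n - 3, …, n` in the last slot. -/
def lastFour (n : ℕ) : ℕ → Finset (ℕ × ℕ)
  | 1 => {(n - 2, n - 3), (n, n - 1)}
  | 2 => {(n - 3, n), (n - 1, n - 2)}
  | 3 => {(n, n - 2), (n - 3, n - 1)}
  | 4 => {(n, n - 3), (n - 2, n - 1)}
  | 5 => {(n - 1, n - 3), (n - 2, n)}
  | 6 => {(n - 3, n - 2), (n - 1, n)}
  | _ => ∅

/-- All games on the `r`-th day (`1 ≤ r ≤ 6`) of the last slot. -/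
def lastGames (n r : ℕ) : Finset (ℕ × ℕ) :=
  (Finset.Icc 1 ((n / 2 - 5) / 2)).biUnion (fun h => lastInner h r) ∪
    lastOuter n r ∪ lastMates (n / 2) r ∪ lastFour n r

/-- The Zhao–Xiao tournament on teams `1, …, n`: slot `s` (`1 ≤ s ≤ m - 2`) takes the days
`4 * s - 3, …, 4 * s`, and the last slot takes the six days after day `4 * (m - 2)`. -/
def zhaoXiao (n k : ℕ) : Finset (ℕ × ℕ) :=
  if k ≤ 4 * (n / 2 - 2) then slotGames (n / 2) ((k - 1) / 4 + 1) ((k - 1) % 4 + 1)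
  else lastGames n (k - 4 * (n / 2 - 2))

/-! ### Matchings, spanning trees and the algorithm of Christofides -/

/-- The length of an edge. -/
noncomputable def edgeLen [PseudoMetricSpace V] : Sym2 V → ℝ :=
  Sym2.lift ⟨fun u v => dist u v, fun u v => dist_comm u v⟩

open scoped Classical in
/-- The total length of the edges of a graph. -/
noncomputable def graphLen [Fintype V] [PseudoMetricSpace V] (G : SimpleGraph V) : ℝ :=
  ∑ e ∈ G.edgeFinset, edgeLen e

/-- `M` is a minimum weight perfect matching of the complete graph on `U`. -/
def IsMinMatchingOn [Fintype V] [PseudoMetricSpace V] (U : Set V)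
    (M : (⊤ : SimpleGraph V).Subgraph) : Prop :=
  M.verts = U ∧ M.IsMatching ∧
    ∀ M' : (⊤ : SimpleGraph V).Subgraph, M'.verts = U → M'.IsMatching →
      graphLen M.spanningCoe ≤ graphLen M'.spanningCoe

/-- `T` is a minimum weight spanning tree of the complete graph on `V`. -/
def IsMinSpanningTree [Fintype V] [PseudoMetricSpace V] (T : SimpleGraph V) : Prop :=
  T.IsTree ∧ ∀ T' : SimpleGraph V, T'.IsTree → graphLen T ≤ graphLen T'

/-- The edges traversed by the closed walk that visits the vertices of `W` in order and then
returns to the first one. -/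
def closedWalkEdges (W : List V) : Multiset (Sym2 V) :=
  (List.zipWith (fun u v => s(u, v)) W (W.rotate 1) : List (Sym2 V))

open scoped Classical in
/-- `C` (read cyclically) is a Hamiltonian cycle produced by the algorithm of Christofides: `T` is a
minimum spanning tree, `J` is a minimum weight perfect matching of the vertices of odd degree in
`T`, `W` is an Eulerian circuit of the multigraph `T + J`, and `C` is a shortcut of `W` that keeps
exactly one occurrence of every vertex. -/
def IsChristofidesCycle [Fintype V] [PseudoMetricSpace V] (C : List V) : Prop :=
  ∃ (T : SimpleGraph V) (J : (⊤ : SimpleGraph V).Subgraph) (W : List V),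
    IsMinSpanningTree T ∧
    IsMinMatchingOn {v | Odd (T.degree v)} J ∧
    closedWalkEdges W = T.edgeFinset.val + J.spanningCoe.edgeFinset.val ∧
    C.Sublist W ∧ C.Nodup ∧ ∀ v, v ∈ C

/-! ### The algorithm -/

/-- `D(v)`, the sum of the distances from `v` to all teams. -/
noncomputable def distSum [Fintype V] [PseudoMetricSpace V] (v : V) : ℝ := ∑ u : V, dist v u

/-- `t 1, …, t n` is a numbering of the teams obtained from the matching `M` and the Hamiltonian
cycle `C`. -/
structure IsNumbering [Fintype V] [PseudoMetricSpace V] (n : ℕ)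
    (M : (⊤ : SimpleGraph V).Subgraph) (C : List V) (t : ℕ → V) : Prop where
  bijOn : Set.BijOn t (Set.Icc 1 n) Set.univ
  /-- The super-teams are the edges of `M`. -/
  mates : ∀ i ∈ Finset.Icc 1 (n / 2), M.Adj (t (2 * i - 1)) (t (2 * i))
  /-- The super-team `{t (n - 1), t n}` has the smallest sum of the values `D`. -/
  smallest : distSum (t (n - 1)) + distSum (t n) ≤ distSum (t (n - 3)) + distSum (t (n - 2))
  /-- The super-team `{t (n - 3), t (n - 2)}` has the second smallest sum of the values `D`. -/
  second_smallest : ∀ i ∈ Finset.Icc 1 (n / 2 - 2),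
    distSum (t (n - 3)) + distSum (t (n - 2)) ≤ distSum (t (2 * i - 1)) + distSum (t (2 * i))
  /-- The teams `t 2, t 4, …, t (n - 4)` appear in this cyclic order in `C`. -/
  cyclic_order : ∃ C' : List V, C.IsRotated C' ∧
    ((List.range (n / 2 - 2)).map (fun i => t (2 * (i + 1)))).Sublist C'

open scoped Classical in
/-- `S` is a possible output of the algorithm, over all of its arbitrary choices: the Zhao–Xiao
tournament with the teams numbered in this way. -/
def IsOutput [Fintype V] [PseudoMetricSpace V] (n : ℕ) (S : Schedule V) : Prop :=
  ∃ (M : (⊤ : SimpleGraph V).Subgraph) (C : List V) (t : ℕ → V),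
    IsMinMatchingOn Set.univ M ∧ IsChristofidesCycle C ∧ IsNumbering n M C t ∧
    S = fun k => (zhaoXiao n k).image (Prod.map t t)

end TTP

namespace TTP

/-! ### The games of the tournament -/

/-! Write n = 4q + 10, so that m = 2q + 5 and the super-teams 1, …, 2q + 3 circulate. Let Δ be the
sum of all D(v), and d(M) the weight of the matching. Both schedules are compared with Δ + n d(M).

Lower bound (`le_travel`). A team that returned home after every away game would travel 2 D(v);
going directly from a to b saves the detour d(v,a) + d(v,b) − d(a,b) (`travel_eq`). No three away
games are consecutive, so the direct steps of team v form a partial matching of its opponents.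
Completing it to a perfect matching, with the triangle inequality through v for the added edges,
shows that v travels at least D(v) + d(M).

Upper bound. Let c(v,a) be d(v,a) minus what v saves after visiting a; the travel of the tournament
is Δ plus the sum of all c(v,a). All that is needed about c is collected in `TourCost`: c ≤ d, and
c(v,a) + d(v,b) ≤ d(a,b) if v goes directly from a to b. Most pairs of super-teams play a normal
super-game, where every team visits two mates in one trip, at the cost of one matching edge.
Isolated visits in left super-games are charged to D(n−3) + D(n−2), mixed trips in right super-games
to D(n−1) + D(n), and the remaining visits between neighbouring super-teams to matching edges and to
edges of the cycle through teams 2, 4, …, n − 4. `TourCost.sum_le` bounds the total by the four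
values D, five times that cycle, and (n − 1) d(M).

The four values D belong to the two cheapest of m pairs, so they add up to at most 4Δ/n
(`IsNumbering.distSum_le`). The cycle is a shortcut of C, and C has length at most 2 d(M) + D(v) for
every v (`closedLen_le`): M together with a star from v to one end of each matching edge contains a
spanning tree, and it also pays for a matching of any even set of vertices; averaging over the two
complementary choices of ends, the star costs D(v)/2. Averaging over v leaves 2 d(M) + Δ/n.
Altogether the travel is at most (1 + 9/n)Δ + (n + 9) d(M) = (1 + 9/n)(Δ + n d(M)).

Feasibility follows by counting. It is enough to exhibit games: every team occurs on every day,
never three times in a row at home or away (`playsWell`), and every two teams meet at both venues at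
least two days apart (`meet_of_ne`). A day has at most m games, and all days together at most n(n −
1), so there is no room for anything else.

For the existence of an output, minimum matchings and trees exist by finiteness, T + J is connected
with even degrees (`exists_eulerian`), and the numbering lists one team of each pair in the order of
C. -/

theorem occupant_eq {q s c : ℕ} (hs : 1 ≤ s) (hs' : s ≤ 2 * q + 3) (hc : 1 ≤ c)
    (hc' : c ≤ 2 * q + 3) :
    occupant (2 * q + 5) s c = if s ≤ c then c + 1 - s else c + (2 * q + 4) - s := by
  unfold occupant
  have h : 2 * q + 5 - 2 = 2 * q + 3 := by omega
  rw [h]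
  split_ifs with hsc
  · have : c + (2 * q + 3) - s = (c - s) + (2 * q + 3) := by omega
    rw [this, Nat.add_mod_right, Nat.mod_eq_of_lt (by omega)]
    omega
  · rw [Nat.mod_eq_of_lt (by omega)]
    omega

theorem slotGames_subset {q s r : ℕ} (hs : 1 ≤ s) (hs' : s ≤ 2 * q + 3) (hr : 1 ≤ r)
    (hr' : r ≤ 4) :
    slotGames (2 * q + 5) s r ⊆ zhaoXiao (4 * q + 10) (4 * (s - 1) + r) := by
  unfold zhaoXiao
  have h1 : (4 * q + 10) / 2 = 2 * q + 5 := by omega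
  rw [if_pos (by omega), h1]
  have h2 : (4 * (s - 1) + r - 1) / 4 + 1 = s := by omega
  have h3 : (4 * (s - 1) + r - 1) % 4 + 1 = r := by omega
  rw [h2, h3]

theorem columnGames_subset {q s c r : ℕ} (hs : 1 ≤ s) (hs' : s ≤ 2 * q + 3) (hr : 1 ≤ r)
    (hr' : r ≤ 4) (hc : 1 ≤ c) (hc' : c ≤ q) :
    columnGames (2 * q + 5) s c r ⊆ zhaoXiao (4 * q + 10) (4 * (s - 1) + r) := by
  refine Finset.Subset.trans ?_ (slotGames_subset hs hs' hr hr')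
  unfold slotGames
  have : c ∈ Finset.Icc 1 ((2 * q + 5 - 5) / 2) := by
    rw [Finset.mem_Icc]; omega
  refine Finset.Subset.trans (Finset.subset_biUnion_of_mem
    (fun c => columnGames (2 * q + 5) s c r) this) ?_
  intro g hg
  simp only [Finset.mem_union]
  exact Or.inl (Or.inl hg)

theorem leftmostGames_subset {q s r : ℕ} (hs : 1 ≤ s) (hs' : s ≤ 2 * q + 3) (hr : 1 ≤ r)
    (hr' : r ≤ 4) :
    leftmostGames (2 * q + 5) s r ⊆ zhaoXiao (4 * q + 10) (4 * (s - 1) + r) := by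
  refine Finset.Subset.trans ?_ (slotGames_subset hs hs' hr hr')
  unfold slotGames
  intro g hg
  simp only [Finset.mem_union]
  exact Or.inl (Or.inr hg)

theorem rightGames_subset {q s r : ℕ} (hs : 1 ≤ s) (hs' : s ≤ 2 * q + 3) (hr : 1 ≤ r)
    (hr' : r ≤ 4) :
    rightGames (2 * q + 5) s r ⊆ zhaoXiao (4 * q + 10) (4 * (s - 1) + r) := by
  refine Finset.Subset.trans ?_ (slotGames_subset hs hs' hr hr')
  unfold slotGames
  intro g hg
  simp only [Finset.mem_union]
  exact Or.inr hg

theorem lastGames_subset {q r : ℕ} (hr : 1 ≤ r) :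
    lastGames (4 * q + 10) r ⊆ zhaoXiao (4 * q + 10) (8 * q + 12 + r) := by
  unfold zhaoXiao
  rw [if_neg (by omega)]
  have : 8 * q + 12 + r - 4 * ((4 * q + 10) / 2 - 2) = r := by omega
  rw [this]

/-- The position of super-team `i` at position `c` in slot `s`, for a normal super-game. -/
theorem normalGames_subset {q s c x y : ℕ} (hs : 1 ≤ s) (hs' : s ≤ 2 * q + 3) (hc : 1 ≤ c)
    (hc' : c ≤ q)
    (hx : (s + c) % 2 = 1 ∧ (s + x = c + 1 ∨ s + x = c + (2 * q + 4)) ∧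
        (s + y = 2 * q + 3 - c + 1 ∨ s + y = 2 * q + 3 - c + (2 * q + 4)) ∨
      (s + c) % 2 = 0 ∧ (s + y = c + 1 ∨ s + y = c + (2 * q + 4)) ∧
        (s + x = 2 * q + 3 - c + 1 ∨ s + x = 2 * q + 3 - c + (2 * q + 4)))
    (hx1 : 1 ≤ x) (hx2 : x ≤ 2 * q + 3) (hy1 : 1 ≤ y) (hy2 : y ≤ 2 * q + 3) {r : ℕ} (hr : 1 ≤ r)
    (hr' : r ≤ 4) :
    normalGames x y r ⊆ zhaoXiao (4 * q + 10) (4 * (s - 1) + r) := by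
  refine Finset.Subset.trans ?_ (columnGames_subset hs hs' hr hr' hc hc')
  have h : 2 * q + 5 - 2 - c = 2 * q + 3 - c := by omega
  unfold columnGames
  rw [h, occupant_eq hs hs' hc (by omega), occupant_eq hs hs' (by omega) (by omega)]
  rcases hx with ⟨h1, h2, h3⟩ | ⟨h1, h2, h3⟩
  · rw [if_pos (by rw [Nat.odd_iff]; omega)]
    have e1 : (if s ≤ c then c + 1 - s else c + (2 * q + 4) - s) = x := by split_ifs <;> omega
    have e2 : (if s ≤ 2 * q + 3 - c then 2 * q + 3 - c + 1 - s else
      2 * q + 3 - c + (2 * q + 4) - s) = y := by split_ifs <;> omega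
    rw [e1, e2]
  · rw [if_neg (by rw [Nat.odd_iff]; omega)]
    have e1 : (if s ≤ c then c + 1 - s else c + (2 * q + 4) - s) = y := by split_ifs <;> omega
    have e2 : (if s ≤ 2 * q + 3 - c then 2 * q + 3 - c + 1 - s else
      2 * q + 3 - c + (2 * q + 4) - s) = x := by split_ifs <;> omega
    rw [e1, e2]

/-- The super-teams `x` and `y` play a normal super-game with edge from `x` to `y`. -/
def NormalSuperGame (q x y : ℕ) : Prop :=
  ∃ s, 1 ≤ s ∧ s ≤ 2 * q + 3 ∧ ∀ r, 1 ≤ r → r ≤ 4 →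
    normalGames x y r ⊆ zhaoXiao (4 * q + 10) (4 * (s - 1) + r)

/-- Positions are counted modulo the odd number N = 2q + 3, and the difference of two positions
never changes, so i and j face each other when they occupy c and N − c for some c. If j − i = 2c,
this happens with j at position c; if j − i is odd, then N − (j − i) = 2d is even and i is at
position d. The hypotheses exclude cyclic neighbours, for which the position would be that of a
right super-game. -/
theorem exists_normalSuperGame {q i j : ℕ} (hi : 1 ≤ i) (hij : i + 2 ≤ j) (hj : j ≤ 2 * q + 3)
    (hji : j ≤ i + (2 * q + 1)) : NormalSuperGame q i j ∨ NormalSuperGame q j i := by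
  rcases Nat.even_or_odd' (j - i) with ⟨c, h | h⟩
  · by_cases hpar : (2 * q + 4 + c - j + c) % 2 = 1
    · exact Or.inr ⟨2 * q + 4 + c - j, by omega, by omega, fun r h1 h2 =>
        normalGames_subset (by omega) (by omega) (c := c) (by omega) (by omega) (by omega)
          (by omega) (by omega) (by omega) (by omega) h1 h2⟩
    · exact Or.inl ⟨2 * q + 4 + c - j, by omega, by omega, fun r h1 h2 =>
        normalGames_subset (by omega) (by omega) (c := c) (by omega) (by omega) (by omega)
          (by omega) (by omega) (by omega) (by omega) h1 h2⟩
  · obtain ⟨d, hd⟩ : ∃ d, d = q + 1 - c := ⟨_, rfl⟩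
    by_cases hle : i + j ≤ 2 * q + 3
    · by_cases hpar : (d + 1 - i + d) % 2 = 1
      · exact Or.inl ⟨d + 1 - i, by omega, by omega, fun r h1 h2 =>
          normalGames_subset (by omega) (by omega) (c := d) (by omega) (by omega) (by omega)
            (by omega) (by omega) (by omega) (by omega) h1 h2⟩
      · exact Or.inr ⟨d + 1 - i, by omega, by omega, fun r h1 h2 =>
          normalGames_subset (by omega) (by omega) (c := d) (by omega) (by omega) (by omega)
            (by omega) (by omega) (by omega) (by omega) h1 h2⟩
    · by_cases hpar : (d + (2 * q + 4) - i + d) % 2 = 1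
      · exact Or.inl ⟨d + (2 * q + 4) - i, by omega, by omega, fun r h1 h2 =>
          normalGames_subset (by omega) (by omega) (c := d) (by omega) (by omega) (by omega)
            (by omega) (by omega) (by omega) (by omega) h1 h2⟩
      · exact Or.inr ⟨d + (2 * q + 4) - i, by omega, by omega, fun r h1 h2 =>
          normalGames_subset (by omega) (by omega) (c := d) (by omega) (by omega) (by omega)
            (by omega) (by omega) (by omega) (by omega) h1 h2⟩

theorem leftmost_normal_subset {q r : ℕ} (hr : 1 ≤ r) (hr' : r ≤ 4) :
    normalGames (2 * q + 3) (2 * q + 4) r ⊆ zhaoXiao (4 * q + 10) r := by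
  have h := leftmostGames_subset (q := q) (s := 1) le_rfl (by omega) hr hr'
  simpa [leftmostGames] using h

theorem leftmost_even_subset {q i r : ℕ} (hi : 1 ≤ i) (hi' : i ≤ 2 * q + 2) (hp : i % 2 = 0)
    (hr : 1 ≤ r) (hr' : r ≤ 4) :
    leftGames i (2 * q + 4) r ⊆ zhaoXiao (4 * q + 10) (4 * (2 * q + 3 - i) + r) := by
  have h := leftmostGames_subset (q := q) (s := 2 * q + 4 - i) (by omega) (by omega) hr hr'
  unfold leftmostGames at h
  rw [if_neg (by omega), if_neg (by omega), if_pos (by rw [Nat.even_iff]; omega)] at h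
  have e1 : 2 * q + 5 - 1 - (2 * q + 4 - i) = i := by omega
  have e2 : 2 * q + 5 - 1 = 2 * q + 4 := by omega
  have e3 : 2 * q + 4 - i - 1 = 2 * q + 3 - i := by omega
  rwa [e1, e2, e3] at h

theorem leftmost_odd_subset {q i r : ℕ} (hi : 2 ≤ i) (hi' : i ≤ 2 * q + 2) (hp : i % 2 = 1)
    (hr : 1 ≤ r) (hr' : r ≤ 4) :
    leftGames (2 * q + 4) i r ⊆ zhaoXiao (4 * q + 10) (4 * (2 * q + 3 - i) + r) := by
  have h := leftmostGames_subset (q := q) (s := 2 * q + 4 - i) (by omega) (by omega) hr hr'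
  unfold leftmostGames at h
  rw [if_neg (by omega), if_neg (by omega), if_neg (by rw [Nat.even_iff]; omega)] at h
  have e1 : 2 * q + 5 - 1 - (2 * q + 4 - i) = i := by omega
  have e2 : 2 * q + 5 - 1 = 2 * q + 4 := by omega
  have e3 : 2 * q + 4 - i - 1 = 2 * q + 3 - i := by omega
  rwa [e1, e2, e3] at h

theorem leftmost_special_subset {q r : ℕ} (hr : 1 ≤ r) (hr' : r ≤ 4) :
    specialLeftGames (4 * q + 10) r ⊆ zhaoXiao (4 * q + 10) (8 * q + 8 + r) := by
  have h := leftmostGames_subset (q := q) (s := 2 * q + 3) (by omega) (by omega) hr hr'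
  unfold leftmostGames at h
  rw [if_neg (by omega), if_pos (by omega)] at h
  have e1 : 2 * (2 * q + 5) = 4 * q + 10 := by omega
  have e2 : 4 * (2 * q + 3 - 1) + r = 8 * q + 8 + r := by omega
  rwa [e1, e2] at h

theorem right_occupants {q s x y : ℕ} (hs : 1 ≤ s) (hs' : s ≤ 2 * q + 3)
    (hx : s + x = q + 2 ∨ s + x = 3 * q + 5) (hy : s + y = q + 3 ∨ s + y = 3 * q + 6)
    (hx1 : 1 ≤ x) (hx2 : x ≤ 2 * q + 3) (hy1 : 1 ≤ y) (hy2 : y ≤ 2 * q + 3) :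
    occupant (2 * q + 5) s ((2 * q + 5 - 3) / 2) = x ∧
      occupant (2 * q + 5) s ((2 * q + 5 - 1) / 2) = y := by
  have e1 : (2 * q + 5 - 3) / 2 = q + 1 := by omega
  have e2 : (2 * q + 5 - 1) / 2 = q + 2 := by omega
  rw [e1, e2, occupant_eq hs hs' (by omega) (by omega), occupant_eq hs hs' (by omega) (by omega)]
  constructor <;> split_ifs <;> omega

theorem right_low_even_subset {q x r : ℕ} (hx : 1 ≤ x) (hx' : x ≤ q + 1) (hp : x % 2 = 0)
    (hr : 1 ≤ r) (hr' : r ≤ 4) :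
    fourDays (rightType (4 * q + 10) x (x + 1) 4) (rightType (4 * q + 10) x (x + 1) 3) r ⊆
      zhaoXiao (4 * q + 10) (4 * (q + 1 - x) + r) := by
  have h := rightGames_subset (q := q) (s := q + 2 - x) (by omega) (by omega) hr hr'
  obtain ⟨h1, h2⟩ := right_occupants (q := q) (s := q + 2 - x) (x := x) (y := x + 1) (by omega)
    (by omega) (by omega) (by omega) (by omega) (by omega) (by omega) (by omega)
  unfold rightGames at h
  rw [h1, h2] at h
  dsimp only at h
  rw [if_neg (by omega), if_pos (by omega), if_pos (by rw [Nat.odd_iff]; omega)] at h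
  have e1 : 2 * (2 * q + 5) = 4 * q + 10 := by omega
  have e2 : q + 2 - x - 1 = q + 1 - x := by omega
  rwa [e1, e2] at h

theorem right_low_odd_subset {q x r : ℕ} (hx : 1 ≤ x) (hx' : x ≤ q + 1) (hp : x % 2 = 1)
    (hr : 1 ≤ r) (hr' : r ≤ 4) :
    fourDays (rev (rightType (4 * q + 10) x (x + 1) 2)) (rev (rightType (4 * q + 10) x (x + 1) 1))
      r ⊆ zhaoXiao (4 * q + 10) (4 * (q + 1 - x) + r) := by
  have h := rightGames_subset (q := q) (s := q + 2 - x) (by omega) (by omega) hr hr'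
  obtain ⟨h1, h2⟩ := right_occupants (q := q) (s := q + 2 - x) (x := x) (y := x + 1) (by omega)
    (by omega) (by omega) (by omega) (by omega) (by omega) (by omega) (by omega)
  unfold rightGames at h
  rw [h1, h2] at h
  dsimp only at h
  rw [if_neg (by omega), if_pos (by omega), if_neg (by rw [Nat.odd_iff]; omega)] at h
  have e1 : 2 * (2 * q + 5) = 4 * q + 10 := by omega
  have e2 : q + 2 - x - 1 = q + 1 - x := by omega
  rwa [e1, e2] at h

theorem right_wrap_subset {q r : ℕ} (hr : 1 ≤ r) (hr' : r ≤ 4) :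
    fourDays (rightType (4 * q + 10) (2 * q + 3) 1 1) (rightType (4 * q + 10) (2 * q + 3) 1 3) r ⊆
      zhaoXiao (4 * q + 10) (4 * q + 4 + r) := by
  have h := rightGames_subset (q := q) (s := q + 2) (by omega) (by omega) hr hr'
  obtain ⟨h1, h2⟩ := right_occupants (q := q) (s := q + 2) (x := 2 * q + 3) (y := 1) (by omega)
    (by omega) (by omega) (by omega) (by omega) (by omega) (by omega) (by omega)
  unfold rightGames at h
  rw [h1, h2] at h
  dsimp only at h
  rw [if_pos (by omega)] at h
  have e1 : 2 * (2 * q + 5) = 4 * q + 10 := by omega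
  have e2 : 4 * (q + 2 - 1) + r = 4 * q + 4 + r := by omega
  rwa [e1, e2] at h

theorem right_high_odd_subset {q x r : ℕ} (hx : q + 2 ≤ x) (hx' : x ≤ 2 * q + 2)
    (hp : x % 2 = 1) (hr : 1 ≤ r) (hr' : r ≤ 4) :
    fourDays (rightType (4 * q + 10) x (x + 1) 1) (rightType (4 * q + 10) x (x + 1) 2) r ⊆
      zhaoXiao (4 * q + 10) (4 * (3 * q + 4 - x) + r) := by
  have h := rightGames_subset (q := q) (s := 3 * q + 5 - x) (by omega) (by omega) hr hr'
  obtain ⟨h1, h2⟩ := right_occupants (q := q) (s := 3 * q + 5 - x) (x := x) (y := x + 1)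
    (by omega) (by omega) (by omega) (by omega) (by omega) (by omega) (by omega) (by omega)
  unfold rightGames at h
  rw [h1, h2] at h
  dsimp only at h
  rw [if_neg (by omega), if_neg (by omega), if_pos (by rw [Nat.odd_iff]; omega)] at h
  have e1 : 2 * (2 * q + 5) = 4 * q + 10 := by omega
  have e2 : 3 * q + 5 - x - 1 = 3 * q + 4 - x := by omega
  rwa [e1, e2] at h

theorem right_high_even_subset {q x r : ℕ} (hx : q + 2 ≤ x) (hx' : x ≤ 2 * q + 2)
    (hp : x % 2 = 0) (hr : 1 ≤ r) (hr' : r ≤ 4) :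
    fourDays (rev (rightType (4 * q + 10) x (x + 1) 3)) (rev (rightType (4 * q + 10) x (x + 1) 4))
      r ⊆ zhaoXiao (4 * q + 10) (4 * (3 * q + 4 - x) + r) := by
  have h := rightGames_subset (q := q) (s := 3 * q + 5 - x) (by omega) (by omega) hr hr'
  obtain ⟨h1, h2⟩ := right_occupants (q := q) (s := 3 * q + 5 - x) (x := x) (y := x + 1)
    (by omega) (by omega) (by omega) (by omega) (by omega) (by omega) (by omega) (by omega)
  unfold rightGames at h
  rw [h1, h2] at h
  dsimp only at h
  rw [if_neg (by omega), if_neg (by omega), if_neg (by rw [Nat.odd_iff]; omega)] at h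
  have e1 : 2 * (2 * q + 5) = 4 * q + 10 := by omega
  have e2 : 3 * q + 5 - x - 1 = 3 * q + 4 - x := by omega
  rwa [e1, e2] at h

theorem lastInner_subset {q h r : ℕ} (hh : 1 ≤ h) (hh' : h ≤ q) (hr : 1 ≤ r) :
    lastInner h r ⊆ zhaoXiao (4 * q + 10) (8 * q + 12 + r) := by
  refine Finset.Subset.trans ?_ (lastGames_subset hr)
  intro g hg
  simp only [lastGames, Finset.mem_union, Finset.mem_biUnion, Finset.mem_Icc]
  exact Or.inl (Or.inl (Or.inl ⟨h, ⟨hh, by omega⟩, hg⟩))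

theorem lastOuter_subset {q r : ℕ} (hr : 1 ≤ r) :
    lastOuter (4 * q + 10) r ⊆ zhaoXiao (4 * q + 10) (8 * q + 12 + r) := by
  refine Finset.Subset.trans ?_ (lastGames_subset hr)
  intro g hg
  simp only [lastGames, Finset.mem_union]
  exact Or.inl (Or.inl (Or.inr hg))

theorem lastMates_mem {q i : ℕ} (hi : 1 ≤ i) (hi' : i ≤ 2 * q + 3) :
    (2 * i, 2 * i - 1) ∈ zhaoXiao (4 * q + 10) (8 * q + 12 + 2) ∧
      (2 * i - 1, 2 * i) ∈ zhaoXiao (4 * q + 10) (8 * q + 12 + 6) := by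
  have h2 := lastGames_subset (q := q) (r := 2) (by omega)
  have h6 := lastGames_subset (q := q) (r := 6) (by omega)
  have e : (4 * q + 10) / 2 - 2 = 2 * q + 3 := by omega
  refine ⟨h2 ?_, h6 ?_⟩ <;>
  · simp only [lastGames, lastMates, Finset.mem_union, Finset.mem_image, Finset.mem_Icc, e]
    exact Or.inl (Or.inr ⟨i, ⟨hi, hi'⟩, rfl⟩)

theorem lastFour_subset {q r : ℕ} (hr : 1 ≤ r) :
    lastFour (4 * q + 10) r ⊆ zhaoXiao (4 * q + 10) (8 * q + 12 + r) := by
  refine Finset.Subset.trans ?_ (lastGames_subset hr)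
  intro g hg
  simp only [lastGames, Finset.mem_union]
  exact Or.inr hg

/-! ### Home and away patterns -/

/-- Team `v` plays on day `k` of the tournament, at home if `h` and away otherwise. -/
def Plays (n k v : ℕ) (h : Bool) : Prop :=
  ∃ u, (if h then (v, u) else (u, v)) ∈ zhaoXiao n k

/-- The home-away pattern of team `v` on the days `k + 1, …, k + 4`. -/
def HasPattern (n k v : ℕ) (a b c d : Bool) : Prop :=
  Plays n (k + 1) v a ∧ Plays n (k + 2) v b ∧ Plays n (k + 3) v c ∧ Plays n (k + 4) v d

theorem plays_home {n k v u : ℕ} (h : (v, u) ∈ zhaoXiao n k) : Plays n k v true := ⟨u, h⟩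

theorem plays_away {n k v u : ℕ} (h : (u, v) ∈ zhaoXiao n k) : Plays n k v false := ⟨u, h⟩

theorem pattern_normal_tail {n k x y v : ℕ}
    (h : ∀ r, 1 ≤ r → r ≤ 4 → normalGames x y r ⊆ zhaoXiao n (k + r))
    (hv : v = 2 * x - 1 ∨ v = 2 * x) : HasPattern n k v false false true true := by
  have h1 := h 1 (by omega) (by omega)
  have h2 := h 2 (by omega) (by omega)
  have h3 := h 3 (by omega) (by omega)
  have h4 := h 4 (by omega) (by omega)
  simp only [normalGames, par, cross, Finset.insert_subset_iff, Finset.singleton_subset_iff]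
    at h1 h2 h3 h4
  rcases hv with rfl | rfl
  · exact ⟨plays_away h1.1, plays_away h2.2, plays_home h3.1, plays_home h4.1⟩
  · exact ⟨plays_away h1.2, plays_away h2.1, plays_home h3.2, plays_home h4.2⟩

theorem pattern_normal_head {n k x y v : ℕ}
    (h : ∀ r, 1 ≤ r → r ≤ 4 → normalGames x y r ⊆ zhaoXiao n (k + r))
    (hv : v = 2 * y - 1 ∨ v = 2 * y) : HasPattern n k v true true false false := by
  have h1 := h 1 (by omega) (by omega)
  have h2 := h 2 (by omega) (by omega)
  have h3 := h 3 (by omega) (by omega)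
  have h4 := h 4 (by omega) (by omega)
  simp only [normalGames, par, cross, Finset.insert_subset_iff, Finset.singleton_subset_iff]
    at h1 h2 h3 h4
  rcases hv with rfl | rfl
  · exact ⟨plays_home h1.1, plays_home h2.1, plays_away h3.1, plays_away h4.2⟩
  · exact ⟨plays_home h1.2, plays_home h2.2, plays_away h3.2, plays_away h4.1⟩

theorem pattern_left_tail {n k x y v : ℕ}
    (h : ∀ r, 1 ≤ r → r ≤ 4 → leftGames x y r ⊆ zhaoXiao n (k + r))
    (hv : v = 2 * x - 1 ∨ v = 2 * x) : HasPattern n k v false true true false := by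
  have h1 := h 1 (by omega) (by omega)
  have h2 := h 2 (by omega) (by omega)
  have h3 := h 3 (by omega) (by omega)
  have h4 := h 4 (by omega) (by omega)
  simp only [leftGames, par, cross, Finset.insert_subset_iff, Finset.singleton_subset_iff]
    at h1 h2 h3 h4
  rcases hv with rfl | rfl
  · exact ⟨plays_away h1.1, plays_home h2.1, plays_home h3.1, plays_away h4.2⟩
  · exact ⟨plays_away h1.2, plays_home h2.2, plays_home h3.2, plays_away h4.1⟩

theorem pattern_left_head {n k x y v : ℕ}
    (h : ∀ r, 1 ≤ r → r ≤ 4 → leftGames x y r ⊆ zhaoXiao n (k + r))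
    (hv : v = 2 * y - 1 ∨ v = 2 * y) : HasPattern n k v true false false true := by
  have h1 := h 1 (by omega) (by omega)
  have h2 := h 2 (by omega) (by omega)
  have h3 := h 3 (by omega) (by omega)
  have h4 := h 4 (by omega) (by omega)
  simp only [leftGames, par, cross, Finset.insert_subset_iff, Finset.singleton_subset_iff]
    at h1 h2 h3 h4
  rcases hv with rfl | rfl
  · exact ⟨plays_home h1.1, plays_away h2.2, plays_away h3.1, plays_home h4.1⟩
  · exact ⟨plays_home h1.2, plays_away h2.1, plays_away h3.2, plays_home h4.2⟩

/-- The games of four days of the types `A`, `B`, reversed `A`, reversed `B`. -/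
theorem fourDays_mem {n k : ℕ} {A B : Finset (ℕ × ℕ)}
    (h : ∀ r, 1 ≤ r → r ≤ 4 → fourDays A B r ⊆ zhaoXiao n (k + r)) :
    (∀ a b, (a, b) ∈ A → (a, b) ∈ zhaoXiao n (k + 1) ∧ (b, a) ∈ zhaoXiao n (k + 3)) ∧
    (∀ a b, (a, b) ∈ B → (a, b) ∈ zhaoXiao n (k + 2) ∧ (b, a) ∈ zhaoXiao n (k + 4)) := by
  have h1 := h 1 (by omega) (by omega)
  have h2 := h 2 (by omega) (by omega)
  have h3 := h 3 (by omega) (by omega)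
  have h4 := h 4 (by omega) (by omega)
  refine ⟨fun a b hab => ⟨h1 hab, h3 ?_⟩, fun a b hab => ⟨h2 hab, h4 ?_⟩⟩ <;>
  · simp only [fourDays, rev, Finset.mem_image]
    exact ⟨(a, b), hab, rfl⟩

theorem fourDays_rev_mem {n k : ℕ} {A B : Finset (ℕ × ℕ)}
    (h : ∀ r, 1 ≤ r → r ≤ 4 → fourDays (rev A) (rev B) r ⊆ zhaoXiao n (k + r)) :
    (∀ a b, (a, b) ∈ A → (b, a) ∈ zhaoXiao n (k + 1) ∧ (a, b) ∈ zhaoXiao n (k + 3)) ∧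
    (∀ a b, (a, b) ∈ B → (b, a) ∈ zhaoXiao n (k + 2) ∧ (a, b) ∈ zhaoXiao n (k + 4)) := by
  obtain ⟨hA, hB⟩ := fourDays_mem h
  have hm : ∀ (C : Finset (ℕ × ℕ)) a b, (a, b) ∈ C → (b, a) ∈ rev C := fun C a b hab => by
    simp only [rev, Finset.mem_image]
    exact ⟨(a, b), hab, rfl⟩
  exact ⟨fun a b hab => hA b a (hm A a b hab), fun a b hab => hB b a (hm B a b hab)⟩

/-- In a right super-game of `x`, `y` and `{n - 1, n}`, played in the four days after day `k`, the
tail `x` plays away, away, home, home, the head `y` plays home, home, away, away, team `n - 1`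
plays away, home, home, away, and team `n` plays home, away, away, home. -/
def RightPatterns (n k x y : ℕ) : Prop :=
  (∀ v, v = 2 * x - 1 ∨ v = 2 * x → HasPattern n k v false false true true) ∧
  (∀ v, v = 2 * y - 1 ∨ v = 2 * y → HasPattern n k v true true false false) ∧
  HasPattern n k (n - 1) false true true false ∧ HasPattern n k n true false false true

theorem rightPatterns_four_three {n k x y : ℕ}
    (h : ∀ r, 1 ≤ r → r ≤ 4 →
      fourDays (rightType n x y 4) (rightType n x y 3) r ⊆ zhaoXiao n (k + r)) :
    RightPatterns n k x y := by
  obtain ⟨hA, hB⟩ := fourDays_mem h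
  have a1 := hA n (2 * x) (by simp [rightType])
  have a2 := hA (2 * y) (2 * x - 1) (by simp [rightType])
  have a3 := hA (2 * y - 1) (n - 1) (by simp [rightType])
  have b1 := hB (n - 1) (2 * x) (by simp [rightType])
  have b2 := hB (2 * y - 1) (2 * x - 1) (by simp [rightType])
  have b3 := hB (2 * y) n (by simp [rightType])
  refine ⟨?_, ?_, ?_, ?_⟩
  · rintro v (rfl | rfl)
    · exact ⟨plays_away a2.1, plays_away b2.1, plays_home a2.2, plays_home b2.2⟩
    · exact ⟨plays_away a1.1, plays_away b1.1, plays_home a1.2, plays_home b1.2⟩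
  · rintro v (rfl | rfl)
    · exact ⟨plays_home a3.1, plays_home b2.1, plays_away a3.2, plays_away b2.2⟩
    · exact ⟨plays_home a2.1, plays_home b3.1, plays_away a2.2, plays_away b3.2⟩
  · exact ⟨plays_away a3.1, plays_home b1.1, plays_home a3.2, plays_away b1.2⟩
  · exact ⟨plays_home a1.1, plays_away b3.1, plays_away a1.2, plays_home b3.2⟩

theorem rightPatterns_one_three {n k x y : ℕ}
    (h : ∀ r, 1 ≤ r → r ≤ 4 →
      fourDays (rightType n x y 1) (rightType n x y 3) r ⊆ zhaoXiao n (k + r)) :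
    RightPatterns n k x y := by
  obtain ⟨hA, hB⟩ := fourDays_mem h
  have a1 := hA n (2 * x - 1) (by simp [rightType])
  have a2 := hA (2 * y) (2 * x) (by simp [rightType])
  have a3 := hA (2 * y - 1) (n - 1) (by simp [rightType])
  have b1 := hB (n - 1) (2 * x) (by simp [rightType])
  have b2 := hB (2 * y - 1) (2 * x - 1) (by simp [rightType])
  have b3 := hB (2 * y) n (by simp [rightType])
  refine ⟨?_, ?_, ?_, ?_⟩
  · rintro v (rfl | rfl)
    · exact ⟨plays_away a1.1, plays_away b2.1, plays_home a1.2, plays_home b2.2⟩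
    · exact ⟨plays_away a2.1, plays_away b1.1, plays_home a2.2, plays_home b1.2⟩
  · rintro v (rfl | rfl)
    · exact ⟨plays_home a3.1, plays_home b2.1, plays_away a3.2, plays_away b2.2⟩
    · exact ⟨plays_home a2.1, plays_home b3.1, plays_away a2.2, plays_away b3.2⟩
  · exact ⟨plays_away a3.1, plays_home b1.1, plays_home a3.2, plays_away b1.2⟩
  · exact ⟨plays_home a1.1, plays_away b3.1, plays_away a1.2, plays_home b3.2⟩

theorem rightPatterns_one_two {n k x y : ℕ}
    (h : ∀ r, 1 ≤ r → r ≤ 4 →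
      fourDays (rightType n x y 1) (rightType n x y 2) r ⊆ zhaoXiao n (k + r)) :
    RightPatterns n k x y := by
  obtain ⟨hA, hB⟩ := fourDays_mem h
  have a1 := hA n (2 * x - 1) (by simp [rightType])
  have a2 := hA (2 * y) (2 * x) (by simp [rightType])
  have a3 := hA (2 * y - 1) (n - 1) (by simp [rightType])
  have b1 := hB (2 * y) (2 * x - 1) (by simp [rightType])
  have b2 := hB (n - 1) (2 * x) (by simp [rightType])
  have b3 := hB (2 * y - 1) n (by simp [rightType])
  refine ⟨?_, ?_, ?_, ?_⟩
  · rintro v (rfl | rfl)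
    · exact ⟨plays_away a1.1, plays_away b1.1, plays_home a1.2, plays_home b1.2⟩
    · exact ⟨plays_away a2.1, plays_away b2.1, plays_home a2.2, plays_home b2.2⟩
  · rintro v (rfl | rfl)
    · exact ⟨plays_home a3.1, plays_home b3.1, plays_away a3.2, plays_away b3.2⟩
    · exact ⟨plays_home a2.1, plays_home b1.1, plays_away a2.2, plays_away b1.2⟩
  · exact ⟨plays_away a3.1, plays_home b2.1, plays_home a3.2, plays_away b2.2⟩
  · exact ⟨plays_home a1.1, plays_away b3.1, plays_away a1.2, plays_home b3.2⟩

theorem rightPatterns_rev_two_one {n k x y : ℕ}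
    (h : ∀ r, 1 ≤ r → r ≤ 4 →
      fourDays (rev (rightType n x y 2)) (rev (rightType n x y 1)) r ⊆ zhaoXiao n (k + r)) :
    RightPatterns n k y x := by
  obtain ⟨hB, hA⟩ := fourDays_rev_mem h
  have a1 := hA n (2 * x - 1) (by simp [rightType])
  have a2 := hA (2 * y) (2 * x) (by simp [rightType])
  have a3 := hA (2 * y - 1) (n - 1) (by simp [rightType])
  have b1 := hB (2 * y) (2 * x - 1) (by simp [rightType])
  have b2 := hB (n - 1) (2 * x) (by simp [rightType])
  have b3 := hB (2 * y - 1) n (by simp [rightType])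
  refine ⟨?_, ?_, ?_, ?_⟩
  · rintro v (rfl | rfl)
    · exact ⟨plays_away b3.1, plays_away a3.1, plays_home b3.2, plays_home a3.2⟩
    · exact ⟨plays_away b1.1, plays_away a2.1, plays_home b1.2, plays_home a2.2⟩
  · rintro v (rfl | rfl)
    · exact ⟨plays_home b1.1, plays_home a1.1, plays_away b1.2, plays_away a1.2⟩
    · exact ⟨plays_home b2.1, plays_home a2.1, plays_away b2.2, plays_away a2.2⟩
  · exact ⟨plays_away b2.1, plays_home a3.1, plays_home b2.2, plays_away a3.2⟩
  · exact ⟨plays_home b3.1, plays_away a1.1, plays_away b3.2, plays_home a1.2⟩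

theorem rightPatterns_rev_three_four {n k x y : ℕ}
    (h : ∀ r, 1 ≤ r → r ≤ 4 →
      fourDays (rev (rightType n x y 3)) (rev (rightType n x y 4)) r ⊆ zhaoXiao n (k + r)) :
    RightPatterns n k y x := by
  obtain ⟨hB, hA⟩ := fourDays_rev_mem h
  have a1 := hA n (2 * x) (by simp [rightType])
  have a2 := hA (2 * y) (2 * x - 1) (by simp [rightType])
  have a3 := hA (2 * y - 1) (n - 1) (by simp [rightType])
  have b1 := hB (n - 1) (2 * x) (by simp [rightType])
  have b2 := hB (2 * y - 1) (2 * x - 1) (by simp [rightType])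
  have b3 := hB (2 * y) n (by simp [rightType])
  refine ⟨?_, ?_, ?_, ?_⟩
  · rintro v (rfl | rfl)
    · exact ⟨plays_away b2.1, plays_away a3.1, plays_home b2.2, plays_home a3.2⟩
    · exact ⟨plays_away b3.1, plays_away a2.1, plays_home b3.2, plays_home a2.2⟩
  · rintro v (rfl | rfl)
    · exact ⟨plays_home b2.1, plays_home a2.1, plays_away b2.2, plays_away a2.2⟩
    · exact ⟨plays_home b1.1, plays_home a1.1, plays_away b1.2, plays_away a1.2⟩
  · exact ⟨plays_away b1.1, plays_home a3.1, plays_home b1.2, plays_away a3.2⟩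
  · exact ⟨plays_home b3.1, plays_away a1.1, plays_away b3.2, plays_home a1.2⟩

/-- The right super-game of slot `s` in terms of the super-team `x` at position `(m - 3) / 2`. -/
theorem exists_rightPatterns {q s : ℕ} (hs : 1 ≤ s) (hs' : s ≤ 2 * q + 3) :
    ∃ x y, (s + x = q + 2 ∨ s + x = 3 * q + 5) ∧ (s + y = q + 3 ∨ s + y = 3 * q + 6) ∧
      1 ≤ x ∧ x ≤ 2 * q + 3 ∧ 1 ≤ y ∧ y ≤ 2 * q + 3 ∧
      ((s + q) % 2 = 0 ∧ RightPatterns (4 * q + 10) (4 * (s - 1)) x y ∨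
        (s + q) % 2 = 1 ∧ RightPatterns (4 * q + 10) (4 * (s - 1)) y x) := by
  -- The pair at the right moves down from (q + 1, q + 2) in slot 1, becomes (2q + 3, 1) in slot q +
  -- 2, and then goes on down to (q + 2, q + 3) in the last of these slots.
  rcases lt_trichotomy s (q + 2) with h | h | h
  · refine ⟨q + 2 - s, q + 2 - s + 1, by omega, by omega, by omega, by omega, by omega, by omega,
      ?_⟩
    have e : q + 1 - (q + 2 - s) = s - 1 := by omega
    rcases Nat.mod_two_eq_zero_or_one (q + 2 - s) with hp | hp
    · refine Or.inl ⟨by omega, rightPatterns_four_three fun r hr hr' => ?_⟩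
      have := right_low_even_subset (q := q) (by omega) (by omega) hp hr hr'
      rwa [e] at this
    · refine Or.inr ⟨by omega, rightPatterns_rev_two_one fun r hr hr' => ?_⟩
      have := right_low_odd_subset (q := q) (by omega) (by omega) hp hr hr'
      rwa [e] at this
  · refine ⟨2 * q + 3, 1, by omega, by omega, by omega, by omega, by omega, by omega, ?_⟩
    refine Or.inl ⟨by omega, rightPatterns_one_three fun r hr hr' => ?_⟩
    have := right_wrap_subset (q := q) hr hr'
    have e : 4 * (s - 1) + r = 4 * q + 4 + r := by omega
    rwa [e]
  · refine ⟨3 * q + 5 - s, 3 * q + 5 - s + 1, by omega, by omega, by omega, by omega, by omega,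
      by omega, ?_⟩
    have e : 3 * q + 4 - (3 * q + 5 - s) = s - 1 := by omega
    rcases Nat.mod_two_eq_zero_or_one (3 * q + 5 - s) with hp | hp
    · refine Or.inr ⟨by omega, rightPatterns_rev_three_four fun r hr hr' => ?_⟩
      have := right_high_even_subset (q := q) (by omega) (by omega) hp hr hr'
      rwa [e] at this
    · refine Or.inl ⟨by omega, rightPatterns_one_two fun r hr hr' => ?_⟩
      have := right_high_odd_subset (q := q) (by omega) (by omega) hp hr hr'
      rwa [e] at this

/-- A super-team at position `p ≤ m - 3` in slot `s` plays away, away, home, home if `p + s` is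
odd, and home, home, away, away otherwise. -/
theorem pattern_of_position {q s p i v : ℕ} (hs : 1 ≤ s) (hs' : s ≤ 2 * q + 3) (hp : 1 ≤ p)
    (hp' : p ≤ 2 * q + 2) (hi : 1 ≤ i) (hi' : i ≤ 2 * q + 3)
    (h : s + i = p + 1 ∨ s + i = p + (2 * q + 4)) (hv : v = 2 * i - 1 ∨ v = 2 * i) :
    ((p + s) % 2 = 1 → HasPattern (4 * q + 10) (4 * (s - 1)) v false false true true) ∧
    ((p + s) % 2 = 0 → HasPattern (4 * q + 10) (4 * (s - 1)) v true true false false) := by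
  by_cases hr : p = q + 1 ∨ p = q + 2
  · obtain ⟨x, y, hx, hy, hx1, hx2, hy1, hy2, hR⟩ := exists_rightPatterns hs hs'
    rcases hr with rfl | rfl
    · have : i = x := by omega
      subst this
      rcases hR with ⟨hpar, hR⟩ | ⟨hpar, hR⟩
      · exact ⟨fun _ => hR.1 v hv, fun _ => by omega⟩
      · exact ⟨fun _ => by omega, fun _ => hR.2.1 v hv⟩
    · have : i = y := by omega
      subst this
      rcases hR with ⟨hpar, hR⟩ | ⟨hpar, hR⟩
      · exact ⟨fun _ => by omega, fun _ => hR.2.1 v hv⟩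
      · exact ⟨fun _ => hR.1 v hv, fun _ => by omega⟩
  · obtain ⟨j, hj1, hj2, hj⟩ : ∃ j, 1 ≤ j ∧ j ≤ 2 * q + 3 ∧
        (s + j = 2 * q + 3 - p + 1 ∨ s + j = 2 * q + 3 - p + (2 * q + 4)) := by
      by_cases hsp : s ≤ 2 * q + 3 - p
      · exact ⟨2 * q + 3 - p + 1 - s, by omega, by omega, by omega⟩
      · exact ⟨2 * q + 3 - p + (2 * q + 4) - s, by omega, by omega, by omega⟩
    by_cases hpq : p ≤ q
    · exact ⟨fun _ => pattern_normal_tail (x := i) (y := j) (fun r h1 h2 => normalGames_subset hs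
        hs' (c := p) (by omega) (by omega) (by omega) hi hi' hj1 hj2 h1 h2) hv,
        fun _ => pattern_normal_head (x := j) (y := i) (fun r h1 h2 => normalGames_subset hs
        hs' (c := p) (by omega) (by omega) (by omega) hj1 hj2 hi hi' h1 h2) hv⟩
    · exact ⟨fun _ => pattern_normal_tail (x := i) (y := j) (fun r h1 h2 => normalGames_subset hs
        hs' (c := 2 * q + 3 - p) (by omega) (by omega) (by omega) hi hi' hj1 hj2 h1 h2) hv,
        fun _ => pattern_normal_head (x := j) (y := i) (fun r h1 h2 => normalGames_subset hs
        hs' (c := 2 * q + 3 - p) (by omega) (by omega) (by omega) hj1 hj2 hi hi' h1 h2) hv⟩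

/-- Three consecutive days with a game at home and a game away. -/
def Mixed (n k v : ℕ) : Prop :=
  ∃ a b c : Bool, Plays n k v a ∧ Plays n (k + 1) v b ∧ Plays n (k + 2) v c ∧ ¬(a = b ∧ b = c)

/-- Team `v` plays in every slot with a pattern without three equal games in a row, with the
status `F s` on the first day and the status `L s` on the last day of slot `s`. -/
structure SlotPatterns (q v : ℕ) (F L : ℕ → Bool) : Prop where
  pattern : ∀ s, 1 ≤ s → s ≤ 2 * q + 3 → ∃ b c, HasPattern (4 * q + 10) (4 * (s - 1)) v (F s) b c
    (L s) ∧ ¬(F s = b ∧ b = c) ∧ ¬(b = c ∧ c = L s)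
  switch : ∀ s, 1 ≤ s → s ≤ 2 * q + 2 → L s = ! F (s + 1)

/-- From one slot to the next both the position and the slot number grow by one, so the parity that
fixes the direction of the edge persists until the super-team reaches position m − 2 in slot 2q + 4
− i. It plays AAHH before, AHHA there, and HHAA afterwards, because the wrap to position 1 changes
the parity. The left super-game is what makes this turn possible. -/
theorem slotPatterns_even {q i v : ℕ} (hi : 1 ≤ i) (hi' : i ≤ 2 * q + 3) (hpar : i % 2 = 0)
    (hv : v = 2 * i - 1 ∨ v = 2 * i) :
    SlotPatterns q v (fun s => decide (2 * q + 5 ≤ i + s)) (fun s => decide (i + s ≤ 2 * q + 3)) where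
  switch := fun s _ _ => by
    by_cases h : i + s ≤ 2 * q + 3
    · simp [h, show ¬ (2 * q + 5 ≤ i + (s + 1)) by omega]
    · simp [h, show 2 * q + 5 ≤ i + (s + 1) by omega]
  pattern := fun s hs hs' => by
    rcases lt_trichotomy (i + s) (2 * q + 4) with h | h | h
    · have h1 : decide (2 * q + 5 ≤ i + s) = false := by simp; omega
      have h2 : decide (i + s ≤ 2 * q + 3) = true := by simp; omega
      rw [h1, h2]
      exact ⟨false, true, (pattern_of_position (p := i + s - 1) hs hs' (by omega) (by omega) hi hi'
        (by omega) hv).1 (by omega), by decide, by decide⟩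
    · have h1 : decide (2 * q + 5 ≤ i + s) = false := by simp; omega
      have h2 : decide (i + s ≤ 2 * q + 3) = false := by simp; omega
      rw [h1, h2]
      refine ⟨true, true, pattern_left_tail (x := i) (y := 2 * q + 4) (fun r hr hr' => ?_) hv,
        by decide, by decide⟩
      have := leftmost_even_subset (q := q) hi (by omega) hpar hr hr'
      rwa [show 2 * q + 3 - i = s - 1 by omega] at this
    · have h1 : decide (2 * q + 5 ≤ i + s) = true := by simp; omega
      have h2 : decide (i + s ≤ 2 * q + 3) = false := by simp; omega
      rw [h1, h2]
      exact ⟨true, false, (pattern_of_position (p := i + s - (2 * q + 4)) hs hs' (by omega)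
        (by omega) hi hi' (by omega) hv).2 (by omega), by decide, by decide⟩

/-- The mirror image of the even case: HHAA, then HAAH as the head of the left super-game, then
AAHH. -/
theorem slotPatterns_odd {q i v : ℕ} (hi : 2 ≤ i) (hi' : i ≤ 2 * q + 2) (hpar : i % 2 = 1)
    (hv : v = 2 * i - 1 ∨ v = 2 * i) :
    SlotPatterns q v (fun s => decide (i + s ≤ 2 * q + 4)) (fun s => decide (2 * q + 4 ≤ i + s)) where
  switch := fun s _ _ => by
    by_cases h : 2 * q + 4 ≤ i + s
    · simp [h, show ¬ (i + (s + 1) ≤ 2 * q + 4) by omega]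
    · simp [h, show i + (s + 1) ≤ 2 * q + 4 by omega]
  pattern := fun s hs hs' => by
    rcases lt_trichotomy (i + s) (2 * q + 4) with h | h | h
    · have h1 : decide (i + s ≤ 2 * q + 4) = true := by simp; omega
      have h2 : decide (2 * q + 4 ≤ i + s) = false := by simp; omega
      rw [h1, h2]
      exact ⟨true, false, (pattern_of_position (p := i + s - 1) hs hs' (by omega) (by omega)
        (by omega) (by omega) (by omega) hv).2 (by omega), by decide, by decide⟩
    · have h1 : decide (i + s ≤ 2 * q + 4) = true := by simp; omega
      have h2 : decide (2 * q + 4 ≤ i + s) = true := by simp; omega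
      rw [h1, h2]
      refine ⟨false, false, pattern_left_head (x := 2 * q + 4) (y := i) (fun r hr hr' => ?_) hv,
        by decide, by decide⟩
      have := leftmost_odd_subset (q := q) hi (by omega) hpar hr hr'
      rwa [show 2 * q + 3 - i = s - 1 by omega] at this
    · have h1 : decide (i + s ≤ 2 * q + 4) = false := by simp; omega
      have h2 : decide (2 * q + 4 ≤ i + s) = true := by simp; omega
      rw [h1, h2]
      exact ⟨false, true, (pattern_of_position (p := i + s - (2 * q + 4)) hs hs' (by omega)
        (by omega) (by omega) (by omega) (by omega) hv).1 (by omega), by decide, by decide⟩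

/-- This super-team starts at position m − 2 and afterwards always has odd position plus slot, so it
plays AAHH throughout. A left super-game with the same edge would end with an away game before two
more of them; hence the normal super-game in slot 1. -/
theorem slotPatterns_top {q v : ℕ} (hv : v = 4 * q + 5 ∨ v = 4 * q + 6) :
    SlotPatterns q v (fun _ => false) (fun _ => true) where
  switch := fun s _ _ => rfl
  pattern := fun s hs hs' => by
    refine ⟨false, true, ?_, by decide, by decide⟩
    rcases Nat.lt_or_ge s 2 with h | h
    · obtain rfl : s = 1 := by omega
      exact pattern_normal_tail (x := 2 * q + 3) (y := 2 * q + 4) (fun r hr hr' => by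
        have := leftmost_normal_subset (q := q) hr hr'
        simpa using this) (by omega)
    · exact (pattern_of_position (p := s - 1) (i := 2 * q + 3) hs hs' (by omega) (by omega)
        (by omega) (by omega) (by omega) (by omega)).1 (by omega)

/-- The games of the special left super-game. -/
theorem specialLeft_mem (q : ℕ) :
    ((1, 4 * q + 7) ∈ zhaoXiao (4 * q + 10) (8 * q + 9) ∧
      (2, 4 * q + 8) ∈ zhaoXiao (4 * q + 10) (8 * q + 9)) ∧
    ((2, 4 * q + 7) ∈ zhaoXiao (4 * q + 10) (8 * q + 10) ∧
      (4 * q + 8, 1) ∈ zhaoXiao (4 * q + 10) (8 * q + 10)) ∧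
    ((4 * q + 7, 1) ∈ zhaoXiao (4 * q + 10) (8 * q + 11) ∧
      (4 * q + 8, 2) ∈ zhaoXiao (4 * q + 10) (8 * q + 11)) ∧
    ((4 * q + 7, 2) ∈ zhaoXiao (4 * q + 10) (8 * q + 12) ∧
      (1, 4 * q + 8) ∈ zhaoXiao (4 * q + 10) (8 * q + 12)) := by
  have h := fun r hr hr' => leftmost_special_subset (q := q) (r := r) hr hr'
  have h1 := h 1 (by omega) (by omega)
  have h2 := h 2 (by omega) (by omega)
  have h3 := h 3 (by omega) (by omega)
  have h4 := h 4 (by omega) (by omega)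
  simp only [specialLeftGames, Finset.insert_subset_iff, Finset.singleton_subset_iff]
    at h1 h2 h3 h4
  exact ⟨h1, h2, h3, h4⟩

theorem slotPatterns_one {q : ℕ} :
    SlotPatterns q 1 (fun _ => true) (fun s => decide (s = 2 * q + 3)) where
  switch := fun s _ _ => by simp; omega
  pattern := fun s hs hs' => by
    rcases Nat.lt_or_ge s (2 * q + 3) with h | h
    · have h1 : decide (s = 2 * q + 3) = false := by simp; omega
      rw [h1]
      exact ⟨true, false, (pattern_of_position (p := s) (i := 1) hs hs' (by omega) (by omega)
        (by omega) (by omega) (by omega) (by omega)).2 (by omega), by decide, by decide⟩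
    · have h1 : decide (s = 2 * q + 3) = true := by simp; omega
      rw [h1]
      obtain ⟨a, b, c, d⟩ := specialLeft_mem q
      refine ⟨false, false, ?_, by decide, by decide⟩
      rw [show 4 * (s - 1) = 8 * q + 8 by omega]
      exact ⟨plays_home a.1, plays_away b.2, plays_away c.1, plays_home d.2⟩

/-- The reversed games of team n − 3 are those against team 2. They give team 2 the pattern HHAA in
slot m − 2; with HAAH it would have three home games in a row, as the last slot starts with two. -/
theorem slotPatterns_two {q : ℕ} :
    SlotPatterns q 2 (fun _ => true) (fun _ => false) where
  switch := fun s _ _ => rfl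
  pattern := fun s hs hs' => by
    refine ⟨true, false, ?_, by decide, by decide⟩
    rcases Nat.lt_or_ge s (2 * q + 3) with h | h
    · exact (pattern_of_position (p := s) (i := 1) hs hs' (by omega) (by omega)
        (by omega) (by omega) (by omega) (by omega)).2 (by omega)
    · obtain ⟨a, b, c, d⟩ := specialLeft_mem q
      rw [show 4 * (s - 1) = 8 * q + 8 by omega]
      exact ⟨plays_home a.2, plays_home b.1, plays_away c.2, plays_away d.1⟩

theorem pattern_leftmost {q s v : ℕ} (hs : 1 ≤ s) (hs' : s ≤ 2 * q + 2)
    (hv : v = 4 * q + 7 ∨ v = 4 * q + 8) :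
    ∃ b c, HasPattern (4 * q + 10) (4 * (s - 1)) v (decide (s = 1 ∨ s % 2 = 0)) b c
      (decide (s % 2 = 0)) ∧ ¬(decide (s = 1 ∨ s % 2 = 0) = b ∧ b = c) ∧
      ¬(b = c ∧ c = decide (s % 2 = 0)) := by
  rcases Nat.lt_or_ge s 2 with h | h
  · obtain rfl : s = 1 := by omega
    exact ⟨true, false, pattern_normal_head (x := 2 * q + 3) (y := 2 * q + 4) (fun r hr hr' => by
      have := leftmost_normal_subset (q := q) hr hr'
      simpa using this) (by omega), by decide, by decide⟩
  · have e : 2 * q + 3 - (2 * q + 4 - s) = s - 1 := by omega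
    rcases Nat.mod_two_eq_zero_or_one s with hp | hp
    · have h1 : decide (s = 1 ∨ s % 2 = 0) = true := by simp; omega
      have h2 : decide (s % 2 = 0) = true := by simp; omega
      rw [h1, h2]
      refine ⟨false, false, pattern_left_head (x := 2 * q + 4 - s) (y := 2 * q + 4)
        (fun r hr hr' => ?_) (by omega), by decide, by decide⟩
      have := leftmost_even_subset (q := q) (i := 2 * q + 4 - s) (by omega) (by omega) (by omega)
        hr hr'
      rwa [e] at this
    · have h1 : decide (s = 1 ∨ s % 2 = 0) = false := by simp; omega
      have h2 : decide (s % 2 = 0) = false := by simp; omega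
      rw [h1, h2]
      refine ⟨true, true, pattern_left_tail (x := 2 * q + 4) (y := 2 * q + 4 - s)
        (fun r hr hr' => ?_) (by omega), by decide, by decide⟩
      have := leftmost_odd_subset (q := q) (i := 2 * q + 4 - s) (by omega) (by omega) (by omega)
        hr hr'
      rwa [e] at this

theorem slotPatterns_fourth_last {q : ℕ} :
    SlotPatterns q (4 * q + 7) (fun s => decide (s = 1 ∨ s % 2 = 0))
      (fun s => decide (s % 2 = 0 ∨ s = 2 * q + 3)) where
  switch := fun s h1 h2 => by
    rcases Nat.mod_two_eq_zero_or_one s with hp | hp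
    · simp [hp, show ¬ (s = 0 ∨ (s + 1) % 2 = 0) by omega]
    · simp [hp, show ¬ (s = 2 * q + 3) by omega, show (s + 1) % 2 = 0 by omega]
  pattern := fun s hs hs' => by
    rcases Nat.lt_or_ge s (2 * q + 3) with h | h
    · have := pattern_leftmost (q := q) (v := 4 * q + 7) hs (by omega) (by omega)
      have e : decide (s % 2 = 0 ∨ s = 2 * q + 3) = decide (s % 2 = 0) := by
        simp; omega
      rwa [e]
    · have h1 : decide (s = 1 ∨ s % 2 = 0) = false := by simp; omega
      have h2 : decide (s % 2 = 0 ∨ s = 2 * q + 3) = true := by simp; omega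
      rw [h1, h2]
      obtain ⟨a, b, c, d⟩ := specialLeft_mem q
      refine ⟨false, true, ?_, by decide, by decide⟩
      rw [show 4 * (s - 1) = 8 * q + 8 by omega]
      exact ⟨plays_away a.1, plays_away b.1, plays_home c.1, plays_home d.1⟩

theorem slotPatterns_third_last {q : ℕ} :
    SlotPatterns q (4 * q + 8) (fun s => decide (s = 1 ∨ s % 2 = 0))
      (fun s => decide (s % 2 = 0)) where
  switch := fun s h1 h2 => by
    rcases Nat.mod_two_eq_zero_or_one s with hp | hp
    · simp [hp, show ¬ (s = 0 ∨ (s + 1) % 2 = 0) by omega]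
    · simp [hp, show (s + 1) % 2 = 0 by omega]
  pattern := fun s hs hs' => by
    rcases Nat.lt_or_ge s (2 * q + 3) with h | h
    · exact pattern_leftmost hs (by omega) (by omega)
    · have h1 : decide (s = 1 ∨ s % 2 = 0) = false := by simp; omega
      have h2 : decide (s % 2 = 0) = false := by simp; omega
      rw [h1, h2]
      obtain ⟨a, b, c, d⟩ := specialLeft_mem q
      refine ⟨true, true, ?_, by decide, by decide⟩
      rw [show 4 * (s - 1) = 8 * q + 8 by omega]
      exact ⟨plays_away a.2, plays_home b.2, plays_home c.2, plays_away d.2⟩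

theorem pattern_right {q s : ℕ} (hs : 1 ≤ s) (hs' : s ≤ 2 * q + 3) :
    HasPattern (4 * q + 10) (4 * (s - 1)) (4 * q + 9) false true true false ∧
      HasPattern (4 * q + 10) (4 * (s - 1)) (4 * q + 10) true false false true := by
  obtain ⟨x, y, -, -, -, -, -, -, ⟨-, h⟩ | ⟨-, h⟩⟩ := exists_rightPatterns hs hs'
  · exact ⟨h.2.2.1, h.2.2.2⟩
  · exact ⟨h.2.2.1, h.2.2.2⟩

/-! ### The last slot -/

theorem lastInner_mem {q h : ℕ} (hh : 1 ≤ h) (hh' : h ≤ q) :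
    ((4 * h + 3, 4 * h + 1) ∈ zhaoXiao (4 * q + 10) (8 * q + 13) ∧
      (4 * h, 4 * h + 2) ∈ zhaoXiao (4 * q + 10) (8 * q + 13)) ∧
    ((4 * h + 1, 4 * h) ∈ zhaoXiao (4 * q + 10) (8 * q + 15) ∧
      (4 * h + 3, 4 * h + 2) ∈ zhaoXiao (4 * q + 10) (8 * q + 15)) ∧
    ((4 * h + 1, 4 * h + 3) ∈ zhaoXiao (4 * q + 10) (8 * q + 16) ∧
      (4 * h + 2, 4 * h) ∈ zhaoXiao (4 * q + 10) (8 * q + 16)) ∧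
    ((4 * h, 4 * h + 1) ∈ zhaoXiao (4 * q + 10) (8 * q + 17) ∧
      (4 * h + 2, 4 * h + 3) ∈ zhaoXiao (4 * q + 10) (8 * q + 17)) := by
  have h1 := lastInner_subset (r := 1) hh hh' (by omega)
  have h3 := lastInner_subset (r := 3) hh hh' (by omega)
  have h4 := lastInner_subset (r := 4) hh hh' (by omega)
  have h5 := lastInner_subset (r := 5) hh hh' (by omega)
  simp only [lastInner, Finset.insert_subset_iff, Finset.singleton_subset_iff] at h1 h3 h4 h5
  exact ⟨h1, h3, h4, h5⟩

theorem lastOuter_mem (q : ℕ) :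
    ((3, 1) ∈ zhaoXiao (4 * q + 10) (8 * q + 13) ∧
      (4 * q + 4, 4 * q + 6) ∈ zhaoXiao (4 * q + 10) (8 * q + 13) ∧
      (2, 4 * q + 5) ∈ zhaoXiao (4 * q + 10) (8 * q + 13)) ∧
    ((3, 2) ∈ zhaoXiao (4 * q + 10) (8 * q + 15) ∧
      (4 * q + 5, 4 * q + 4) ∈ zhaoXiao (4 * q + 10) (8 * q + 15) ∧
      (1, 4 * q + 6) ∈ zhaoXiao (4 * q + 10) (8 * q + 15)) ∧
    ((1, 3) ∈ zhaoXiao (4 * q + 10) (8 * q + 16) ∧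
      (4 * q + 6, 4 * q + 4) ∈ zhaoXiao (4 * q + 10) (8 * q + 16) ∧
      (4 * q + 5, 2) ∈ zhaoXiao (4 * q + 10) (8 * q + 16)) ∧
    ((2, 3) ∈ zhaoXiao (4 * q + 10) (8 * q + 17) ∧
      (4 * q + 4, 4 * q + 5) ∈ zhaoXiao (4 * q + 10) (8 * q + 17) ∧
      (4 * q + 6, 1) ∈ zhaoXiao (4 * q + 10) (8 * q + 17)) := by
  have h1 := lastOuter_subset (q := q) (r := 1) (by omega)
  have h3 := lastOuter_subset (q := q) (r := 3) (by omega)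
  have h4 := lastOuter_subset (q := q) (r := 4) (by omega)
  have h5 := lastOuter_subset (q := q) (r := 5) (by omega)
  simp only [lastOuter, Finset.insert_subset_iff, Finset.singleton_subset_iff] at h1 h3 h4 h5
  exact ⟨h1, h3, h4, h5⟩

theorem lastFour_mem (q : ℕ) :
    ((4 * q + 8, 4 * q + 7) ∈ zhaoXiao (4 * q + 10) (8 * q + 13) ∧
      (4 * q + 10, 4 * q + 9) ∈ zhaoXiao (4 * q + 10) (8 * q + 13)) ∧
    ((4 * q + 7, 4 * q + 10) ∈ zhaoXiao (4 * q + 10) (8 * q + 14) ∧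
      (4 * q + 9, 4 * q + 8) ∈ zhaoXiao (4 * q + 10) (8 * q + 14)) ∧
    ((4 * q + 10, 4 * q + 8) ∈ zhaoXiao (4 * q + 10) (8 * q + 15) ∧
      (4 * q + 7, 4 * q + 9) ∈ zhaoXiao (4 * q + 10) (8 * q + 15)) ∧
    ((4 * q + 10, 4 * q + 7) ∈ zhaoXiao (4 * q + 10) (8 * q + 16) ∧
      (4 * q + 8, 4 * q + 9) ∈ zhaoXiao (4 * q + 10) (8 * q + 16)) ∧
    ((4 * q + 9, 4 * q + 7) ∈ zhaoXiao (4 * q + 10) (8 * q + 17) ∧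
      (4 * q + 8, 4 * q + 10) ∈ zhaoXiao (4 * q + 10) (8 * q + 17)) ∧
    ((4 * q + 7, 4 * q + 8) ∈ zhaoXiao (4 * q + 10) (8 * q + 18) ∧
      (4 * q + 9, 4 * q + 10) ∈ zhaoXiao (4 * q + 10) (8 * q + 18)) := by
  have h1 := lastFour_subset (q := q) (r := 1) (by omega)
  have h2 := lastFour_subset (q := q) (r := 2) (by omega)
  have h3 := lastFour_subset (q := q) (r := 3) (by omega)
  have h4 := lastFour_subset (q := q) (r := 4) (by omega)
  have h5 := lastFour_subset (q := q) (r := 5) (by omega)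
  have h6 := lastFour_subset (q := q) (r := 6) (by omega)
  simp only [lastFour, Finset.insert_subset_iff, Finset.singleton_subset_iff] at h1 h2 h3 h4 h5 h6
  exact ⟨h1, h2, h3, h4, h5, h6⟩

/-- Team `v` plays in the last slot with a pattern without three equal games in a row, with the
status `a` on the first day. -/
def HasLastPattern (q v : ℕ) (a : Bool) : Prop :=
  ∃ b c d e f, Plays (4 * q + 10) (8 * q + 13) v a ∧ Plays (4 * q + 10) (8 * q + 14) v b ∧
    Plays (4 * q + 10) (8 * q + 15) v c ∧ Plays (4 * q + 10) (8 * q + 16) v d ∧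
    Plays (4 * q + 10) (8 * q + 17) v e ∧ Plays (4 * q + 10) (8 * q + 18) v f ∧
    ¬(a = b ∧ b = c) ∧ ¬(b = c ∧ c = d) ∧ ¬(c = d ∧ d = e) ∧ ¬(d = e ∧ e = f)

theorem lastPattern_zero {q h : ℕ} (hh : 1 ≤ h) (hh' : h ≤ q) :
    HasLastPattern q (4 * h) true := by
  obtain ⟨⟨a1, a2⟩, ⟨b1, b2⟩, ⟨c1, c2⟩, ⟨d1, d2⟩⟩ := lastInner_mem hh hh'
  obtain ⟨e1, e2⟩ := lastMates_mem (q := q) (i := 2 * h) (by omega) (by omega)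
  rw [show 2 * (2 * h) = 4 * h by omega] at e1 e2
  exact ⟨true, false, false, true, false, plays_home a2, plays_home e1, plays_away b1,
    plays_away c2, plays_home d1, plays_away e2, by decide, by decide, by decide, by decide⟩

theorem lastPattern_one {q h : ℕ} (hh : 1 ≤ h) (hh' : h ≤ q) :
    HasLastPattern q (4 * h + 1) false := by
  obtain ⟨⟨a1, a2⟩, ⟨b1, b2⟩, ⟨c1, c2⟩, ⟨d1, d2⟩⟩ := lastInner_mem hh hh'
  obtain ⟨e1, e2⟩ := lastMates_mem (q := q) (i := 2 * h + 1) (by omega) (by omega)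
  rw [show 2 * (2 * h + 1) - 1 = 4 * h + 1 by omega] at e1 e2
  exact ⟨false, true, true, false, true, plays_away a1, plays_away e1, plays_home b1,
    plays_home c1, plays_away d1, plays_home e2, by decide, by decide, by decide, by decide⟩

theorem lastPattern_two {q h : ℕ} (hh : 1 ≤ h) (hh' : h ≤ q) :
    HasLastPattern q (4 * h + 2) false := by
  obtain ⟨⟨a1, a2⟩, ⟨b1, b2⟩, ⟨c1, c2⟩, ⟨d1, d2⟩⟩ := lastInner_mem hh hh'
  obtain ⟨e1, e2⟩ := lastMates_mem (q := q) (i := 2 * h + 1) (by omega) (by omega)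
  rw [show 2 * (2 * h + 1) = 4 * h + 2 by omega] at e1 e2
  exact ⟨true, false, true, true, false, plays_away a2, plays_home e1, plays_away b2,
    plays_home c2, plays_home d2, plays_away e2, by decide, by decide, by decide, by decide⟩

theorem lastPattern_three {q h : ℕ} (hh : 1 ≤ h) (hh' : h ≤ q) :
    HasLastPattern q (4 * h + 3) true := by
  obtain ⟨⟨a1, a2⟩, ⟨b1, b2⟩, ⟨c1, c2⟩, ⟨d1, d2⟩⟩ := lastInner_mem hh hh'
  obtain ⟨e1, e2⟩ := lastMates_mem (q := q) (i := 2 * h + 2) (by omega) (by omega)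
  rw [show 2 * (2 * h + 2) - 1 = 4 * h + 3 by omega] at e1 e2
  exact ⟨false, true, false, false, true, plays_home a1, plays_away e1, plays_home b2,
    plays_away c1, plays_away d2, plays_home e2, by decide, by decide, by decide, by decide⟩

theorem lastPattern_team_one {q : ℕ} : HasLastPattern q 1 false := by
  obtain ⟨⟨a1, a2, a3⟩, ⟨b1, b2, b3⟩, ⟨c1, c2, c3⟩, ⟨d1, d2, d3⟩⟩ := lastOuter_mem q
  obtain ⟨e1, e2⟩ := lastMates_mem (q := q) (i := 1) (by omega) (by omega)
  exact ⟨false, true, true, false, true, plays_away a1, plays_away e1, plays_home b3,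
    plays_home c1, plays_away d3, plays_home e2, by decide, by decide, by decide, by decide⟩

theorem lastPattern_team_two {q : ℕ} : HasLastPattern q 2 true := by
  obtain ⟨⟨a1, a2, a3⟩, ⟨b1, b2, b3⟩, ⟨c1, c2, c3⟩, ⟨d1, d2, d3⟩⟩ := lastOuter_mem q
  obtain ⟨e1, e2⟩ := lastMates_mem (q := q) (i := 1) (by omega) (by omega)
  exact ⟨true, false, false, true, false, plays_home a3, plays_home e1, plays_away b1,
    plays_away c3, plays_home d1, plays_away e2, by decide, by decide, by decide, by decide⟩

theorem lastPattern_team_three {q : ℕ} : HasLastPattern q 3 true := by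
  obtain ⟨⟨a1, a2, a3⟩, ⟨b1, b2, b3⟩, ⟨c1, c2, c3⟩, ⟨d1, d2, d3⟩⟩ := lastOuter_mem q
  obtain ⟨e1, e2⟩ := lastMates_mem (q := q) (i := 2) (by omega) (by omega)
  exact ⟨false, true, false, false, true, plays_home a1, plays_away e1, plays_home b1,
    plays_away c1, plays_away d1, plays_home e2, by decide, by decide, by decide, by decide⟩

theorem lastPattern_seventh_last {q : ℕ} : HasLastPattern q (4 * q + 4) true := by
  obtain ⟨⟨a1, a2, a3⟩, ⟨b1, b2, b3⟩, ⟨c1, c2, c3⟩, ⟨d1, d2, d3⟩⟩ := lastOuter_mem q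
  obtain ⟨e1, e2⟩ := lastMates_mem (q := q) (i := 2 * q + 2) (by omega) (by omega)
  rw [show 2 * (2 * q + 2) = 4 * q + 4 by omega] at e1 e2
  exact ⟨true, false, false, true, false, plays_home a2, plays_home e1, plays_away b2,
    plays_away c2, plays_home d2, plays_away e2, by decide, by decide, by decide, by decide⟩

theorem lastPattern_sixth_last {q : ℕ} : HasLastPattern q (4 * q + 5) false := by
  obtain ⟨⟨a1, a2, a3⟩, ⟨b1, b2, b3⟩, ⟨c1, c2, c3⟩, ⟨d1, d2, d3⟩⟩ := lastOuter_mem q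
  obtain ⟨e1, e2⟩ := lastMates_mem (q := q) (i := 2 * q + 3) (by omega) (by omega)
  rw [show 2 * (2 * q + 3) - 1 = 4 * q + 5 by omega] at e1 e2
  exact ⟨false, true, true, false, true, plays_away a3, plays_away e1, plays_home b2,
    plays_home c3, plays_away d2, plays_home e2, by decide, by decide, by decide, by decide⟩

theorem lastPattern_fifth_last {q : ℕ} : HasLastPattern q (4 * q + 6) false := by
  obtain ⟨⟨a1, a2, a3⟩, ⟨b1, b2, b3⟩, ⟨c1, c2, c3⟩, ⟨d1, d2, d3⟩⟩ := lastOuter_mem q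
  obtain ⟨e1, e2⟩ := lastMates_mem (q := q) (i := 2 * q + 3) (by omega) (by omega)
  rw [show 2 * (2 * q + 3) = 4 * q + 6 by omega] at e1 e2
  exact ⟨true, false, true, true, false, plays_away a2, plays_home e1, plays_away b3,
    plays_home c2, plays_home d3, plays_away e2, by decide, by decide, by decide, by decide⟩

theorem lastPattern_fourth_last {q : ℕ} : HasLastPattern q (4 * q + 7) false := by
  obtain ⟨a, b, c, d, e, f⟩ := lastFour_mem q
  exact ⟨true, true, false, false, true, plays_away a.1, plays_home b.1, plays_home c.2,
    plays_away d.1, plays_away e.1, plays_home f.1, by decide, by decide, by decide, by decide⟩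

theorem lastPattern_third_last {q : ℕ} : HasLastPattern q (4 * q + 8) true := by
  obtain ⟨a, b, c, d, e, f⟩ := lastFour_mem q
  exact ⟨false, false, true, true, false, plays_home a.1, plays_away b.2, plays_away c.1,
    plays_home d.2, plays_home e.2, plays_away f.1, by decide, by decide, by decide, by decide⟩

/-- Team `v` plays on every day, and never three times in a row at home or away. -/
def PlaysWell (q v : ℕ) : Prop :=
  (∀ k, 1 ≤ k → k ≤ 8 * q + 18 → ∃ h, Plays (4 * q + 10) k v h) ∧
    ∀ k, 1 ≤ k → k ≤ 8 * q + 16 → Mixed (4 * q + 10) k v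

/-- The conditions across slot boundaries are kept general because of the last two teams: they do
not alternate at a boundary and rely on the second game before or after it instead. -/
theorem playsWell_of_patterns {q v : ℕ} {F L : ℕ → Bool} {a : Bool}
    (hpat : ∀ s, 1 ≤ s → s ≤ 2 * q + 3 → ∃ b c, HasPattern (4 * q + 10) (4 * (s - 1)) v (F s) b c
      (L s) ∧ ¬(F s = b ∧ b = c) ∧ ¬(b = c ∧ c = L s) ∧
      (∀ s', s' = s + 1 → s' ≤ 2 * q + 3 → ¬(c = L s ∧ L s = F s')) ∧
      (s = 2 * q + 3 → ¬(c = L s ∧ L s = a)))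
    (hpat' : ∀ s, 1 ≤ s → s ≤ 2 * q + 2 → ∃ b c, HasPattern (4 * q + 10) (4 * s) v (F (s + 1)) b c
      (L (s + 1)) ∧ ¬(L s = F (s + 1) ∧ F (s + 1) = b))
    (hlast : ∃ b c d e f, Plays (4 * q + 10) (8 * q + 13) v a ∧
      Plays (4 * q + 10) (8 * q + 14) v b ∧
      Plays (4 * q + 10) (8 * q + 15) v c ∧ Plays (4 * q + 10) (8 * q + 16) v d ∧
      Plays (4 * q + 10) (8 * q + 17) v e ∧ Plays (4 * q + 10) (8 * q + 18) v f ∧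
      ¬(a = b ∧ b = c) ∧ ¬(b = c ∧ c = d) ∧ ¬(c = d ∧ d = e) ∧ ¬(d = e ∧ e = f) ∧
      ¬(L (2 * q + 3) = a ∧ a = b)) : PlaysWell q v := by
  obtain ⟨b, c, d, e, f, h1, h2, h3, h4, h5, h6, n1, n2, n3, n4, n5⟩ := hlast
  have split : ∀ k, 1 ≤ k → k ≤ 8 * q + 12 → ∃ s r, 1 ≤ s ∧ s ≤ 2 * q + 3 ∧ 1 ≤ r ∧ r ≤ 4 ∧
      k = 4 * (s - 1) + r := fun k hk hk' =>
    ⟨(k - 1) / 4 + 1, (k - 1) % 4 + 1, by omega, by omega, by omega, by omega, by omega⟩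
  constructor
  · intro k hk hk'
    by_cases hkl : k ≤ 8 * q + 12
    · obtain ⟨s, r, hs, hs', hr, hr', rfl⟩ := split k hk hkl
      obtain ⟨b, c, ⟨p1, p2, p3, p4⟩, -⟩ := hpat s hs hs'
      interval_cases r
      exacts [⟨_, p1⟩, ⟨_, p2⟩, ⟨_, p3⟩, ⟨_, p4⟩]
    · obtain ⟨r, rfl⟩ : ∃ r, k = 8 * q + 12 + r := ⟨k - (8 * q + 12), by omega⟩
      have : 1 ≤ r := by omega
      have : r ≤ 6 := by omega
      interval_cases r
      exacts [⟨_, h1⟩, ⟨_, h2⟩, ⟨_, h3⟩, ⟨_, h4⟩, ⟨_, h5⟩, ⟨_, h6⟩]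
  · intro k hk hk'
    by_cases hkl : k ≤ 8 * q + 12
    · obtain ⟨s, r, hs, hs', hr, hr', rfl⟩ := split k hk hkl
      obtain ⟨b', c', ⟨p1, p2, p3, p4⟩, m1, m2, m3, m4⟩ := hpat s hs hs'
      by_cases hsl : s ≤ 2 * q + 2
      · obtain ⟨b'', c'', ⟨p5, p6, -⟩, m5⟩ := hpat' s hs hsl
        rw [show 4 * s = 4 * (s - 1) + 4 by omega] at p5 p6
        interval_cases r
        exacts [⟨_, _, _, p1, p2, p3, m1⟩, ⟨_, _, _, p2, p3, p4, m2⟩,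
          ⟨_, _, _, p3, p4, p5, m3 _ rfl (by omega)⟩, ⟨_, _, _, p4, p5, p6, m5⟩]
      · obtain rfl : s = 2 * q + 3 := by omega
        rw [show 8 * q + 13 = 4 * (2 * q + 3 - 1) + 5 by omega] at h1
        rw [show 8 * q + 14 = 4 * (2 * q + 3 - 1) + 6 by omega] at h2
        interval_cases r
        exacts [⟨_, _, _, p1, p2, p3, m1⟩, ⟨_, _, _, p2, p3, p4, m2⟩,
          ⟨_, _, _, p3, p4, h1, m4 rfl⟩, ⟨_, _, _, p4, h1, h2, n5⟩]
    · obtain ⟨r, rfl⟩ : ∃ r, k = 8 * q + 12 + r := ⟨k - (8 * q + 12), by omega⟩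
      have : 1 ≤ r := by omega
      have : r ≤ 4 := by omega
      interval_cases r
      exacts [⟨_, _, _, h1, h2, h3, n1⟩, ⟨_, _, _, h2, h3, h4, n2⟩, ⟨_, _, _, h3, h4, h5, n3⟩,
        ⟨_, _, _, h4, h5, h6, n4⟩]

theorem SlotPatterns.playsWell {q v : ℕ} {F L : ℕ → Bool} (h : SlotPatterns q v F L) {a : Bool}
    (hL : L (2 * q + 3) = ! a) (ha : HasLastPattern q v a) : PlaysWell q v := by
  refine playsWell_of_patterns (F := F) (L := L) (a := a) (fun s hs hs' => ?_)
    (fun s hs hs' => ?_) ?_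
  · obtain ⟨b, c, hp, h1, h2⟩ := h.pattern s hs hs'
    refine ⟨b, c, hp, h1, h2, ?_, ?_⟩
    · rintro _ rfl hs'' ⟨-, he⟩
      rw [h.switch s hs (by omega)] at he
      simp at he
    · rintro rfl ⟨-, he⟩
      rw [hL] at he
      simp at he
  · obtain ⟨b, c, hp, -, -⟩ := h.pattern (s + 1) (by omega) (by omega)
    refine ⟨b, c, hp, fun he => ?_⟩
    rw [h.switch s hs hs'] at he
    simp at he
  · obtain ⟨b, c, d, e, f, h1, h2, h3, h4, h5, h6, n1, n2, n3, n4⟩ := ha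
    refine ⟨b, c, d, e, f, h1, h2, h3, h4, h5, h6, n1, n2, n3, n4, fun he => ?_⟩
    rw [hL] at he
    simp at he

/-- Team n − 1 repeats AHHA, so two away games meet at every slot boundary, enclosed by home games.
Team n does the opposite. -/
theorem playsWell_second_last {q : ℕ} : PlaysWell q (4 * q + 9) := by
  refine playsWell_of_patterns (F := fun _ => false) (L := fun _ => false) (a := false)
    (fun s hs hs' => ⟨true, true, (pattern_right hs hs').1, by simp⟩)
    (fun s hs hs' => ⟨true, true, (pattern_right (s := s + 1) (by omega) (by omega)).1, by simp⟩) ?_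
  obtain ⟨a, b, c, d, e, f⟩ := lastFour_mem q
  exact ⟨true, false, false, true, true, plays_away a.2, plays_home b.2, plays_away c.2,
    plays_away d.2, plays_home e.1, plays_home f.2, by simp⟩

theorem playsWell_last {q : ℕ} : PlaysWell q (4 * q + 10) := by
  refine playsWell_of_patterns (F := fun _ => true) (L := fun _ => true) (a := true)
    (fun s hs hs' => ⟨false, false, (pattern_right hs hs').2, by simp⟩)
    (fun s hs hs' => ⟨false, false, (pattern_right (s := s + 1) (by omega) (by omega)).2,
      by simp⟩) ?_
  obtain ⟨a, b, c, d, e, f⟩ := lastFour_mem q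
  exact ⟨false, true, true, false, false, plays_home a.2, plays_away b.1, plays_home c.1,
    plays_home d.1, plays_away e.2, plays_away f.2, by simp⟩

theorem playsWell (q v : ℕ) (hv : 1 ≤ v) (hv' : v ≤ 4 * q + 10) : PlaysWell q v := by
  by_cases h1 : v = 1
  · subst h1; exact slotPatterns_one.playsWell (by simp) lastPattern_team_one
  by_cases h2 : v = 2
  · subst h2; exact slotPatterns_two.playsWell (by simp) lastPattern_team_two
  by_cases h3 : v = 3
  · subst h3
    exact (slotPatterns_even (i := 2) (by omega) (by omega) rfl (by omega)).playsWell (by simp)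
      lastPattern_team_three
  by_cases h4 : v = 4 * q + 4
  · subst h4
    exact (slotPatterns_even (i := 2 * q + 2) (by omega) (by omega) (by omega)
      (by omega)).playsWell (by simp) lastPattern_seventh_last
  by_cases h5 : v = 4 * q + 5
  · subst h5
    exact (slotPatterns_top (Or.inl rfl)).playsWell rfl lastPattern_sixth_last
  by_cases h6 : v = 4 * q + 6
  · subst h6
    exact (slotPatterns_top (Or.inr rfl)).playsWell rfl lastPattern_fifth_last
  by_cases h7 : v = 4 * q + 7
  · subst h7; exact slotPatterns_fourth_last.playsWell (by simp) lastPattern_fourth_last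
  by_cases h8 : v = 4 * q + 8
  · subst h8
    exact slotPatterns_third_last.playsWell (by simp) lastPattern_third_last
  by_cases h9 : v = 4 * q + 9
  · subst h9; exact playsWell_second_last
  by_cases h10 : v = 4 * q + 10
  · subst h10; exact playsWell_last
  -- The remaining teams 4, …, 4q + 3 split into the groups of four of the inner games of the last
  -- slot.
  obtain ⟨h, hh, hh', hvh⟩ : ∃ h, 1 ≤ h ∧ h ≤ q ∧
      (v = 4 * h ∨ v = 4 * h + 1 ∨ v = 4 * h + 2 ∨ v = 4 * h + 3) :=
    ⟨v / 4, by omega, by omega, by omega⟩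
  rcases hvh with rfl | rfl | rfl | rfl
  · exact (slotPatterns_even (i := 2 * h) (by omega) (by omega) (by omega)
      (by omega)).playsWell (by simp; omega) (lastPattern_zero hh hh')
  · exact (slotPatterns_odd (i := 2 * h + 1) (by omega) (by omega) (by omega)
      (by omega)).playsWell (by simp; omega) (lastPattern_one hh hh')
  · exact (slotPatterns_odd (i := 2 * h + 1) (by omega) (by omega) (by omega)
      (by omega)).playsWell (by simp; omega) (lastPattern_two hh hh')
  · exact (slotPatterns_even (i := 2 * h + 2) (by omega) (by omega) (by omega)
      (by omega)).playsWell (by simp) (lastPattern_three hh hh')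

/-! ### Every two teams meet twice, not on consecutive days -/

/-- Teams `a` and `b` meet at both venues, and not on consecutive days. -/
def Meet (n a b : ℕ) : Prop :=
  ∃ k l, k ∈ Finset.Icc 1 (2 * (n - 1)) ∧ l ∈ Finset.Icc 1 (2 * (n - 1)) ∧
    (a, b) ∈ zhaoXiao n k ∧ (b, a) ∈ zhaoXiao n l ∧ (k + 2 ≤ l ∨ l + 2 ≤ k)

theorem Meet.symm {n a b : ℕ} (h : Meet n a b) : Meet n b a := by
  obtain ⟨k, l, hk, hl, h1, h2, h3⟩ := h
  exact ⟨l, k, hl, hk, h2, h1, h3.symm⟩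

theorem meet_of_mem {q a b k l : ℕ} (h1 : (a, b) ∈ zhaoXiao (4 * q + 10) k)
    (h2 : (b, a) ∈ zhaoXiao (4 * q + 10) l) (hk : 1 ≤ k) (hkl : k + 2 ≤ l) (hl : l ≤ 8 * q + 18) :
    Meet (4 * q + 10) a b :=
  ⟨k, l, by rw [Finset.mem_Icc]; omega, by rw [Finset.mem_Icc]; omega, h1, h2, Or.inl hkl⟩

theorem meet_of_normal {q k x y a b : ℕ} (hk : k ≤ 8 * q + 14)
    (h : ∀ r, 1 ≤ r → r ≤ 4 → normalGames x y r ⊆ zhaoXiao (4 * q + 10) (k + r))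
    (ha : a = 2 * x - 1 ∨ a = 2 * x) (hb : b = 2 * y - 1 ∨ b = 2 * y) : Meet (4 * q + 10) a b := by
  have h1 := h 1 (by omega) (by omega)
  have h2 := h 2 (by omega) (by omega)
  have h3 := h 3 (by omega) (by omega)
  have h4 := h 4 (by omega) (by omega)
  simp only [normalGames, par, cross, Finset.insert_subset_iff, Finset.singleton_subset_iff]
    at h1 h2 h3 h4
  rcases ha with rfl | rfl <;> rcases hb with rfl | rfl
  · exact (meet_of_mem h1.1 h3.1 (by omega) (by omega) (by omega)).symm
  · exact (meet_of_mem h2.2 h4.1 (by omega) (by omega) (by omega)).symm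
  · exact (meet_of_mem h2.1 h4.2 (by omega) (by omega) (by omega)).symm
  · exact (meet_of_mem h1.2 h3.2 (by omega) (by omega) (by omega)).symm

theorem meet_of_left {q k x y a b : ℕ} (hk : k ≤ 8 * q + 14)
    (h : ∀ r, 1 ≤ r → r ≤ 4 → leftGames x y r ⊆ zhaoXiao (4 * q + 10) (k + r))
    (ha : a = 2 * x - 1 ∨ a = 2 * x) (hb : b = 2 * y - 1 ∨ b = 2 * y) : Meet (4 * q + 10) a b := by
  have h1 := h 1 (by omega) (by omega)
  have h2 := h 2 (by omega) (by omega)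
  have h3 := h 3 (by omega) (by omega)
  have h4 := h 4 (by omega) (by omega)
  simp only [leftGames, par, cross, Finset.insert_subset_iff, Finset.singleton_subset_iff]
    at h1 h2 h3 h4
  rcases ha with rfl | rfl <;> rcases hb with rfl | rfl
  · exact (meet_of_mem h1.1 h3.1 (by omega) (by omega) (by omega)).symm
  · exact meet_of_mem h2.1 h4.2 (by omega) (by omega) (by omega)
  · exact meet_of_mem h2.2 h4.1 (by omega) (by omega) (by omega)
  · exact (meet_of_mem h1.2 h3.2 (by omega) (by omega) (by omega)).symm

theorem meet_of_fourDays {q k : ℕ} {A B : Finset (ℕ × ℕ)} (hk : k ≤ 8 * q + 14)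
    (h : ∀ r, 1 ≤ r → r ≤ 4 → fourDays A B r ⊆ zhaoXiao (4 * q + 10) (k + r)) {a b : ℕ}
    (hab : (a, b) ∈ A ∨ (a, b) ∈ B) : Meet (4 * q + 10) a b := by
  obtain ⟨hA, hB⟩ := fourDays_mem h
  rcases hab with hab | hab
  · exact meet_of_mem (hA a b hab).1 (hA a b hab).2 (by omega) (by omega) (by omega)
  · exact meet_of_mem (hB a b hab).1 (hB a b hab).2 (by omega) (by omega) (by omega)

theorem meet_of_fourDays_rev {q k : ℕ} {A B : Finset (ℕ × ℕ)} (hk : k ≤ 8 * q + 14)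
    (h : ∀ r, 1 ≤ r → r ≤ 4 → fourDays (rev A) (rev B) r ⊆ zhaoXiao (4 * q + 10) (k + r)) {a b : ℕ}
    (hab : (a, b) ∈ A ∨ (a, b) ∈ B) : Meet (4 * q + 10) a b := by
  obtain ⟨hA, hB⟩ := fourDays_rev_mem h
  rcases hab with hab | hab
  · exact (meet_of_mem (hA a b hab).1 (hA a b hab).2 (by omega) (by omega) (by omega)).symm
  · exact (meet_of_mem (hB a b hab).1 (hB a b hab).2 (by omega) (by omega) (by omega)).symm

/-- For even x both ranges of slots use the types 3 and 4, only in another order and orientation, so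
the pairs that meet do not depend on the slot. The same holds for odd x with the types 1 and 2. -/
theorem meet_right_even {q x a b : ℕ} (hx : 1 ≤ x) (hx' : x ≤ 2 * q + 2) (hp : x % 2 = 0)
    (hab : (a, b) ∈ rightType (4 * q + 10) x (x + 1) 3 ∨
      (a, b) ∈ rightType (4 * q + 10) x (x + 1) 4) : Meet (4 * q + 10) a b := by
  rcases Nat.lt_or_ge x (q + 2) with h | h
  · exact meet_of_fourDays (k := 4 * (q + 1 - x)) (by omega)
      (fun r hr hr' => right_low_even_subset hx (by omega) hp hr hr') hab.symm
  · exact meet_of_fourDays_rev (k := 4 * (3 * q + 4 - x)) (by omega)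
      (fun r hr hr' => right_high_even_subset h (by omega) hp hr hr') hab

theorem meet_right_odd {q x a b : ℕ} (hx : 1 ≤ x) (hx' : x ≤ 2 * q + 2) (hp : x % 2 = 1)
    (hab : (a, b) ∈ rightType (4 * q + 10) x (x + 1) 1 ∨
      (a, b) ∈ rightType (4 * q + 10) x (x + 1) 2) : Meet (4 * q + 10) a b := by
  rcases Nat.lt_or_ge x (q + 2) with h | h
  · exact meet_of_fourDays_rev (k := 4 * (q + 1 - x)) (by omega)
      (fun r hr hr' => right_low_odd_subset hx (by omega) hp hr hr') hab.symm
  · exact meet_of_fourDays (k := 4 * (3 * q + 4 - x)) (by omega)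
      (fun r hr hr' => right_high_odd_subset h (by omega) hp hr hr') hab

theorem meet_right_wrap {q a b : ℕ}
    (hab : (a, b) ∈ rightType (4 * q + 10) (2 * q + 3) 1 1 ∨
      (a, b) ∈ rightType (4 * q + 10) (2 * q + 3) 1 3) : Meet (4 * q + 10) a b :=
  meet_of_fourDays (k := 4 * q + 4) (by omega) (fun _ hr hr' => right_wrap_subset hr hr') hab

theorem meet_last_inner {q h : ℕ} (hh : 1 ≤ h) (hh' : h ≤ q) :
    Meet (4 * q + 10) (4 * h) (4 * h + 1) ∧ Meet (4 * q + 10) (4 * h) (4 * h + 2) ∧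
    Meet (4 * q + 10) (4 * h + 3) (4 * h + 1) ∧ Meet (4 * q + 10) (4 * h + 3) (4 * h + 2) := by
  obtain ⟨⟨a1, a2⟩, ⟨b1, b2⟩, ⟨c1, c2⟩, ⟨d1, d2⟩⟩ := lastInner_mem hh hh'
  exact ⟨(meet_of_mem b1 d1 (by omega) (by omega) (by omega)).symm,
    meet_of_mem a2 c2 (by omega) (by omega) (by omega),
    meet_of_mem a1 c1 (by omega) (by omega) (by omega),
    meet_of_mem b2 d2 (by omega) (by omega) (by omega)⟩

theorem meet_last_outer (q : ℕ) :
    Meet (4 * q + 10) 1 3 ∧ Meet (4 * q + 10) 2 3 ∧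
    Meet (4 * q + 10) (4 * q + 4) (4 * q + 5) ∧ Meet (4 * q + 10) (4 * q + 4) (4 * q + 6) ∧
    Meet (4 * q + 10) 2 (4 * q + 5) ∧ Meet (4 * q + 10) 1 (4 * q + 6) := by
  obtain ⟨⟨a1, a2, a3⟩, ⟨b1, b2, b3⟩, ⟨c1, c2, c3⟩, ⟨d1, d2, d3⟩⟩ := lastOuter_mem q
  exact ⟨(meet_of_mem a1 c1 (by omega) (by omega) (by omega)).symm,
    (meet_of_mem b1 d1 (by omega) (by omega) (by omega)).symm,
    (meet_of_mem b2 d2 (by omega) (by omega) (by omega)).symm,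
    meet_of_mem a2 c2 (by omega) (by omega) (by omega),
    meet_of_mem a3 c3 (by omega) (by omega) (by omega),
    meet_of_mem b3 d3 (by omega) (by omega) (by omega)⟩

theorem meet_last_four (q : ℕ) {a b : ℕ} (ha : 4 * q + 7 ≤ a) (hab : a < b) (hb : b ≤ 4 * q + 10) :
    Meet (4 * q + 10) a b := by
  obtain ⟨A, B, C, D, E, F⟩ := lastFour_mem q
  have h : a = 4 * q + 7 ∨ a = 4 * q + 8 ∨ a = 4 * q + 9 := by omega
  rcases h with rfl | rfl | rfl
  · have h' : b = 4 * q + 8 ∨ b = 4 * q + 9 ∨ b = 4 * q + 10 := by omega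
    rcases h' with rfl | rfl | rfl
    · exact (meet_of_mem A.1 F.1 (by omega) (by omega) (by omega)).symm
    · exact meet_of_mem C.2 E.1 (by omega) (by omega) (by omega)
    · exact meet_of_mem B.1 D.1 (by omega) (by omega) (by omega)
  · have h' : b = 4 * q + 9 ∨ b = 4 * q + 10 := by omega
    rcases h' with rfl | rfl
    · exact (meet_of_mem B.2 D.2 (by omega) (by omega) (by omega)).symm
    · exact (meet_of_mem C.1 E.2 (by omega) (by omega) (by omega)).symm
  · obtain rfl : b = 4 * q + 10 := by omega
    exact (meet_of_mem A.2 F.2 (by omega) (by omega) (by omega)).symm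

/-- The right super-game of two neighbours leaves room for only two of their four pairings: those of
team 2x − 1 if x is even, and those of team 2x + 2 if x is odd. The last slot supplies the other
two. -/
theorem meet_next {q x a b : ℕ} (hx : 1 ≤ x) (hx' : x ≤ 2 * q + 2)
    (ha : a = 2 * x - 1 ∨ a = 2 * x) (hb : b = 2 * (x + 1) - 1 ∨ b = 2 * (x + 1)) :
    Meet (4 * q + 10) a b := by
  have last_even : x % 2 = 0 → Meet (4 * q + 10) (2 * x) (2 * (x + 1) - 1) ∧
      Meet (4 * q + 10) (2 * x) (2 * (x + 1)) := fun hp => by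
    by_cases hl : x = 2 * q + 2
    · subst hl
      obtain ⟨-, -, h1, h2, -⟩ := meet_last_outer q
      rw [show 2 * (2 * q + 2) = 4 * q + 4 by omega, show 2 * (2 * q + 2 + 1) = 4 * q + 6 by omega]
      exact ⟨h1, h2⟩
    · obtain ⟨h1, h2, -⟩ := meet_last_inner (q := q) (h := x / 2) (by omega) (by omega)
      rw [show 4 * (x / 2) = 2 * x by omega] at h1 h2
      exact ⟨h1, h2⟩
  have last_odd : x % 2 = 1 → Meet (4 * q + 10) (2 * (x + 1) - 1) (2 * x - 1) ∧
      Meet (4 * q + 10) (2 * (x + 1) - 1) (2 * x) := fun hp => by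
    by_cases hl : x = 1
    · subst hl
      obtain ⟨h1, h2, -⟩ := meet_last_outer q
      exact ⟨h1.symm, h2.symm⟩
    · obtain ⟨-, -, h1, h2⟩ := meet_last_inner (q := q) (h := x / 2) (by omega) (by omega)
      rw [show 4 * (x / 2) + 1 = 2 * x - 1 by omega,
        show 4 * (x / 2) + 3 = 2 * (x + 1) - 1 by omega] at h1
      rw [show 4 * (x / 2) + 2 = 2 * x by omega,
        show 4 * (x / 2) + 3 = 2 * (x + 1) - 1 by omega] at h2
      exact ⟨h1, h2⟩
  rcases Nat.mod_two_eq_zero_or_one x with hp | hp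
  · rcases ha with rfl | rfl
    · refine (meet_right_even hx hx' hp ?_).symm
      rcases hb with rfl | rfl <;> simp [rightType]
    · rcases hb with rfl | rfl
      exacts [(last_even hp).1, (last_even hp).2]
  · rcases hb with rfl | rfl
    · rcases ha with rfl | rfl
      exacts [(last_odd hp).1.symm, (last_odd hp).2.symm]
    · refine (meet_right_odd hx hx' hp ?_).symm
      rcases ha with rfl | rfl <;> simp [rightType]

theorem meet_wrap {q a b : ℕ} (ha : a = 1 ∨ a = 2) (hb : b = 4 * q + 5 ∨ b = 4 * q + 6) :
    Meet (4 * q + 10) a b := by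
  obtain ⟨-, -, -, -, h1, h2⟩ := meet_last_outer q
  rcases ha with rfl | rfl <;> rcases hb with rfl | rfl
  · refine meet_right_wrap ?_
    simp [rightType]; omega
  · exact h2
  · exact h1
  · refine meet_right_wrap ?_
    simp [rightType]; omega

theorem meet_leftmost {q i a b : ℕ} (hi : 1 ≤ i) (hi' : i ≤ 2 * q + 3)
    (ha : a = 2 * i - 1 ∨ a = 2 * i) (hb : b = 4 * q + 7 ∨ b = 4 * q + 8) :
    Meet (4 * q + 10) a b := by
  rcases Nat.mod_two_eq_zero_or_one i with hp | hp
  · exact meet_of_left (k := 4 * (2 * q + 3 - i)) (y := 2 * q + 4) (by omega)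
      (fun r hr hr' => leftmost_even_subset hi (by omega) hp hr hr') ha (by omega)
  · by_cases h1 : i = 1
    · subst h1
      obtain ⟨A, B, C, D⟩ := specialLeft_mem q
      rcases ha with rfl | rfl <;> rcases hb with rfl | rfl
      · exact meet_of_mem A.1 C.1 (by omega) (by omega) (by omega)
      · exact (meet_of_mem B.2 D.2 (by omega) (by omega) (by omega)).symm
      · exact meet_of_mem B.1 D.1 (by omega) (by omega) (by omega)
      · exact meet_of_mem A.2 C.2 (by omega) (by omega) (by omega)
    · by_cases h2 : i = 2 * q + 3
      · subst h2
        exact meet_of_normal (k := 0) (by omega)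
          (fun r hr hr' => by rw [zero_add]; exact leftmost_normal_subset hr hr') ha (by omega)
      · exact (meet_of_left (k := 4 * (2 * q + 3 - i)) (x := 2 * q + 4) (by omega)
          (fun r hr hr' => leftmost_odd_subset (by omega) (by omega) hp hr hr') (by omega) ha).symm

/-- Super-team i plays two right super-games, one with each cyclic neighbour, and each of them
contributes two of the four pairings with teams n − 1 and n. For i = 1 and i = 2q + 3 one of the two
is the super-game at the wrap. -/
theorem meet_rightmost {q i a b : ℕ} (hi : 1 ≤ i) (hi' : i ≤ 2 * q + 3)
    (ha : a = 2 * i - 1 ∨ a = 2 * i) (hb : b = 4 * q + 9 ∨ b = 4 * q + 10) :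
    Meet (4 * q + 10) a b := by
  rcases Nat.mod_two_eq_zero_or_one i with hp | hp
  · rcases ha with rfl | rfl
    · obtain ⟨x, rfl⟩ : ∃ x, i = x + 1 := ⟨i - 1, by omega⟩
      refine meet_right_odd (x := x) (by omega) (by omega) (by omega) ?_
      rcases hb with rfl | rfl <;> simp [rightType]
    · refine (meet_right_even (x := i) (by omega) (by omega) (by omega) ?_).symm
      rcases hb with rfl | rfl <;> simp [rightType]
  · have tail : Meet (4 * q + 10) (4 * q + 10) (2 * i - 1) ∧
        Meet (4 * q + 10) (4 * q + 9) (2 * i) := by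
      by_cases hN : i = 2 * q + 3
      · subst hN
        constructor <;> refine meet_right_wrap ?_ <;> simp [rightType]
      · constructor <;> refine meet_right_odd (x := i) (by omega) (by omega) (by omega) ?_ <;>
          simp [rightType]
    have head : Meet (4 * q + 10) (2 * i - 1) (4 * q + 9) ∧
        Meet (4 * q + 10) (2 * i) (4 * q + 10) := by
      by_cases h1 : i = 1
      · subst h1
        constructor <;> refine meet_right_wrap ?_ <;> simp [rightType]
      · obtain ⟨x, rfl⟩ : ∃ x, i = x + 1 := ⟨i - 1, by omega⟩
        constructor <;> refine meet_right_even (x := x) (by omega) (by omega) (by omega) ?_ <;>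
          simp [rightType]
    rcases ha with rfl | rfl <;> rcases hb with rfl | rfl
    exacts [head.1, tail.1.symm, tail.2.symm, head.2]

theorem meet_of_lt {q a b : ℕ} (ha : 1 ≤ a) (hab : a < b) (hb : b ≤ 4 * q + 10) :
    Meet (4 * q + 10) a b := by
  obtain ⟨i, hi⟩ : ∃ i, i = (a + 1) / 2 := ⟨_, rfl⟩
  obtain ⟨j, hj⟩ : ∃ j, j = (b + 1) / 2 := ⟨_, rfl⟩
  have hai : a = 2 * i - 1 ∨ a = 2 * i := by omega
  have hbj : b = 2 * j - 1 ∨ b = 2 * j := by omega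
  by_cases h1 : 4 * q + 7 ≤ a
  · exact meet_last_four q h1 hab hb
  by_cases h2 : 4 * q + 9 ≤ b
  · exact meet_rightmost (i := i) (by omega) (by omega) hai (by omega)
  by_cases h3 : 4 * q + 7 ≤ b
  · exact meet_leftmost (i := i) (by omega) (by omega) hai (by omega)
  by_cases h4 : i = j
  · obtain ⟨e1, e2⟩ := lastMates_mem (q := q) (i := i) (by omega) (by omega)
    have e3 : a = 2 * i - 1 := by omega
    have e4 : b = 2 * i := by omega
    rw [e3, e4]
    exact (meet_of_mem e1 e2 (by omega) (by omega) (by omega)).symm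
  by_cases h5 : j = i + 1
  · subst h5
    exact meet_next (x := i) (by omega) (by omega) hai hbj
  by_cases h6 : j = i + (2 * q + 2)
  · exact meet_wrap (by omega) (by omega)
  rcases exists_normalSuperGame (q := q) (i := i) (j := j) (by omega) (by omega) (by omega)
    (by omega) with ⟨s, hs, hs', h⟩ | ⟨s, hs, hs', h⟩
  · exact meet_of_normal (by omega) h hai hbj
  · exact (meet_of_normal (by omega) h hbj hai).symm

theorem meet_of_ne {q a b : ℕ} (ha : a ∈ Finset.Icc 1 (4 * q + 10))
    (hb : b ∈ Finset.Icc 1 (4 * q + 10)) (hab : a ≠ b) : Meet (4 * q + 10) a b := by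
  rw [Finset.mem_Icc] at ha hb
  rcases Nat.lt_or_gt_of_ne hab with h | h
  · exact meet_of_lt ha.1 h hb.2
  · exact (meet_of_lt hb.1 h ha.2).symm

/-! ### Counting games -/

theorem card_normalGames_le (x y r : ℕ) : (normalGames x y r).card ≤ 2 := by
  unfold normalGames par cross
  split <;> first | exact Finset.card_le_two | simp

theorem card_leftGames_le (x y r : ℕ) : (leftGames x y r).card ≤ 2 := by
  unfold leftGames par cross
  split <;> first | exact Finset.card_le_two | simp

theorem card_specialLeftGames_le (n r : ℕ) : (specialLeftGames n r).card ≤ 2 := by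
  unfold specialLeftGames
  split <;> first | exact Finset.card_le_two | simp

theorem card_rightType_le (n x y r : ℕ) : (rightType n x y r).card ≤ 3 := by
  unfold rightType
  split <;> first | exact Finset.card_le_three | simp

theorem card_rev_le (A : Finset (ℕ × ℕ)) : (rev A).card ≤ A.card := Finset.card_image_le

theorem card_fourDays_le {A B : Finset (ℕ × ℕ)} {c : ℕ} (hA : A.card ≤ c) (hB : B.card ≤ c)
    (r : ℕ) : (fourDays A B r).card ≤ c := by
  unfold fourDays
  split
  · exact hA
  · exact hB
  · exact (card_rev_le A).trans hA
  · exact (card_rev_le B).trans hB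
  · simp

theorem card_rightGames_le (m s r : ℕ) : (rightGames m s r).card ≤ 3 := by
  have h := card_rightType_le
  have h' := fun n x y i => (card_rev_le (rightType n x y i)).trans (h n x y i)
  unfold rightGames
  dsimp only
  split_ifs <;> apply card_fourDays_le <;> first | apply h | apply h'

theorem card_leftmostGames_le (m s r : ℕ) : (leftmostGames m s r).card ≤ 2 := by
  unfold leftmostGames
  split_ifs
  · apply card_normalGames_le
  · apply card_specialLeftGames_le
  · apply card_leftGames_le
  · apply card_leftGames_le

theorem card_columnGames_le (m s c r : ℕ) : (columnGames m s c r).card ≤ 2 := by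
  unfold columnGames
  split_ifs <;> apply card_normalGames_le

theorem card_lastInner_le (h r : ℕ) : (lastInner h r).card ≤ 2 := by
  unfold lastInner
  split <;> first | exact Finset.card_le_two | simp

theorem card_lastFour_le (n r : ℕ) : (lastFour n r).card ≤ 2 := by
  unfold lastFour
  split <;> first | exact Finset.card_le_two | simp

theorem card_lastOuter_le (n r : ℕ) : (lastOuter n r).card ≤ 3 := by
  unfold lastOuter
  split <;> first | exact Finset.card_le_three | simp

theorem card_lastGames_le (q r : ℕ) : (lastGames (4 * q + 10) r).card ≤ 2 * q + 5 := by
  have e1 : ((4 * q + 10) / 2 - 5) / 2 = q := by omega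
  have e2 : (4 * q + 10) / 2 = 2 * q + 5 := by omega
  have hin : ((Finset.Icc 1 q).biUnion (fun h => lastInner h r)).card ≤ q * 2 := by
    have := Finset.card_biUnion_le_card_mul (Finset.Icc 1 q) (fun h => lastInner h r) 2
      (fun h _ => card_lastInner_le h r)
    simpa using this
  have hf := card_lastFour_le (4 * q + 10) r
  have ho := card_lastOuter_le (4 * q + 10) r
  unfold lastGames
  rw [e1, e2]
  refine (Finset.card_union_le _ _).trans ?_
  have h2 : ((Finset.Icc 1 q).biUnion (fun h => lastInner h r) ∪ lastOuter (4 * q + 10) r ∪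
      lastMates (2 * q + 5) r).card ≤ 2 * q + 3 := by
    -- On days 2 and 6 the games of mates take the place of all inner and outer games; on the other
    -- days there are none.
    by_cases hr : r = 2 ∨ r = 6
    · have hm : (lastMates (2 * q + 5) r).card ≤ 2 * q + 3 := by
        rcases hr with rfl | rfl <;>
        · refine Finset.card_image_le.trans ?_
          simp
      have hi : (Finset.Icc 1 q).biUnion (fun h => lastInner h r) = ∅ := by
        rcases hr with rfl | rfl <;>
          · rw [← Finset.card_eq_zero, ← Nat.le_zero]
            exact (Finset.card_biUnion_le_card_mul _ _ 0 fun h _ => le_rfl).trans (by simp)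
      have ho : lastOuter (4 * q + 10) r = ∅ := by
        rcases hr with rfl | rfl <;> simp [lastOuter]
      rw [hi, ho]
      simpa using hm
    · have hm : lastMates (2 * q + 5) r = ∅ := by
        unfold lastMates
        split
        · simp at hr
        · simp at hr
        · rfl
      rw [hm, Finset.union_empty]
      refine (Finset.card_union_le _ _).trans ?_
      omega
  omega

theorem card_slotGames_le (q s r : ℕ) : (slotGames (2 * q + 5) s r).card ≤ 2 * q + 5 := by
  have e1 : (2 * q + 5 - 5) / 2 = q := by omega
  have hin : ((Finset.Icc 1 q).biUnion (fun c => columnGames (2 * q + 5) s c r)).card ≤ q * 2 := by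
    have := Finset.card_biUnion_le_card_mul (Finset.Icc 1 q)
      (fun c => columnGames (2 * q + 5) s c r) 2 (fun c _ => card_columnGames_le _ s c r)
    simpa using this
  have hl := card_leftmostGames_le (2 * q + 5) s r
  have hr := card_rightGames_le (2 * q + 5) s r
  unfold slotGames
  rw [e1]
  refine (Finset.card_union_le _ _).trans ?_
  have := Finset.card_union_le ((Finset.Icc 1 q).biUnion
    (fun c => columnGames (2 * q + 5) s c r)) (leftmostGames (2 * q + 5) s r)
  omega

theorem card_zhaoXiao_le (q k : ℕ) : (zhaoXiao (4 * q + 10) k).card ≤ 2 * q + 5 := by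
  unfold zhaoXiao
  split_ifs
  · have e : (4 * q + 10) / 2 = 2 * q + 5 := by omega
    rw [e]
    apply card_slotGames_le
  · apply card_lastGames_le

/-- The teams that occur in a set of games, with the information whether they play at home. -/
theorem games_of_cover {G : Finset (ℕ × ℕ)} {m : ℕ} (hG : G.card ≤ m)
    (hcov : ∀ v ∈ Finset.Icc 1 (2 * m), ∃ g ∈ G, g.1 = v ∨ g.2 = v) :
    (∀ g ∈ G, g.1 ∈ Finset.Icc 1 (2 * m) ∧ g.2 ∈ Finset.Icc 1 (2 * m) ∧ g.1 ≠ g.2) ∧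
    (∀ g ∈ G, ∀ g' ∈ G, ∀ v, (g.1 = v ∨ g.2 = v) → (g'.1 = v ∨ g'.2 = v) → g = g') := by
  -- At most m games have at most 2m ends, and these cover 2m teams; so the map from ends to teams
  -- is a bijection.
  let f : (ℕ × ℕ) × Bool → ℕ := fun p => if p.2 then p.1.1 else p.1.2
  let X : Finset ((ℕ × ℕ) × Bool) := G ×ˢ Finset.univ
  have hX : X.card ≤ 2 * m := by
    simp only [X, Finset.card_product, Finset.card_univ, Fintype.card_bool]
    omega
  have hmem : ∀ g ∈ G, ∀ b, (g, b) ∈ X := fun g hg b => by simp [X, hg]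
  have hsub : Finset.Icc 1 (2 * m) ⊆ X.image f := by
    intro v hv
    obtain ⟨g, hg, rfl | rfl⟩ := hcov v hv
    · exact Finset.mem_image.2 ⟨(g, true), hmem g hg _, rfl⟩
    · exact Finset.mem_image.2 ⟨(g, false), hmem g hg _, rfl⟩
  have hc : (Finset.Icc 1 (2 * m)).card = 2 * m := by simp
  have hle : (X.image f).card ≤ X.card := Finset.card_image_le
  have heq : Finset.Icc 1 (2 * m) = X.image f := Finset.eq_of_subset_of_card_le hsub (by omega)
  have hinj : Set.InjOn f X := Finset.injOn_of_card_image_eq (by rw [← heq]; rw [← heq] at hle; omega)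
  have himg : ∀ g ∈ G, ∀ b, f (g, b) ∈ Finset.Icc 1 (2 * m) := fun g hg b => by
    rw [heq]; exact Finset.mem_image_of_mem f (hmem g hg b)
  have huniq : ∀ g ∈ G, ∀ g' ∈ G, ∀ b b', f (g, b) = f (g', b') → g = g' ∧ b = b' :=
    fun g hg g' hg' b b' h => by
      have := hinj (hmem g hg b) (hmem g' hg' b') h
      simpa using this
  refine ⟨fun g hg => ⟨himg g hg true, himg g hg false, fun h => ?_⟩, ?_⟩
  · have := (huniq g hg g hg true false h).2
    simp at this
  · rintro g hg g' hg' v (h | h) (h' | h')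
    · exact (huniq g hg g' hg' true true (h.trans h'.symm)).1
    · exact (huniq g hg g' hg' true false (h.trans h'.symm)).1
    · exact (huniq g hg g' hg' false true (h.trans h'.symm)).1
    · exact (huniq g hg g' hg' false false (h.trans h'.symm)).1

theorem zhaoXiao_cover {q k : ℕ} (hk : k ∈ Finset.Icc 1 (8 * q + 18)) :
    ∀ v ∈ Finset.Icc 1 (2 * (2 * q + 5)), ∃ g ∈ zhaoXiao (4 * q + 10) k, g.1 = v ∨ g.2 = v := by
  intro v hv
  rw [Finset.mem_Icc] at hk hv
  obtain ⟨h, u, hu⟩ := (playsWell q v hv.1 (by omega)).1 k hk.1 hk.2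
  cases h
  · exact ⟨(u, v), by simpa using hu, Or.inr rfl⟩
  · exact ⟨(v, u), by simpa using hu, Or.inl rfl⟩

theorem zhaoXiao_mem {q k : ℕ} (hk : k ∈ Finset.Icc 1 (8 * q + 18)) {a b : ℕ}
    (h : (a, b) ∈ zhaoXiao (4 * q + 10) k) :
    a ∈ Finset.Icc 1 (4 * q + 10) ∧ b ∈ Finset.Icc 1 (4 * q + 10) ∧ a ≠ b := by
  have := (games_of_cover (card_zhaoXiao_le q k) (zhaoXiao_cover hk)).1 _ h
  rwa [show 2 * (2 * q + 5) = 4 * q + 10 by omega] at this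

theorem zhaoXiao_unique {q k : ℕ} (hk : k ∈ Finset.Icc 1 (8 * q + 18)) {g g' : ℕ × ℕ} {v : ℕ}
    (hg : g ∈ zhaoXiao (4 * q + 10) k) (hg' : g' ∈ zhaoXiao (4 * q + 10) k)
    (h : g.1 = v ∨ g.2 = v) (h' : g'.1 = v ∨ g'.2 = v) : g = g' :=
  (games_of_cover (card_zhaoXiao_le q k) (zhaoXiao_cover hk)).2 g hg g' hg' v h h'

/-- All n(n − 1) ordered pairs occur, while 2(n − 1) days with at most n/2 games each offer no more
than n(n − 1) places. Hence the map from places to games is injective. -/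
theorem zhaoXiao_day_unique {q k l a b : ℕ} (hk : k ∈ Finset.Icc 1 (8 * q + 18))
    (hl : l ∈ Finset.Icc 1 (8 * q + 18)) (h : (a, b) ∈ zhaoXiao (4 * q + 10) k)
    (h' : (a, b) ∈ zhaoXiao (4 * q + 10) l) : k = l := by
  let X : Finset (Σ _ : ℕ, ℕ × ℕ) :=
    (Finset.Icc 1 (8 * q + 18)).sigma (fun k => zhaoXiao (4 * q + 10) k)
  have hX : X.card ≤ (8 * q + 18) * (2 * q + 5) := by
    rw [Finset.card_sigma]
    refine (Finset.sum_le_card_nsmul _ _ _ fun k _ => card_zhaoXiao_le q k).trans ?_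
    simp
  have hsub : (Finset.Icc 1 (4 * q + 10)).offDiag ⊆ X.image Sigma.snd := by
    rintro ⟨u, v⟩ huv
    rw [Finset.mem_offDiag] at huv
    obtain ⟨k, l, hk, -, h, -⟩ := meet_of_ne huv.1 huv.2.1 huv.2.2
    refine Finset.mem_image.2 ⟨⟨k, (u, v)⟩, ?_, rfl⟩
    rw [Finset.mem_sigma]
    exact ⟨by rwa [show 8 * q + 18 = 2 * (4 * q + 10 - 1) by omega], h⟩
  have hoff : (Finset.Icc 1 (4 * q + 10)).offDiag.card = (8 * q + 18) * (2 * q + 5) := by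
    rw [Finset.offDiag_card, Nat.card_Icc, Nat.sub_eq_iff_eq_add (Nat.le_mul_self _)]
    simp only [Nat.add_sub_cancel]
    ring
  have h1 := Finset.card_le_card hsub
  have h2 : (X.image Sigma.snd).card ≤ X.card := Finset.card_image_le
  have hinj : Set.InjOn Sigma.snd (X : Set (Σ _ : ℕ, ℕ × ℕ)) :=
    Finset.injOn_of_card_image_eq (by omega)
  have hmem : (⟨k, (a, b)⟩ : Σ _ : ℕ, ℕ × ℕ) ∈ X := Finset.mem_sigma.2 ⟨hk, h⟩
  have hmem' : (⟨l, (a, b)⟩ : Σ _ : ℕ, ℕ × ℕ) ∈ X := Finset.mem_sigma.2 ⟨hl, h'⟩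
  exact congrArg Sigma.fst (hinj hmem hmem' rfl)

/-! ### Feasibility -/

section Feasible

variable {V : Type*}

theorem mem_image_iff {q k : ℕ} {t : ℕ → V} [DecidableEq (V × V)]
    (ht : Set.InjOn t (Set.Icc 1 (4 * q + 10)))
    (hk : k ∈ Finset.Icc 1 (8 * q + 18)) {a b : ℕ} (ha : a ∈ Finset.Icc 1 (4 * q + 10))
    (hb : b ∈ Finset.Icc 1 (4 * q + 10)) :
    (t a, t b) ∈ (zhaoXiao (4 * q + 10) k).image (Prod.map t t) ↔
      (a, b) ∈ zhaoXiao (4 * q + 10) k := by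
  constructor
  · intro h
    obtain ⟨⟨c, d⟩, hcd, he⟩ := Finset.mem_image.1 h
    obtain ⟨hc, hd, -⟩ := zhaoXiao_mem hk hcd
    rw [Finset.mem_Icc] at *
    simp only [Prod.map_apply, Prod.mk.injEq] at he
    rwa [← ht hc ha he.1, ← ht hd hb he.2]
  · intro h
    exact Finset.mem_image.2 ⟨(a, b), h, rfl⟩

theorem isFeasible_image {q : ℕ} {t : ℕ → V} [DecidableEq (V × V)]
    (ht : Set.BijOn t (Set.Icc 1 (4 * q + 10)) Set.univ) :
    IsFeasible 2 (4 * q + 10) (fun k => (zhaoXiao (4 * q + 10) k).image (Prod.map t t)) := by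
  have e : 2 * (4 * q + 10 - 1) = 8 * q + 18 := by omega
  have hsurj : ∀ v, ∃ i ∈ Finset.Icc 1 (4 * q + 10), t i = v := fun v => by
    obtain ⟨i, hi, rfl⟩ := ht.surjOn (Set.mem_univ v)
    exact ⟨i, by rwa [Finset.mem_Icc], rfl⟩
  have hinj : ∀ {a b}, a ∈ Finset.Icc 1 (4 * q + 10) → b ∈ Finset.Icc 1 (4 * q + 10) →
      t a = t b → a = b := fun ha hb h => by
    rw [Finset.mem_Icc] at ha hb
    exact ht.injOn ha hb h
  have hmixed : ∀ k, 1 ≤ k → k + 2 ≤ 8 * q + 18 → ∀ v,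
      (∃ j ≤ 2, ∃ u ∈ Finset.Icc 1 (4 * q + 10), (u, v) ∈ zhaoXiao (4 * q + 10) (k + j)) ∧
      (∃ j ≤ 2, ∃ u ∈ Finset.Icc 1 (4 * q + 10), (v, u) ∈ zhaoXiao (4 * q + 10) (k + j)) ∨
      v ∉ Finset.Icc 1 (4 * q + 10) := by
    intro k hk hk' v
    by_cases hv : v ∈ Finset.Icc 1 (4 * q + 10)
    swap
    · exact Or.inr hv
    refine Or.inl ?_
    rw [Finset.mem_Icc] at hv
    obtain ⟨a, b, c, h0, h1, h2, hn⟩ := (playsWell q v hv.1 hv.2).2 k hk (by omega)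
    have away : ∀ j ≤ 2, Plays (4 * q + 10) (k + j) v false →
        ∃ j ≤ 2, ∃ u ∈ Finset.Icc 1 (4 * q + 10), (u, v) ∈ zhaoXiao (4 * q + 10) (k + j) := by
      rintro j hj ⟨u, hu⟩
      have hu' : (u, v) ∈ zhaoXiao (4 * q + 10) (k + j) := by simpa using hu
      exact ⟨j, hj, u, (zhaoXiao_mem (by rw [Finset.mem_Icc]; omega) hu').1, hu'⟩
    have home : ∀ j ≤ 2, Plays (4 * q + 10) (k + j) v true →
        ∃ j ≤ 2, ∃ u ∈ Finset.Icc 1 (4 * q + 10), (v, u) ∈ zhaoXiao (4 * q + 10) (k + j) := by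
      rintro j hj ⟨u, hu⟩
      have hu' : (v, u) ∈ zhaoXiao (4 * q + 10) (k + j) := by simpa using hu
      exact ⟨j, hj, u, (zhaoXiao_mem (by rw [Finset.mem_Icc]; omega) hu').2.1, hu'⟩
    cases a <;> cases b <;> cases c <;> simp at hn
    exacts [⟨away 0 (by omega) h0, home 2 (by omega) h2⟩,
      ⟨away 0 (by omega) h0, home 1 (by omega) h1⟩, ⟨away 0 (by omega) h0, home 1 (by omega) h1⟩,
      ⟨away 1 (by omega) h1, home 0 (by omega) h0⟩, ⟨away 1 (by omega) h1, home 0 (by omega) h0⟩,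
      ⟨away 2 (by omega) h2, home 0 (by omega) h0⟩]
  refine ⟨?_, ?_, ?_, ?_, ?_, ?_⟩
  · intro k hk g hg
    rw [e] at hk
    obtain ⟨⟨a, b⟩, hab, rfl⟩ := Finset.mem_image.1 hg
    obtain ⟨ha, hb, hne⟩ := zhaoXiao_mem hk hab
    exact fun h => hne (hinj ha hb h)
  · intro k hk v
    rw [e] at hk
    obtain ⟨i, hi, rfl⟩ := hsurj v
    obtain ⟨g, hg, hgi⟩ := zhaoXiao_cover hk i (by
      rwa [show 2 * (2 * q + 5) = 4 * q + 10 by omega])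
    refine ⟨Prod.map t t g, ⟨Finset.mem_image_of_mem _ hg, ?_⟩, ?_⟩
    · rcases hgi with h | h
      · exact Or.inl (by rw [Prod.map_fst, h])
      · exact Or.inr (by rw [Prod.map_snd, h])
    · rintro g' ⟨hg', hgi'⟩
      obtain ⟨⟨a, b⟩, hab, rfl⟩ := Finset.mem_image.1 hg'
      obtain ⟨ha, hb, -⟩ := zhaoXiao_mem hk hab
      rw [zhaoXiao_unique hk hg hab hgi (hgi'.imp (hinj ha hi) (hinj hb hi))]
  · intro u v huv
    obtain ⟨i, hi, rfl⟩ := hsurj u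
    obtain ⟨j, hj, rfl⟩ := hsurj v
    obtain ⟨k, -, hk, -, hij, -⟩ := meet_of_ne hi hj (fun h => huv (by rw [h]))
    rw [e] at hk ⊢
    refine ⟨k, ⟨hk, (mem_image_iff ht.injOn hk hi hj).2 hij⟩, ?_⟩
    rintro l ⟨hl, hl'⟩
    exact zhaoXiao_day_unique hl hk ((mem_image_iff ht.injOn hl hi hj).1 hl') hij
  · intro k hk hk' u v huv
    rw [e] at hk'
    obtain ⟨⟨a, b⟩, hab, he⟩ := Finset.mem_image.1 huv
    simp only [Prod.map_apply, Prod.mk.injEq] at he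
    obtain ⟨rfl, rfl⟩ := he
    have hk1 : k ∈ Finset.Icc 1 (8 * q + 18) := by rw [Finset.mem_Icc]; omega
    have hk2 : k + 1 ∈ Finset.Icc 1 (8 * q + 18) := by rw [Finset.mem_Icc]; omega
    obtain ⟨ha, hb, hne⟩ := zhaoXiao_mem hk1 hab
    rw [mem_image_iff ht.injOn hk2 ha hb, mem_image_iff ht.injOn hk2 hb ha]
    -- Since the day of an ordered pair is unique, the two days found here are the actual ones, and
    -- they are at least two apart.
    obtain ⟨l, l', hl, hl', h1, h2, h3⟩ := meet_of_ne ha hb hne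
    rw [e] at hl hl'
    constructor
    · intro h
      have := zhaoXiao_day_unique hk1 hk2 hab h
      omega
    · intro h
      have h4 := zhaoXiao_day_unique hk1 hl hab h1
      have h5 := zhaoXiao_day_unique hk2 hl' h h2
      omega
  · intro k hk hk' v
    rw [e] at hk'
    obtain ⟨i, hi, rfl⟩ := hsurj v
    obtain ⟨⟨j, hj, u, hu, hui⟩, -⟩ | h := hmixed k hk hk' i
    swap
    · exact absurd hi h
    refine ⟨j, hj, ?_⟩
    rintro ⟨w, hw⟩
    obtain ⟨w, hw', rfl⟩ := hsurj w
    have hkj : k + j ∈ Finset.Icc 1 (8 * q + 18) := by rw [Finset.mem_Icc]; omega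
    have h2 := (mem_image_iff ht.injOn hkj hi hw').1 hw
    have h3 := zhaoXiao_unique hkj hui h2 (Or.inr rfl) (Or.inl rfl)
    have h4 := (zhaoXiao_mem hkj hui).2.2
    simp only [Prod.mk.injEq] at h3
    exact h4 h3.1
  · intro k hk hk' v
    rw [e] at hk'
    obtain ⟨i, hi, rfl⟩ := hsurj v
    obtain ⟨-, j, hj, u, hu, hui⟩ | h := hmixed k hk hk' i
    swap
    · exact absurd hi h
    refine ⟨j, hj, ?_⟩
    rintro ⟨w, hw⟩
    obtain ⟨w, hw', rfl⟩ := hsurj w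
    have hkj : k + j ∈ Finset.Icc 1 (8 * q + 18) := by rw [Finset.mem_Icc]; omega
    have h2 := (mem_image_iff ht.injOn hkj hw' hi).1 hw
    have h3 := zhaoXiao_unique hkj hui h2 (Or.inl rfl) (Or.inr rfl)
    have h4 := (zhaoXiao_mem hkj hui).2.2
    simp only [Prod.mk.injEq] at h3
    exact h4 h3.2.symm

end Feasible

variable {V : Type*}

/-! ### Matchings and pairings -/

/-- `τ` pairs the elements of `U`. -/
def IsPairing (U : Finset V) (τ : V → V) : Prop := ∀ u ∈ U, τ u ∈ U ∧ τ u ≠ u ∧ τ (τ u) = u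

theorem IsPairing.even_card {U : Finset V} {τ : V → V} (h : IsPairing U τ) : Even U.card := by
  -- A product of factors −1 cancels along the orbits of the fixed-point-free involution, so (−1) to
  -- the cardinality is 1.
  have := Finset.prod_involution (s := U) (f := fun _ => (-1 : ℤ)) (fun a _ => τ a) (by simp)
    (fun a ha _ => (h a ha).2.1) (fun a ha => (h a ha).1) (fun a ha => (h a ha).2.2)
  rw [Finset.prod_const] at this
  exact (neg_one_pow_eq_one_iff_even (by decide)).1 this

theorem exists_isPairing (U : Finset V) (h : Even U.card) : ∃ τ, IsPairing U τ := by
  classical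
  obtain ⟨k, hk⟩ := h
  induction k generalizing U with
  | zero =>
    have : U = ∅ := by rw [← Finset.card_eq_zero]; omega
    subst this
    exact ⟨id, fun u hu => absurd hu (Finset.notMem_empty u)⟩
  | succ k ih =>
    obtain ⟨a, ha⟩ : U.Nonempty := by rw [← Finset.card_pos]; omega
    have h1 : (U.erase a).card = U.card - 1 := Finset.card_erase_of_mem ha
    obtain ⟨b, hb⟩ : (U.erase a).Nonempty := by rw [← Finset.card_pos]; omega
    have h2 := Finset.card_erase_of_mem hb
    obtain ⟨τ, hτ⟩ := ih ((U.erase a).erase b) (by omega)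
    have hbU := Finset.mem_of_mem_erase hb
    have hba := Finset.ne_of_mem_erase hb
    refine ⟨fun u => if u = a then b else if u = b then a else τ u, fun u hu => ?_⟩
    by_cases hua : u = a
    · subst hua
      simp [hba, hbU]
    by_cases hub : u = b
    · subst hub
      simp [hba, ha, hba.symm]
    · obtain ⟨h3, h4, h5⟩ := hτ u (Finset.mem_erase.2 ⟨hub, Finset.mem_erase.2 ⟨hua, hu⟩⟩)
      have h6 := Finset.ne_of_mem_erase h3
      have h7 := Finset.mem_of_mem_erase h3
      simp only [hua, hub, if_false, h6, Finset.ne_of_mem_erase h7]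
      exact ⟨Finset.mem_of_mem_erase h7, h4, h5⟩

/-- A pairing of a subset of a set with an even number of elements extends to the whole set. -/
theorem IsPairing.extend [DecidableEq V] {U A : Finset V} {σ : V → V} (hA : IsPairing A σ)
    (hAU : A ⊆ U) (hU : Even U.card) :
    ∃ τ, IsPairing U τ ∧ (∀ u ∈ A, τ u = σ u) ∧ ∀ u ∈ U, u ∉ A → τ u ∉ A := by
  have hB : Even (U \ A).card := by
    have h1 := Finset.card_sdiff_add_card_eq_card hAU
    have h2 := hA.even_card
    rw [← h1] at hU
    exact (Nat.even_add.1 hU).2 h2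
  obtain ⟨ρ, hρ⟩ := exists_isPairing _ hB
  refine ⟨fun u => if u ∈ A then σ u else ρ u, fun u hu => ?_, fun u hu => if_pos hu,
    fun u hu hu' => ?_⟩
  · by_cases huA : u ∈ A
    · obtain ⟨h1, h2, h3⟩ := hA u huA
      simp only [huA, if_true, h1]
      exact ⟨hAU h1, h2, h3⟩
    · obtain ⟨h1, h2, h3⟩ := hρ u (Finset.mem_sdiff.2 ⟨hu, huA⟩)
      rw [Finset.mem_sdiff] at h1
      simp only [huA, if_false, h1.2]
      exact ⟨h1.1, h2, h3⟩
  · simp only [hu', if_false]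
    exact (Finset.mem_sdiff.1 (hρ u (Finset.mem_sdiff.2 ⟨hu, hu'⟩)).1).2

/-- The matching defined by a pairing. -/
def IsPairing.matching {U : Finset V} {τ : V → V} (h : IsPairing U τ) :
    (⊤ : SimpleGraph V).Subgraph where
  verts := U
  Adj u v := u ∈ U ∧ τ u = v
  adj_sub := by
    rintro u v ⟨hu, rfl⟩
    exact fun he => (h u hu).2.1 he.symm
  edge_vert := fun ⟨hu, _⟩ => hu
  symm := ⟨by
    rintro u v ⟨hu, rfl⟩
    exact ⟨(h u hu).1, (h u hu).2.2⟩⟩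

theorem IsPairing.isMatching {U : Finset V} {τ : V → V} (h : IsPairing U τ) :
    h.matching.IsMatching := fun u hu => ⟨τ u, ⟨hu, rfl⟩, fun _ hv => hv.2.symm⟩

/-- Every matching is given by a pairing. -/
theorem exists_isPairing_of_isMatching {U : Finset V} {M : (⊤ : SimpleGraph V).Subgraph}
    (hU : M.verts = U) (hM : M.IsMatching) :
    ∃ τ, IsPairing U τ ∧ ∀ u v, M.Adj u v ↔ u ∈ U ∧ τ u = v := by
  classical
  have h : ∀ u, ∃ v, u ∈ U → M.Adj u v := fun u => by
    by_cases hu : u ∈ U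
    · obtain ⟨v, hv, -⟩ := hM (show u ∈ M.verts by rw [hU]; exact hu)
      exact ⟨v, fun _ => hv⟩
    · exact ⟨u, fun hu' => absurd hu' hu⟩
  choose τ hτ using h
  have hv : ∀ {u v}, M.Adj u v → u ∈ U := fun h => by
    have := M.edge_vert h
    rwa [hU] at this
  have hadj : ∀ u v, M.Adj u v ↔ u ∈ U ∧ τ u = v := fun u v =>
    ⟨fun h => ⟨hv h, hM.eq_of_adj_left (hτ u (hv h)) h⟩, by
      rintro ⟨hu, rfl⟩
      exact hτ u hu⟩
  refine ⟨τ, fun u hu => ⟨hv (hτ u hu).symm, fun he => ?_, ?_⟩, hadj⟩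
  · have := hτ u hu
    rw [he] at this
    exact M.loopless.irrefl u this
  · exact ((hadj _ _).1 (hτ u hu).symm).2

theorem edgeLen_nonneg [PseudoMetricSpace V] (e : Sym2 V) : 0 ≤ edgeLen e := by
  induction e with
  | h u v => exact dist_nonneg

section Length

variable [Fintype V] [PseudoMetricSpace V]

open scoped Classical in
-- Every edge carries two darts, and darts are the adjacent ordered pairs.
theorem two_mul_graphLen (G : SimpleGraph V) :
    2 * graphLen G = ∑ u : V, ∑ v : V, if G.Adj u v then dist u v else 0 := by
  have h1 : ∑ d : G.Dart, edgeLen d.edge = 2 * graphLen G := by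
    rw [← Finset.sum_fiberwise_of_maps_to (s := Finset.univ) (t := G.edgeFinset)
      (g := fun d : G.Dart => d.edge) (fun d _ => by simp), graphLen, Finset.mul_sum]
    refine Finset.sum_congr rfl fun e he => ?_
    rw [Finset.sum_congr rfl (g := fun _ => edgeLen e) (fun d hd => by
      rw [(Finset.mem_filter.1 hd).2]), Finset.sum_const,
      G.dart_edge_fiber_card e (by simpa using he)]
    simp
  rw [← h1, ← Finset.sum_product', ← Finset.sum_filter]
  refine Finset.sum_bij (fun d _ => (d.fst, d.snd)) ?_ ?_ ?_ ?_
  · intro d _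
    simp [d.adj]
  · intro d _ d' _ h
    exact SimpleGraph.Dart.ext _ _ h
  · rintro ⟨u, v⟩ h
    simp only [Finset.univ_product_univ, Finset.mem_filter, Finset.mem_univ, true_and] at h
    exact ⟨⟨(u, v), h⟩, Finset.mem_univ _, rfl⟩
  · intro d _
    rfl

theorem two_mul_graphLen_matching {U : Finset V} {τ : V → V}
    {M : (⊤ : SimpleGraph V).Subgraph} (hM : ∀ u v, M.Adj u v ↔ u ∈ U ∧ τ u = v) :
    2 * graphLen M.spanningCoe = ∑ u ∈ U, dist u (τ u) := by
  classical
  rw [two_mul_graphLen, ← Finset.sum_filter_add_sum_filter_not Finset.univ (· ∈ U)]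
  have h0 : ∑ u with u ∉ U, ∑ v : V, (if M.spanningCoe.Adj u v then dist u v else 0) = 0 := by
    refine Finset.sum_eq_zero fun u hu => Finset.sum_eq_zero fun v _ => if_neg fun h => ?_
    exact (Finset.mem_filter.1 hu).2 ((hM u v).1 h).1
  rw [h0, add_zero, Finset.filter_mem_eq_inter, Finset.univ_inter]
  refine Finset.sum_congr rfl fun u hu => ?_
  rw [Finset.sum_eq_single (τ u)]
  · exact if_pos ((hM u _).2 ⟨hu, rfl⟩)
  · intro v _ hv
    exact if_neg fun h => hv ((hM u v).1 h).2.symm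
  · simp

theorem graphLen_mono {G H : SimpleGraph V} (h : G ≤ H) : graphLen G ≤ graphLen H := by
  classical
  unfold graphLen
  refine Finset.sum_le_sum_of_subset_of_nonneg ?_ fun e _ _ => edgeLen_nonneg e
  intro e he
  rw [SimpleGraph.mem_edgeFinset] at he ⊢
  exact SimpleGraph.edgeSet_mono h he

theorem IsMinMatchingOn.two_mul_graphLen_le {U : Finset V} {M : (⊤ : SimpleGraph V).Subgraph}
    (hM : IsMinMatchingOn (U : Set V) M) {τ : V → V} (hτ : IsPairing U τ) :
    2 * graphLen M.spanningCoe ≤ ∑ u ∈ U, dist u (τ u) := by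
  rw [← two_mul_graphLen_matching (M := hτ.matching) (fun u v => Iff.rfl)]
  have := hM.2.2 hτ.matching rfl hτ.isMatching
  linarith

theorem exists_isMinMatchingOn (U : Finset V) (hU : Even U.card) :
    ∃ M, IsMinMatchingOn (U : Set V) M := by
  obtain ⟨τ, hτ⟩ := exists_isPairing U hU
  obtain ⟨M, hM, hmin⟩ := Set.exists_min_image
    {M : (⊤ : SimpleGraph V).Subgraph | M.verts = U ∧ M.IsMatching}
    (fun M => graphLen M.spanningCoe) (Set.toFinite _) ⟨hτ.matching, rfl, hτ.isMatching⟩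
  exact ⟨M, hM.1, hM.2, fun M' h1 h2 => hmin M' ⟨h1, h2⟩⟩

theorem exists_isMinSpanningTree [Nonempty V] : ∃ T : SimpleGraph V, IsMinSpanningTree T := by
  obtain ⟨T, -, hT⟩ := (SimpleGraph.connected_top (V := V)).exists_isTree_le
  obtain ⟨T, hT, hmin⟩ := Set.exists_min_image {T : SimpleGraph V | T.IsTree} graphLen
    (Set.toFinite _) ⟨T, hT⟩
  exact ⟨T, hT, fun T' h => hmin T' h⟩

end Length

/-! ### Travel and savings -/

theorem sum_Icc_one {M : Type*} [AddCommMonoid M] (K : ℕ) (f : ℕ → M) :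
    ∑ k ∈ Finset.Icc 1 K, f k = ∑ k ∈ Finset.range K, f (k + 1) := by
  rw [Finset.range_eq_Ico, Finset.sum_Ico_add' f 0 K 1]
  rfl

theorem location_of_away {n : ℕ} {S : Schedule V} (hS : IsFeasible 2 n S) {k : ℕ}
    (hk : k ∈ Finset.Icc 1 (2 * (n - 1))) {a v : V} (h : (a, v) ∈ S k) :
    location n S v k = a := by
  have h' : k ∈ Finset.Icc 1 (2 * (n - 1)) ∧ PlaysAway S k v := ⟨hk, a, h⟩
  unfold location
  rw [dif_pos h']
  have := (hS.one_game k hk v).unique (y₁ := (h'.2.choose, v)) (y₂ := (a, v))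
    ⟨h'.2.choose_spec, Or.inr rfl⟩ ⟨h, Or.inr rfl⟩
  exact congrArg Prod.fst this

theorem mem_of_location_ne {n : ℕ} {S : Schedule V} {k : ℕ} {v : V}
    (h : location n S v k ≠ v) :
    k ∈ Finset.Icc 1 (2 * (n - 1)) ∧ (location n S v k, v) ∈ S k := by
  unfold location at h ⊢
  split_ifs at h ⊢ with h'
  · exact ⟨h'.1, h'.2.choose_spec⟩
  · exact absurd rfl h

theorem location_zero {n : ℕ} {S : Schedule V} {v : V} : location n S v 0 = v := by
  by_contra h
  simpa using (mem_of_location_ne h).1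

theorem location_end {n : ℕ} {S : Schedule V} {v : V} :
    location n S v (2 * (n - 1) + 1) = v := by
  by_contra h
  simpa using (mem_of_location_ne h).1

theorem location_ne_of_away {n : ℕ} {S : Schedule V} (hS : IsFeasible 2 n S) {v : V} {k l : ℕ}
    (h : location n S v k ≠ v) (hkl : k ≠ l) : location n S v k ≠ location n S v l := by
  intro he
  obtain ⟨hk, hmem⟩ := mem_of_location_ne h
  obtain ⟨hl, hmem'⟩ := mem_of_location_ne (he ▸ h : location n S v l ≠ v)
  rw [← he] at hmem'
  exact hkl ((hS.double_round_robin _ v h).unique ⟨hk, hmem⟩ ⟨hl, hmem'⟩)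

theorem location_eq_of_two {n : ℕ} {S : Schedule V} (hS : IsFeasible 2 n S) {v : V} {k : ℕ}
    (h0 : location n S v k ≠ v) (h1 : location n S v (k + 1) ≠ v) :
    location n S v (k + 2) = v := by
  by_contra h2
  obtain ⟨hk, m0⟩ := mem_of_location_ne h0
  obtain ⟨-, m1⟩ := mem_of_location_ne h1
  obtain ⟨hk', m2⟩ := mem_of_location_ne h2
  rw [Finset.mem_Icc] at hk hk'
  obtain ⟨j, hj, hj'⟩ := hS.bounded_away k hk.1 hk'.2 v
  interval_cases j
  exacts [hj' ⟨_, m0⟩, hj' ⟨_, m1⟩, hj' ⟨_, m2⟩]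

open scoped Classical in
/-- A sum over the days as a sum over the opponents. -/
theorem sum_days [Fintype V] {n : ℕ} {S : Schedule V} (hS : IsFeasible 2 n S) (v : V) (g : ℕ → V → ℝ)
    (hg : ∀ k, g k v = 0) :
    ∑ k ∈ Finset.Icc 1 (2 * (n - 1)), g k (location n S v k) =
      ∑ a : V, ∑ k ∈ Finset.Icc 1 (2 * (n - 1)), if (a, v) ∈ S k then g k a else 0 := by
  rw [Finset.sum_comm]
  refine Finset.sum_congr rfl fun k hk => ?_
  by_cases hloc : location n S v k = v
  · rw [hloc, hg]
    refine (Finset.sum_eq_zero fun a _ => ?_).symm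
    split_ifs with ha
    · have := location_of_away hS hk ha
      rw [← this, hloc, hg]
    · rfl
  · obtain ⟨-, hmem⟩ := mem_of_location_ne hloc
    rw [Finset.sum_eq_single (location n S v k), if_pos hmem]
    · intro a _ ha
      refine if_neg fun h => ha (location_of_away hS hk h).symm
    · simp

open scoped Classical in
theorem sum_visit {n : ℕ} {S : Schedule V} (hS : IsFeasible 2 n S) {v a : V} (hav : a ≠ v)
    {k : ℕ} (hk : k ∈ Finset.Icc 1 (2 * (n - 1))) (h : (a, v) ∈ S k) (g : ℕ → ℝ) :
    (∑ k ∈ Finset.Icc 1 (2 * (n - 1)), if (a, v) ∈ S k then g k else 0) = g k := by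
  rw [Finset.sum_eq_single k, if_pos h]
  · intro l hl hlk
    exact if_neg fun h' => hlk ((hS.double_round_robin a v hav).unique ⟨hl, h'⟩ ⟨hk, h⟩)
  · exact fun h' => absurd hk h'

/-! ### Savings compared with a return home after every away game -/

section Metric

variable [PseudoMetricSpace V]

/-- The distance saved by team `v` if it travels from `a` to `b` without returning home. -/
noncomputable def detour (v a b : V) : ℝ := dist v a + dist v b - dist a b

theorem detour_nonneg (v a b : V) : 0 ≤ detour v a b := by
  have := dist_triangle_left a b v
  unfold detour
  linarith

theorem detour_comm (v a b : V) : detour v a b = detour v b a := by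
  unfold detour
  rw [dist_comm a b]
  ring

@[simp]
theorem detour_self_left (v a : V) : detour v v a = 0 := by simp [detour]

@[simp]
theorem detour_self_right (v a : V) : detour v a v = 0 := by simp [detour, dist_comm a v]

open scoped Classical in
/-- The distance saved by team `v` on the day after its visit to `a`. -/
noncomputable def saving (n : ℕ) (S : Schedule V) (v a : V) : ℝ :=
  ∑ k ∈ Finset.Icc 1 (2 * (n - 1)),
    if (a, v) ∈ S k then detour v a (location n S v (k + 1)) else 0

theorem saving_nonneg (n : ℕ) (S : Schedule V) (v a : V) : 0 ≤ saving n S v a := by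
  unfold saving
  refine Finset.sum_nonneg fun k _ => ?_
  split_ifs
  · exact detour_nonneg _ _ _
  · exact le_rfl

theorem detour_le_saving {n : ℕ} {S : Schedule V} (hS : IsFeasible 2 n S) {v a b : V} {k : ℕ}
    (hk : 1 ≤ k) (hk' : k + 1 ≤ 2 * (n - 1)) (ha : (a, v) ∈ S k) (hb : (b, v) ∈ S (k + 1)) :
    detour v a b ≤ saving n S v a := by
  classical
  have hloc := location_of_away hS (k := k + 1) (by rw [Finset.mem_Icc]; omega) hb
  unfold saving
  refine le_trans ?_ (Finset.single_le_sum (f := fun k => if (a, v) ∈ S k then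
    detour v a (location n S v (k + 1)) else 0) (fun k _ => ?_)
    (Finset.mem_Icc.2 ⟨hk, by omega⟩ : k ∈ Finset.Icc 1 (2 * (n - 1))))
  · simp [ha, hloc]
  · split_ifs
    · exact detour_nonneg _ _ _
    · exact le_rfl

variable [Fintype V]

theorem sum_dist_location {n : ℕ} {S : Schedule V} (hS : IsFeasible 2 n S) (v : V) :
    ∑ k ∈ Finset.Icc 1 (2 * (n - 1)), dist v (location n S v k) = distSum v := by
  classical
  rw [sum_days hS v (fun _ a => dist v a) (by simp), distSum]
  refine Finset.sum_congr rfl fun a _ => ?_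
  by_cases hav : a = v
  · subst hav
    simp
  · obtain ⟨k, ⟨hk, hk'⟩, -⟩ := hS.double_round_robin a v hav
    exact sum_visit hS hav hk hk' fun _ => dist v a

/-- The distance traveled by a team is twice the sum of its distances minus its savings. -/
theorem sum_dist_eq {n : ℕ} {S : Schedule V} (hS : IsFeasible 2 n S) (v : V) :
    ∑ k ∈ Finset.range (2 * (n - 1) + 1), dist (location n S v k) (location n S v (k + 1)) =
      2 * distSum v - ∑ a, saving n S v a := by
  classical
  obtain ⟨K, hK⟩ : ∃ K, K = 2 * (n - 1) := ⟨_, rfl⟩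
  -- The distance between consecutive locations is d(v, now) + d(v, next) − detour. The sum of the
  -- first terms and that of the second terms are both D(v), because each opponent is visited once
  -- and the tour starts and ends at v.
  have hsav : ∑ a, saving n S v a = ∑ k ∈ Finset.Icc 1 (2 * (n - 1)),
      detour v (location n S v k) (location n S v (k + 1)) :=
    (sum_days hS v (fun k a => detour v a (location n S v (k + 1))) (by simp)).symm
  have h1 : ∀ f : ℕ → ℝ, f 0 = 0 →
      ∑ k ∈ Finset.range (K + 1), f k = ∑ k ∈ Finset.Icc 1 K, f k := fun f hf => by
    rw [Finset.sum_range_succ', hf, add_zero, sum_Icc_one]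
  have h2 : ∑ k ∈ Finset.range (K + 1), dist v (location n S v (k + 1)) = distSum v := by
    rw [Finset.sum_range_succ, hK, location_end, dist_self, add_zero, ← sum_dist_location hS, ← hK,
      ← h1 (fun k => dist v (location n S v k)) (by rw [location_zero, dist_self]),
      Finset.sum_range_succ']
    rw [location_zero, dist_self, add_zero]
  have h3 : ∑ k ∈ Finset.range (K + 1), dist v (location n S v k) = distSum v := by
    rw [h1 _ (by rw [location_zero, dist_self]), hK, sum_dist_location hS]
  rw [hsav, ← hK, ← h1 (fun k => detour v (location n S v k) (location n S v (k + 1)))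
    (by rw [location_zero, detour_self_left])]
  unfold detour
  rw [Finset.sum_sub_distrib, Finset.sum_add_distrib, h2, h3]
  ring

theorem travel_eq {n : ℕ} {S : Schedule V} (hS : IsFeasible 2 n S) :
    travel n S = ∑ v, (2 * distSum v - ∑ a, saving n S v a) :=
  Finset.sum_congr rfl fun v _ => sum_dist_eq hS v

/-! ### The lower bound -/

/-- A team travels at least the sum of its distances plus the weight of some perfect matching. -/
theorem exists_pairing_le {n : ℕ} {S : Schedule V} (hS : IsFeasible 2 n S)
    (heven : Even (Fintype.card V)) (v : V) :
    ∃ τ : V → V, IsPairing Finset.univ τ ∧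
      ∑ u, dist u (τ u) ≤ 2 * (distSum v - ∑ a, saving n S v a) := by
  classical
  have hday : ∀ a, ∃ k, a ≠ v → k ∈ Finset.Icc 1 (2 * (n - 1)) ∧ (a, v) ∈ S k := fun a => by
    by_cases h : a = v
    · exact ⟨0, fun h' => absurd h h'⟩
    · obtain ⟨k, hk, -⟩ := hS.double_round_robin a v h
      exact ⟨k, fun _ => hk⟩
  choose day hday using hday
  have hloc : ∀ a, a ≠ v → location n S v (day a) = a := fun a ha =>
    location_of_away hS (hday a ha).1 (hday a ha).2
  have hday_loc : ∀ k, location n S v k ≠ v → day (location n S v k) = k := fun k hk => by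
    by_contra hne
    have := location_ne_of_away hS hk (Ne.symm hne)
    rw [hloc _ hk] at this
    exact this rfl
  -- N a and P a are the opponents visited by v on the day after and the day before a, with value v
  -- if v is then at home. As trips have at most two away games, at most one of the two differs from
  -- v, and N and P are mutually inverse where they do.
  let N : V → V := fun a => if a = v then v else location n S v (day a + 1)
  let P : V → V := fun a => if a = v then v else location n S v (day a - 1)
  have hpos : ∀ a, a ≠ v → 1 ≤ day a := fun a ha => (Finset.mem_Icc.1 (hday a ha).1).1
  have hPN : ∀ a, N a ≠ v → P (N a) = a ∧ N (N a) = v ∧ N a ≠ a ∧ P a = v := by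
    intro a ha
    have hav : a ≠ v := fun h => ha (if_pos h)
    have hNa : N a = location n S v (day a + 1) := if_neg hav
    rw [hNa] at ha
    have hd := hday_loc _ ha
    refine ⟨?_, ?_, ?_, ?_⟩
    · simp only [P]
      rw [hNa, if_neg ha, hd, Nat.add_sub_cancel, hloc a hav]
    · rw [hNa]
      simp only [N]
      rw [if_neg ha, hd]
      exact location_eq_of_two hS (by rw [hloc a hav]; exact hav) ha
    · have := location_ne_of_away hS ha (l := day a) (by omega)
      rw [hloc a hav] at this
      rwa [hNa]
    · simp only [P]
      rw [if_neg hav]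
      by_contra hP
      have h1 := hpos a hav
      obtain ⟨l, hl⟩ : ∃ l, day a = l + 1 := ⟨day a - 1, by omega⟩
      rw [hl] at ha hP
      have hla : location n S v (l + 1) ≠ v := by rw [← hl, hloc a hav]; exact hav
      exact ha (location_eq_of_two hS hP hla)
  have hNP : ∀ a, P a ≠ v → N (P a) = a ∧ P (P a) = v ∧ P a ≠ a ∧ N a = v := by
    intro a ha
    have hav : a ≠ v := fun h => ha (if_pos h)
    have hPa : P a = location n S v (day a - 1) := if_neg hav
    have h1 := hpos a hav
    have hN : N (P a) = a := by
      rw [hPa] at ha ⊢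
      simp only [N]
      rw [if_neg ha, hday_loc _ ha, Nat.sub_add_cancel h1, hloc a hav]
    have h2 := hPN (P a) (by rw [hN]; exact hav)
    rw [hN] at h2
    exact ⟨hN, h2.2.2.2, h2.2.2.1.symm, h2.2.1⟩
  let A : Finset V := Finset.univ.filter fun a => N a ≠ v ∨ P a ≠ v
  let σ : V → V := fun a => if N a ≠ v then N a else P a
  have hσ : IsPairing A σ := by
    intro a ha
    rcases (Finset.mem_filter.1 ha).2 with h | h
    · obtain ⟨h1, h2, h3, h4⟩ := hPN a h
      have hav : a ≠ v := fun h' => h (if_pos h')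
      have e : σ a = N a := if_pos h
      rw [e]
      refine ⟨Finset.mem_filter.2 ⟨Finset.mem_univ _, Or.inr (by rw [h1]; exact hav)⟩, h3, ?_⟩
      simp only [σ]
      rw [if_neg (by rw [h2]; simp), h1]
    · obtain ⟨h1, h2, h3, h4⟩ := hNP a h
      have hav : a ≠ v := fun h' => h (if_pos h')
      have e : σ a = P a := if_neg (by rw [h4]; simp)
      rw [e]
      refine ⟨Finset.mem_filter.2 ⟨Finset.mem_univ _, Or.inl (by rw [h1]; exact hav)⟩, h3, ?_⟩
      simp only [σ]
      rw [if_pos (by rw [h1]; exact hav), h1]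
  -- Opponents on single-game trips and v itself are paired arbitrarily. Their number is even
  -- because the number of teams is.
  obtain ⟨τ, hτ, hτA, -⟩ := hσ.extend (Finset.subset_univ A) (by rwa [Finset.card_univ])
  refine ⟨τ, hτ, ?_⟩
  have hbij : ∑ u, dist v (τ u) = ∑ u, dist v u :=
    Finset.sum_nbij' τ τ (fun _ _ => Finset.mem_univ _) (fun _ _ => Finset.mem_univ _)
      (fun u hu => (hτ u hu).2.2) (fun u hu => (hτ u hu).2.2) (fun _ _ => rfl)
  -- On two-game trips one detour vanishes and the other one makes this an equality; elsewhere both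
  -- vanish and it is the triangle inequality through v.
  have hpoint : ∀ u, dist u (τ u) ≤ dist v u + dist v (τ u) - detour v u (N u) -
      detour v u (P u) := by
    intro u
    by_cases huA : u ∈ A
    · rw [hτA u huA]
      rcases (Finset.mem_filter.1 huA).2 with h | h
      · obtain ⟨h1, h2, h3, h4⟩ := hPN u h
        have e : σ u = N u := if_pos h
        rw [e, h4, detour_self_right]
        unfold detour
        linarith
      · obtain ⟨h1, h2, h3, h4⟩ := hNP u h
        have e : σ u = P u := if_neg (by rw [h4]; simp)
        rw [e, h4, detour_self_right]
        unfold detour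
        linarith
    · have h : N u = v ∧ P u = v := by
        have : ¬(N u ≠ v ∨ P u ≠ v) := fun h =>
          huA (Finset.mem_filter.2 ⟨Finset.mem_univ _, h⟩)
        tauto
      rw [h.1, h.2, detour_self_right]
      have := dist_triangle_left u (τ u) v
      linarith
  have hsavN : ∀ u, saving n S v u = detour v u (N u) := by
    intro u
    by_cases h : u = v
    · have e : N u = v := if_pos h
      rw [e, detour_self_right]
      subst h
      unfold saving
      refine Finset.sum_eq_zero fun k _ => ?_
      split_ifs <;> simp
    · have e : N u = location n S v (day u + 1) := if_neg h
      rw [e]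
      exact sum_visit hS h (hday u h).1 (hday u h).2
        fun k => detour v u (location n S v (k + 1))
  -- Each trip is seen once from its first and once from its second opponent, so the saving is
  -- counted twice.
  have hswap : ∑ u, detour v u (P u) = ∑ u, detour v u (N u) := by
    have h1 : ∑ u, detour v u (P u) = ∑ u with P u ≠ v, detour v u (P u) := by
      rw [Finset.sum_filter_of_ne]
      intro u _ hu hP
      rw [hP, detour_self_right] at hu
      exact hu rfl
    have h2 : ∑ u, detour v u (N u) = ∑ u with N u ≠ v, detour v u (N u) := by
      rw [Finset.sum_filter_of_ne]
      intro u _ hu hN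
      rw [hN, detour_self_right] at hu
      exact hu rfl
    rw [h1, h2]
    refine Finset.sum_nbij' P N ?_ ?_ ?_ ?_ ?_
    · intro u hu
      have hu := (Finset.mem_filter.1 hu).2
      refine Finset.mem_filter.2 ⟨Finset.mem_univ _, ?_⟩
      rw [(hNP u hu).1]
      exact fun h => hu (if_pos h)
    · intro u hu
      have hu := (Finset.mem_filter.1 hu).2
      refine Finset.mem_filter.2 ⟨Finset.mem_univ _, ?_⟩
      rw [(hPN u hu).1]
      exact fun h => hu (if_pos h)
    · intro u hu
      exact (hNP u (Finset.mem_filter.1 hu).2).1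
    · intro u hu
      exact (hPN u (Finset.mem_filter.1 hu).2).1
    · intro u hu
      rw [(hNP u (Finset.mem_filter.1 hu).2).1, detour_comm]
  calc ∑ u, dist u (τ u) ≤ ∑ u, (dist v u + dist v (τ u) - detour v u (N u) -
        detour v u (P u)) := Finset.sum_le_sum fun u _ => hpoint u
    _ = 2 * (distSum v - ∑ a, saving n S v a) := by
      rw [Finset.sum_sub_distrib, Finset.sum_sub_distrib, Finset.sum_add_distrib, hbij, hswap,
        Finset.sum_congr rfl fun u _ => hsavN u, distSum]
      ring

/-- The lower bound on the travel of every feasible schedule. -/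
theorem le_travel {n : ℕ} {S : Schedule V} (hS : IsFeasible 2 n S)
    (hV : Fintype.card V = n) (heven : Even n) {M : (⊤ : SimpleGraph V).Subgraph}
    (hM : IsMinMatchingOn Set.univ M) :
    ∑ v : V, distSum v + n * graphLen M.spanningCoe ≤ travel n S := by
  have h : ∀ v, distSum v + graphLen M.spanningCoe ≤
      2 * distSum v - ∑ a, saving n S v a := fun v => by
    obtain ⟨τ, hτ, hle⟩ := exists_pairing_le hS (by rwa [hV]) v
    have hM' : IsMinMatchingOn ((Finset.univ : Finset V) : Set V) M := by
      rwa [Finset.coe_univ]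
    have := hM'.two_mul_graphLen_le hτ
    linarith
  have h2 := Finset.sum_le_sum fun v (_ : v ∈ Finset.univ) => h v
  rw [Finset.sum_add_distrib, Finset.sum_const, Finset.card_univ, hV, nsmul_eq_mul] at h2
  rw [travel_eq hS]
  exact h2

end Metric

/-! ### The length of closed walks -/

section ClosedWalk

variable [PseudoMetricSpace V]

/-- The length of the closed walk that visits the vertices of a list in order. -/
noncomputable def closedLen (W : List V) : ℝ := ((closedWalkEdges W).map edgeLen).sum

/-- The length of the walk from `x` through the vertices of a list to `y`. -/
noncomputable def walkLen : V → List V → V → ℝ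
  | x, [], y => dist x y
  | x, z :: l, y => dist x z + walkLen z l y

theorem sum_zipWith (x y : V) (l : List V) :
    ((List.zipWith (fun u v => s(u, v)) (x :: l) (l ++ [y])).map edgeLen).sum = walkLen x l y := by
  induction l generalizing x with
  | nil => simp [walkLen, edgeLen]
  | cons z l ih =>
    have := ih z
    simp only [List.cons_append, List.zipWith_cons_cons, List.map_cons, List.sum_cons] at this ⊢
    rw [walkLen, ← this]
    simp [edgeLen]

@[simp]
theorem closedLen_nil : closedLen ([] : List V) = 0 := by simp [closedLen, closedWalkEdges]

theorem closedLen_cons (x : V) (l : List V) : closedLen (x :: l) = walkLen x l x := by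
  rw [← sum_zipWith, closedLen, closedWalkEdges, Multiset.map_coe, Multiset.sum_coe]
  simp

theorem walkLen_append_singleton (x y z : V) (l : List V) :
    walkLen x (l ++ [z]) y = walkLen x l z + dist z y := by
  induction l generalizing x with
  | nil => simp [walkLen]
  | cons w l ih => simp [walkLen, ih, add_assoc]

theorem walkLen_le_add_left (x y z : V) (l : List V) :
    walkLen x l y ≤ dist x z + walkLen z l y := by
  cases l with
  | nil => exact dist_triangle _ _ _
  | cons w l =>
    simp only [walkLen]
    linarith [dist_triangle x z w]

theorem walkLen_le_add_right (x y z : V) (l : List V) :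
    walkLen x l y ≤ walkLen x l z + dist z y := by
  induction l generalizing x with
  | nil => exact dist_triangle _ _ _
  | cons w l ih =>
    simp only [walkLen]
    linarith [ih w]

theorem walkLen_mono {l₁ l₂ : List V} (h : l₁.Sublist l₂) (x y : V) :
    walkLen x l₁ y ≤ walkLen x l₂ y := by
  induction h generalizing x with
  | slnil => exact le_rfl
  | cons z _ ih => exact (ih x).trans (walkLen_le_add_left _ _ _ _)
  | cons_cons z _ ih =>
    simp only [walkLen]
    linarith [ih z]

theorem closedLen_mono {l₁ l₂ : List V} (h : l₁.Sublist l₂) : closedLen l₁ ≤ closedLen l₂ := by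
  induction h with
  | slnil => exact le_rfl
  | @cons l₁ l₂ z _ ih =>
    refine ih.trans ?_
    cases l₂ with
    | nil => simp [closedLen_cons, walkLen]
    | cons w l =>
      rw [closedLen_cons, closedLen_cons, walkLen]
      linarith [walkLen_le_add_right w w z l]
  | cons_cons z h _ =>
    rw [closedLen_cons, closedLen_cons]
    exact walkLen_mono h _ _

theorem closedLen_rotate (l : List V) (k : ℕ) : closedLen (l.rotate k) = closedLen l := by
  induction k generalizing l with
  | zero => simp
  | succ k ih =>
    cases l with
    | nil => simp
    | cons x l =>
      rw [List.rotate_cons_succ, ih]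
      cases l with
      | nil => simp
      | cons w l =>
        rw [List.cons_append, closedLen_cons, closedLen_cons, walkLen_append_singleton, walkLen]
        ring

theorem walkLen_map_range' (f : ℕ → V) (a k : ℕ) (y : V) :
    walkLen (f a) ((List.range' (a + 1) k).map f) y =
      ∑ i ∈ Finset.range k, dist (f (a + i)) (f (a + i + 1)) + dist (f (a + k)) y := by
  induction k generalizing a with
  | zero => simp [walkLen]
  | succ k ih =>
    rw [List.range'_succ, List.map_cons, walkLen, ih, Finset.sum_range_succ']
    simp only [add_zero, show ∀ i, a + 1 + i = a + (i + 1) by intro i; ring]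
    ring

theorem closedLen_map_range (f : ℕ → V) (k : ℕ) :
    closedLen ((List.range (k + 1)).map f) =
      ∑ i ∈ Finset.range k, dist (f i) (f (i + 1)) + dist (f k) (f 0) := by
  rw [List.range_eq_range', List.range'_succ, List.map_cons, closedLen_cons, walkLen_map_range']
  simp

end ClosedWalk

/-! ### Spanning trees, matchings of the odd vertices, and perfect matchings -/

/-- Every pairing has a set of representatives. -/
theorem exists_representatives [Fintype V] {σ : V → V} (hσ : IsPairing Finset.univ σ) :
    ∃ R : Finset V, ∀ u, u ∈ R ↔ σ u ∉ R := by
  classical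
  let e := Fintype.equivFin V
  refine ⟨Finset.univ.filter fun u => e u < e (σ u), fun u => ?_⟩
  obtain ⟨-, h1, h2⟩ := hσ u (Finset.mem_univ _)
  simp only [Finset.mem_filter, Finset.mem_univ, true_and, h2, not_lt]
  have : e u ≠ e (σ u) := fun h => h1 (e.injective h).symm
  exact ⟨le_of_lt, fun h => lt_of_le_of_ne h this⟩

section Christofides

variable [Fintype V] [PseudoMetricSpace V]

/-- Every vertex is in R or paired with an element of R, so the pairs together with the star from v
to R form a connected graph. A spanning tree of it is at least as long as T. -/
theorem two_mul_graphLen_le_of_spanningTree {T : SimpleGraph V} (hT : IsMinSpanningTree T)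
    {σ : V → V} (hσ : IsPairing Finset.univ σ) {R : Finset V} (hR : ∀ u, u ∈ R ∨ σ u ∈ R) (v : V) :
    2 * graphLen T ≤ ∑ u, dist u (σ u) + 2 * ∑ u ∈ R, dist v u := by
  classical
  obtain ⟨G, hG⟩ : ∃ G : SimpleGraph V, ∀ a b, G.Adj a b ↔
      a ≠ b ∧ (σ a = b ∨ (a = v ∧ b ∈ R) ∨ (b = v ∧ a ∈ R)) :=
    ⟨{  Adj := fun a b => a ≠ b ∧ (σ a = b ∨ (a = v ∧ b ∈ R) ∨ (b = v ∧ a ∈ R))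
        symm := ⟨by
          rintro a b ⟨hab, h⟩
          refine ⟨hab.symm, h.imp (fun h => ?_) Or.symm⟩
          rw [← h, (hσ a (Finset.mem_univ _)).2.2]⟩
        loopless := ⟨fun a h => h.1 rfl⟩ }, fun _ _ => Iff.rfl⟩
  have hrep : ∀ u ∈ R, G.Reachable u v := fun u hu => by
    by_cases huv : u = v
    · rw [huv]
    · exact SimpleGraph.Adj.reachable ((hG _ _).2 ⟨huv, Or.inr (Or.inr ⟨rfl, hu⟩)⟩)
  have hreach : ∀ u, G.Reachable u v := fun u => by
    rcases hR u with h | h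
    · exact hrep u h
    · refine SimpleGraph.Reachable.trans (SimpleGraph.Adj.reachable
        ((hG _ _).2 ⟨?_, Or.inl rfl⟩)) (hrep _ h)
      exact (hσ u (Finset.mem_univ _)).2.1.symm
  have hconn : G.Connected :=
    { preconnected := fun a b => (hreach a).trans (hreach b).symm
      nonempty := ⟨v⟩ }
  obtain ⟨T', hle, hT'⟩ := hconn.exists_isTree_le
  have h1 := (hT.2 T' hT').trans (graphLen_mono hle)
  refine (mul_le_mul_of_nonneg_left h1 zero_le_two).trans ?_
  rw [two_mul_graphLen]
  -- The sum over ordered pairs counts each edge of the pairing and of the star in both directions.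
  have h2 : ∀ a b, (if G.Adj a b then dist a b else 0) ≤ (if σ a = b then dist a b else 0) +
      ((if a = v then (if b ∈ R then dist v b else 0) else 0) +
        (if b = v then (if a ∈ R then dist v a else 0) else 0)) := by
    intro a b
    have hp1 : 0 ≤ (if σ a = b then dist a b else 0) := by split_ifs <;> positivity
    have hp2 : 0 ≤ (if a = v then (if b ∈ R then dist v b else 0) else 0) := by
      split_ifs <;> positivity
    have hp3 : 0 ≤ (if b = v then (if a ∈ R then dist v a else 0) else 0) := by
      split_ifs <;> positivity
    by_cases hab : G.Adj a b
    · rw [if_pos hab]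
      rcases ((hG a b).1 hab).2 with h | ⟨h, h'⟩ | ⟨h, h'⟩
      · rw [if_pos h]
        linarith
      · have e : dist a b = dist v b := by rw [h]
        rw [if_pos h, if_pos h']
        linarith
      · have e : dist a b = dist v a := by rw [h, dist_comm]
        rw [if_pos h, if_pos h']
        linarith
    · rw [if_neg hab]
      linarith
  refine (Finset.sum_le_sum fun a _ => Finset.sum_le_sum fun b _ => h2 a b).trans (le_of_eq ?_)
  simp only [Finset.sum_add_distrib]
  rw [Finset.sum_comm (f := fun a b => if a = v then (if b ∈ R then dist v b else 0) else 0)]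
  simp only [Finset.sum_ite_eq, Finset.sum_ite_eq', Finset.mem_univ, if_true,
    Finset.sum_ite_mem, Finset.univ_inter]
  ring

/-- Pairs of σ inside U are kept. The other elements of U are paired arbitrarily, and each new edge
is routed through v by way of the star and, for an element outside R, of its own σ-edge. As U
contains only one end of each σ-pair used in this way, no part of the star and pairing is paid for
twice. -/
theorem exists_isPairing_le {U : Finset V} (hU : Even U.card) {σ : V → V}
    (hσ : IsPairing Finset.univ σ) {R : Finset V} (hR : ∀ u, u ∈ R ∨ σ u ∈ R) (v : V) :
    ∃ τ, IsPairing U τ ∧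
      ∑ u ∈ U, dist u (τ u) ≤ ∑ u, dist u (σ u) + 2 * ∑ u ∈ R, dist v u := by
  classical
  have hσσ : ∀ u, σ (σ u) = u := fun u => (hσ u (Finset.mem_univ _)).2.2
  let A : Finset V := U.filter fun u => σ u ∈ U
  have hA : IsPairing A σ := fun u hu => by
    obtain ⟨h1, h2⟩ := Finset.mem_filter.1 hu
    refine ⟨Finset.mem_filter.2 ⟨h2, by rwa [hσσ]⟩, (hσ u (Finset.mem_univ _)).2⟩
  obtain ⟨τ, hτ, hτA, hτA'⟩ := hA.extend (Finset.filter_subset _ _) hU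
  refine ⟨τ, hτ, ?_⟩
  -- The length of the branch at v that contains u and σ u: the edge between them and the star edges
  -- into the pair. It is the same for both ends, and it bounds the distance from v to either end.
  let p : V → ℝ := fun u => dist u (σ u) + ((if u ∈ R then dist v u else 0) +
    (if σ u ∈ R then dist v (σ u) else 0))
  have hp0 : ∀ u, 0 ≤ p u := fun u => by
    have h1 : 0 ≤ (if u ∈ R then dist v u else 0) := by split_ifs <;> positivity
    have h2 : 0 ≤ (if σ u ∈ R then dist v (σ u) else 0) := by split_ifs <;> positivity
    have h3 : 0 ≤ dist u (σ u) := dist_nonneg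
    simp only [p]
    linarith
  have hpσ : ∀ u, p (σ u) = p u := fun u => by
    simp only [p, hσσ, dist_comm (σ u) u]
    ring
  have hpv : ∀ u, dist u v ≤ p u := fun u => by
    have h1 : 0 ≤ (if u ∈ R then dist v u else 0) := by split_ifs <;> positivity
    have h2 : 0 ≤ (if σ u ∈ R then dist v (σ u) else 0) := by split_ifs <;> positivity
    have h3 : 0 ≤ dist u (σ u) := dist_nonneg
    simp only [p]
    rcases hR u with h | h
    · rw [if_pos h, dist_comm v u] at *
      linarith
    · rw [if_pos h] at *
      linarith [dist_triangle_right u v (σ u), dist_comm (σ u) v]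
  have hσsum : ∀ f : V → ℝ, ∑ u, f (σ u) = ∑ u, f u := fun f =>
    Finset.sum_nbij' σ σ (fun _ _ => Finset.mem_univ _) (fun _ _ => Finset.mem_univ _)
      (fun u _ => hσσ u) (fun u _ => hσσ u) (fun _ _ => rfl)
  have hpsum : ∑ u, p u = ∑ u, dist u (σ u) + 2 * ∑ u ∈ R, dist v u := by
    simp only [p, Finset.sum_add_distrib]
    rw [hσsum fun u => if u ∈ R then dist v u else 0]
    simp only [Finset.sum_ite_mem, Finset.univ_inter]
    ring
  rw [← hpsum]
  -- Half of the pairing edge at u is charged to u. If σ u is outside U, then u may also use the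
  -- share p (σ u), which no element of U claims otherwise; hence the sum of c over U is at most the
  -- sum of p.
  let c : V → ℝ := fun u => if σ u ∈ U then p u else p u + p (σ u)
  have hτsum : ∑ u ∈ U, c (τ u) = ∑ u ∈ U, c u :=
    Finset.sum_nbij' τ τ (fun u hu => (hτ u hu).1) (fun u hu => (hτ u hu).1)
      (fun u hu => (hτ u hu).2.2) (fun u hu => (hτ u hu).2.2) (fun _ _ => rfl)
  have hpoint : ∀ u ∈ U, 2 * dist u (τ u) ≤ c u + c (τ u) := by
    intro u hu
    by_cases huA : u ∈ A
    · have h1 := (Finset.mem_filter.1 huA).2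
      rw [hτA u huA]
      simp only [c]
      rw [if_pos h1, hσσ, if_pos hu, hpσ]
      have h1 : 0 ≤ (if u ∈ R then dist v u else 0) := by split_ifs <;> positivity
      have h2 : 0 ≤ (if σ u ∈ R then dist v (σ u) else 0) := by split_ifs <;> positivity
      simp only [p]
      linarith
    · have h1 : σ u ∉ U := fun h => huA (Finset.mem_filter.2 ⟨hu, h⟩)
      have h2 : σ (τ u) ∉ U := fun h =>
        hτA' u hu huA (Finset.mem_filter.2 ⟨(hτ u hu).1, h⟩)
      simp only [c]
      rw [if_neg h1, if_neg h2, hpσ, hpσ]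
      linarith [hpv u, hpv (τ u), dist_triangle_right u (τ u) v]
  have hcsum : ∑ u ∈ U, c u ≤ ∑ u, p u := by
    have h1 : ∑ u ∈ U, c u = ∑ u ∈ U, p u + ∑ u ∈ U with σ u ∉ U, p (σ u) := by
      rw [Finset.sum_filter, ← Finset.sum_add_distrib]
      refine Finset.sum_congr rfl fun u _ => ?_
      simp only [c]
      split_ifs <;> simp
    have h2 : ∑ u ∈ U with σ u ∉ U, p (σ u) ≤ ∑ u ∈ Uᶜ, p u := by
      rw [← Finset.sum_image (f := p) (g := σ)
        (fun a _ b _ h => by rw [← hσσ a, ← hσσ b, h])]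
      refine Finset.sum_le_sum_of_subset_of_nonneg ?_ fun u _ _ => hp0 u
      intro u hu
      obtain ⟨w, hw, rfl⟩ := Finset.mem_image.1 hu
      exact Finset.mem_compl.2 (Finset.mem_filter.1 hw).2
    rw [h1, ← Finset.sum_add_sum_compl U]
    linarith
  have := Finset.sum_le_sum hpoint
  rw [← Finset.mul_sum, Finset.sum_add_distrib, hτsum] at this
  linarith

/-- A Christofides cycle is at most as long as twice a perfect matching plus a star. -/
theorem closedLen_le {C : List V} (hC : IsChristofidesCycle C) {σ : V → V}
    (hσ : IsPairing Finset.univ σ) (v : V) :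
    closedLen C ≤ ∑ u, dist u (σ u) + distSum v := by
  classical
  obtain ⟨T, J, W, hT, hJ, hW, hCW, -, -⟩ := hC
  -- The bounds for T and J are used both with R and with its complement. Added up, the two stars
  -- have length D(v), so T and J cost half of D(v) each.
  obtain ⟨R, hR⟩ := exists_representatives hσ
  have h1 : ∀ u, u ∈ R ∨ σ u ∈ R := fun u => by
    have := hR u
    tauto
  have h2 : ∀ u, u ∈ Rᶜ ∨ σ u ∈ Rᶜ := fun u => by
    have := hR u
    simp only [Finset.mem_compl]
    tauto
  have hsum : ∑ u ∈ R, dist v u + ∑ u ∈ Rᶜ, dist v u = distSum v :=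
    Finset.sum_add_sum_compl R _
  have hlen : closedLen C ≤ graphLen T + graphLen J.spanningCoe := by
    refine (closedLen_mono hCW).trans (le_of_eq ?_)
    rw [closedLen, hW, Multiset.map_add, Multiset.sum_add]
    rfl
  have hT1 := two_mul_graphLen_le_of_spanningTree hT hσ h1 v
  have hT2 := two_mul_graphLen_le_of_spanningTree hT hσ h2 v
  let U : Finset V := Finset.univ.filter fun v => Odd (T.degree v)
  have hU : Even U.card := T.even_card_odd_degree_vertices
  have hJU : IsMinMatchingOn (U : Set V) J := by
    have e : (U : Set V) = {v | Odd (T.degree v)} := by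
      ext u
      simp [U]
    rw [e]
    exact hJ
  obtain ⟨τ₁, hτ₁, hle₁⟩ := exists_isPairing_le hU hσ h1 v
  obtain ⟨τ₂, hτ₂, hle₂⟩ := exists_isPairing_le hU hσ h2 v
  have hJ1 := (hJU.two_mul_graphLen_le hτ₁).trans hle₁
  have hJ2 := (hJU.two_mul_graphLen_le hτ₂).trans hle₂
  linarith

end Christofides

/-! ### Eulerian circuits of multigraphs -/

section Euler

/-- The edges of the walk from `x` through the vertices of a list to `y`. -/
def walkEdges : V → List V → V → Multiset (Sym2 V)
  | x, [], y => {s(x, y)}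
  | x, z :: l, y => s(x, z) ::ₘ walkEdges z l y

theorem closedWalkEdges_cons (x : V) (l : List V) :
    closedWalkEdges (x :: l) = walkEdges x l x := by
  have h : ∀ (l : List V) (x y : V), ((List.zipWith (fun u v => s(u, v)) (x :: l) (l ++ [y]) :
      List (Sym2 V)) : Multiset (Sym2 V)) = walkEdges x l y := by
    intro l
    induction l with
    | nil => intro x y; rfl
    | cons z l ih =>
      intro x y
      rw [walkEdges, ← ih z y]
      rfl
  rw [← h]
  simp [closedWalkEdges]

theorem walkEdges_append_cons (x y z : V) (l l' : List V) :
    walkEdges x (l ++ z :: l') y = walkEdges x l z + walkEdges z l' y := by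
  induction l generalizing x with
  | nil => simp [walkEdges]
  | cons w l ih => simp [walkEdges, ih]

theorem closedWalkEdges_rotate (l : List V) (k : ℕ) :
    closedWalkEdges (l.rotate k) = closedWalkEdges l := by
  induction k generalizing l with
  | zero => simp
  | succ k ih =>
    cases l with
    | nil => simp
    | cons x l =>
      rw [List.rotate_cons_succ, ih]
      cases l with
      | nil => simp
      | cons w l =>
        rw [List.cons_append, closedWalkEdges_cons, closedWalkEdges_cons, walkEdges_append_cons,
          walkEdges, walkEdges, add_comm, Multiset.singleton_add]

theorem card_walkEdges (x y : V) (l : List V) : (walkEdges x l y).card = l.length + 1 := by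
  induction l generalizing x with
  | nil => simp [walkEdges]
  | cons w l ih => simp [walkEdges, ih]

theorem mem_of_mem_walkEdges {x y : V} {l : List V} {e : Sym2 V} (h : e ∈ walkEdges x l y) {v : V}
    (hv : v ∈ e) : v = x ∨ v ∈ l ∨ v = y := by
  induction l generalizing x with
  | nil =>
    rw [walkEdges, Multiset.mem_singleton] at h
    subst h
    rw [Sym2.mem_iff] at hv
    tauto
  | cons w l ih =>
    rw [walkEdges, Multiset.mem_cons] at h
    rcases h with rfl | h
    · rw [Sym2.mem_iff] at hv
      rcases hv with rfl | rfl <;> simp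
    · rcases ih h with rfl | h | h <;> simp [*]

variable [DecidableEq V]

/-- The number of ends of an edge at a vertex. -/
def endCount (v : V) : Sym2 V → ℕ :=
  Sym2.lift ⟨fun a b => (if a = v then 1 else 0) + (if b = v then 1 else 0),
    fun _ _ => add_comm _ _⟩

/-- The degree of a vertex in a multigraph. -/
def edgeDegree (E : Multiset (Sym2 V)) (v : V) : ℕ := (E.map (endCount v)).sum

theorem edgeDegree_add (E F : Multiset (Sym2 V)) (v : V) :
    edgeDegree (E + F) v = edgeDegree E v + edgeDegree F v := by simp [edgeDegree]

theorem edgeDegree_walkEdges (x y : V) (l : List V) (v : V) :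
    (edgeDegree (walkEdges x l y) v + ((if x = v then 1 else 0) + (if y = v then 1 else 0))) % 2
      = 0 := by
  induction l generalizing x with
  | nil =>
    simp only [walkEdges, edgeDegree, Multiset.map_singleton, Multiset.sum_singleton, endCount,
      Sym2.lift_mk]
    omega
  | cons w l ih =>
    have := ih w
    simp only [walkEdges, edgeDegree, Multiset.map_cons, Multiset.sum_cons, endCount,
      Sym2.lift_mk] at this ⊢
    omega

theorem exists_mem_of_edgeDegree_pos {E : Multiset (Sym2 V)} {v : V} (h : edgeDegree E v ≠ 0) :
    ∃ z, s(v, z) ∈ E := by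
  by_contra hne
  push Not at hne
  refine h (Multiset.sum_eq_zero fun c hc => ?_)
  obtain ⟨e, he, rfl⟩ := Multiset.mem_map.1 hc
  induction e with
  | h a b =>
    have h1 : a ≠ v := by rintro rfl; exact hne b he
    have h2 : b ≠ v := by rintro rfl; rw [Sym2.eq_swap] at he; exact hne a he
    simp [endCount, h1, h2]

/-- A trail in a multigraph with even degrees extends to a closed trail. -/
theorem exists_closed_walk {E : Multiset (Sym2 V)} (hE : ∀ v, edgeDegree E v % 2 = 0)
    (x y : V) (l : List V) (h : walkEdges x l y ≤ E) : ∃ l', walkEdges x l' x ≤ E := by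
  obtain ⟨k, hk⟩ : ∃ k, k = E.card - (walkEdges x l y).card := ⟨_, rfl⟩
  induction k generalizing y l with
  | zero =>
    have heq := Multiset.eq_of_le_of_card_le h (by omega)
    have h1 := edgeDegree_walkEdges x y l y
    have h2 := hE y
    rw [heq] at h1
    -- All edges are used up, and an open trail would give its end y odd degree.
    have : x = y := by
      by_contra hne
      rw [if_neg hne] at h1
      simp only [if_true] at h1
      omega
    subst this
    exact ⟨l, h⟩
  | succ k ih =>
    by_cases hxy : x = y
    · subst hxy
      exact ⟨l, h⟩
    obtain ⟨F, rfl⟩ := Multiset.le_iff_exists_add.1 h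
    have h1 := edgeDegree_walkEdges x y l y
    have h2 := hE y
    rw [edgeDegree_add] at h2
    rw [if_neg hxy] at h1
    simp only [if_true] at h1
    -- The trail uses an odd number of edge ends at y, so an unused edge leaves y and prolongs the
    -- trail.
    obtain ⟨z, hz⟩ := exists_mem_of_edgeDegree_pos (E := F) (v := y) (by omega)
    have hw : walkEdges x (l ++ [y]) z = walkEdges x l y + {s(y, z)} :=
      walkEdges_append_cons x z y l []
    refine ih z (l ++ [y]) ?_ ?_
    · rw [hw]
      exact add_le_add le_rfl (Multiset.singleton_le.2 hz)
    · rw [card_walkEdges] at hk ⊢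
      simp only [List.length_append, List.length_singleton]
      omega

/-- Euler's theorem: a connected multigraph with even degrees has an Eulerian circuit. -/
theorem exists_eulerian {E : Multiset (Sym2 V)} (hE : ∀ v, edgeDegree E v % 2 = 0) (hne : E ≠ 0)
    (hconn : ∀ S : Set V, S.Nonempty → (∀ a b, s(a, b) ∈ E → a ∈ S → b ∈ S) → ∀ v, v ∈ S) :
    ∃ W : List V, closedWalkEdges W = E ∧ ∀ v, v ∈ W := by
  have closed_mem : ∀ (W : List V) a b, s(a, b) ∈ closedWalkEdges W → b ∈ W := by
    intro W a b h
    cases W with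
    | nil => simp [closedWalkEdges] at h
    | cons x l =>
      rw [closedWalkEdges_cons] at h
      have := mem_of_mem_walkEdges h (Sym2.mem_mk_right a b)
      simp only [List.mem_cons]
      tauto
  have start : ∀ F : Multiset (Sym2 V), (∀ v, edgeDegree F v % 2 = 0) → ∀ w z, s(w, z) ∈ F →
      ∃ l, walkEdges w l w ≤ F := fun F hF w z h =>
    exists_closed_walk hF w z [] (by rw [walkEdges]; exact Multiset.singleton_le.2 h)
  -- As long as edges remain unused, the remaining multigraph F has even degrees. Connectedness
  -- gives an edge of F at a vertex w of W, a closed trail of F through w exists, and it is spliced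
  -- into W at w; the number of unused edges drops.
  have grow : ∀ k (W : List V), W ≠ [] → closedWalkEdges W ≤ E → k = E.card - W.length →
      ∃ W' : List V, W' ≠ [] ∧ closedWalkEdges W' = E := by
    intro k
    induction k using Nat.strong_induction_on with
    | _ k ih =>
      intro W hW hWE hk
      obtain ⟨F, hF⟩ := Multiset.le_iff_exists_add.1 hWE
      by_cases hF0 : F = 0
      · exact ⟨W, hW, by rw [hF, hF0, add_zero]⟩
      have hFdeg : ∀ v, edgeDegree F v % 2 = 0 := fun v => by
        have h1 := hE v
        rw [hF, edgeDegree_add] at h1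
        cases W with
        | nil => exact absurd rfl hW
        | cons x l =>
          have h2 := edgeDegree_walkEdges x x l v
          rw [closedWalkEdges_cons] at h1
          omega
      have htouch : ∃ w ∈ W, ∃ z, s(w, z) ∈ F := by
        by_contra hno
        push Not at hno
        have hall := hconn {v | v ∈ W} (List.exists_mem_of_ne_nil W hW) fun a b hab ha => by
          rw [hF, Multiset.mem_add] at hab
          rcases hab with h | h
          · exact closed_mem W a b h
          · exact absurd h (hno a ha b)
        obtain ⟨e, he⟩ := Multiset.exists_mem_of_ne_zero hF0
        induction e with
        | h a b => exact hno a (hall a) b he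
      obtain ⟨w, hw, z, hz⟩ := htouch
      obtain ⟨l', hl'⟩ := start F hFdeg w z hz
      obtain ⟨l₁, l₂, rfl⟩ := List.append_of_mem hw
      have hrot : closedWalkEdges (l₁ ++ w :: l₂) = walkEdges w (l₂ ++ l₁) w := by
        rw [← closedWalkEdges_rotate _ l₁.length, List.rotate_append_length_eq, List.cons_append,
          closedWalkEdges_cons]
      have hnew : closedWalkEdges (w :: (l' ++ w :: (l₂ ++ l₁))) ≤ E := by
        rw [closedWalkEdges_cons, walkEdges_append_cons, ← hrot, hF, add_comm]
        exact add_le_add le_rfl hl'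
      have hcard := Multiset.card_le_card hnew
      rw [closedWalkEdges_cons, card_walkEdges] at hcard
      refine ih (E.card - (w :: (l' ++ w :: (l₂ ++ l₁))).length) ?_ _ (by simp) hnew rfl
      simp only [List.length_append, List.length_cons] at hcard hk ⊢
      omega
  obtain ⟨e, he⟩ := Multiset.exists_mem_of_ne_zero hne
  obtain ⟨W, hW, hWE⟩ : ∃ W : List V, W ≠ [] ∧ closedWalkEdges W = E := by
    induction e with
    | h a b =>
      obtain ⟨l, hl⟩ := start E hE a b he
      exact grow _ (a :: l) (by simp) (by rwa [closedWalkEdges_cons]) rfl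
  refine ⟨W, hWE, fun v => hconn {v | v ∈ W} (List.exists_mem_of_ne_nil W hW)
    (fun a b hab _ => closed_mem W a b (by rwa [hWE])) v⟩

theorem edgeDegree_edgeFinset [Fintype V] (G : SimpleGraph V) [DecidableRel G.Adj] (v : V) :
    edgeDegree G.edgeFinset.val v = G.degree v := by
  have h : ∀ e ∈ G.edgeFinset, endCount v e = if v ∈ e then 1 else 0 := by
    intro e he
    induction e with
    | h a b =>
      have hab : G.Adj a b := by simpa using he
      have hne := hab.ne
      simp only [endCount, Sym2.lift_mk, Sym2.mem_iff]
      by_cases h1 : a = v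
      · subst h1
        simp [hne.symm]
      · by_cases h2 : b = v
        · subst h2
          simp [h1]
        · simp [h1, h2, Ne.symm h1, Ne.symm h2]
  rw [← G.card_incidenceFinset_eq_degree, G.incidenceFinset_eq_filter, Finset.card_filter]
  exact Finset.sum_congr rfl h

end Euler

/-! ### The algorithm has an output -/

section Output

variable [Fintype V] [PseudoMetricSpace V]

theorem exists_isChristofidesCycle (hV : 2 ≤ Fintype.card V) :
    ∃ C : List V, IsChristofidesCycle C := by
  classical
  have : Nontrivial V := Fintype.one_lt_card_iff_nontrivial.1 hV
  obtain ⟨T, hT⟩ := exists_isMinSpanningTree (V := V)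
  let U : Finset V := Finset.univ.filter fun v => Odd (T.degree v)
  have hU : Even U.card := T.even_card_odd_degree_vertices
  obtain ⟨J, hJ⟩ := exists_isMinMatchingOn U hU
  have hUset : (U : Set V) = {v | Odd (T.degree v)} := by
    ext u
    simp [U]
  obtain ⟨τ, hτ, hadj⟩ := exists_isPairing_of_isMatching hJ.1 hJ.2.1
  have hJdeg : ∀ v, J.spanningCoe.degree v = if v ∈ U then 1 else 0 := fun v => by
    rw [← SimpleGraph.card_neighborFinset_eq_degree]
    split_ifs with hv
    · rw [Finset.card_eq_one]
      refine ⟨τ v, ?_⟩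
      ext w
      rw [SimpleGraph.mem_neighborFinset, SimpleGraph.Subgraph.spanningCoe_adj, hadj,
        Finset.mem_singleton]
      exact ⟨fun h => h.2.symm, fun h => ⟨hv, h.symm⟩⟩
    · rw [Finset.card_eq_zero, Finset.eq_empty_iff_forall_notMem]
      intro w hw
      rw [SimpleGraph.mem_neighborFinset, SimpleGraph.Subgraph.spanningCoe_adj, hadj] at hw
      exact hv hw.1
  obtain ⟨W, hW, hmem⟩ := exists_eulerian
      -- J adds one to the degree exactly at the odd vertices of T, so T + J has even degrees. It is
      -- nonempty and connected because T is a spanning tree of at least two vertices.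
      (E := T.edgeFinset.val + J.spanningCoe.edgeFinset.val) (fun v => by
    rw [edgeDegree_add, edgeDegree_edgeFinset, edgeDegree_edgeFinset, hJdeg]
    by_cases hv : Odd (T.degree v)
    · have : v ∈ U := Finset.mem_filter.2 ⟨Finset.mem_univ _, hv⟩
      rw [if_pos this]
      rw [Nat.odd_iff] at hv
      omega
    · have : v ∉ U := fun h => hv (Finset.mem_filter.1 h).2
      rw [if_neg this]
      rw [Nat.odd_iff] at hv
      omega) (fun h0 => by
    obtain ⟨a, b, hab⟩ := exists_pair_ne V
    obtain ⟨w, hw⟩ := hT.1.connected.preconnected.exists_adj_of_nontrivial a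
    have : s(a, w) ∈ T.edgeFinset.val + J.spanningCoe.edgeFinset.val :=
      Multiset.mem_add.2 (Or.inl (by simpa using hw))
    rw [h0] at this
    simp at this) (fun S hS hclosed v => by
    obtain ⟨a, ha⟩ := hS
    obtain ⟨p⟩ := hT.1.connected.preconnected a v
    induction p with
    | nil => exact ha
    | cons h _ ih =>
      exact ih (hclosed _ _ (Multiset.mem_add.2 (Or.inl (by simpa using h))) ha))
  refine ⟨W.dedup, T, J, W, hT, by rwa [← hUset], hW, W.dedup_sublist, W.nodup_dedup, fun v => ?_⟩
  rw [List.mem_dedup]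
  exact hmem v

/-- One representative of each matching edge receives an even number. The two edges with the
smallest values come last, and the other representatives are listed in the order in which C visits
them. -/
theorem exists_isNumbering {N : ℕ} (hV : Fintype.card V = 2 * (N + 2))
    {M : (⊤ : SimpleGraph V).Subgraph} (hM : IsMinMatchingOn Set.univ M) {C : List V}
    (hC : IsChristofidesCycle C) : ∃ t, IsNumbering (2 * (N + 2)) M C t := by
  classical
  obtain ⟨-, -, -, -, -, -, -, hnodup, hmem⟩ := hC
  obtain ⟨σ, hσ, hadj⟩ := exists_isPairing_of_isMatching (U := Finset.univ)
    (by rw [Finset.coe_univ]; exact hM.1) hM.2.1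
  have hσσ : ∀ u, σ (σ u) = u := fun u => (hσ u (Finset.mem_univ _)).2.2
  obtain ⟨R, hR⟩ := exists_representatives hσ
  have hcard : R.card = N + 2 := by
    have h1 : R.card = Rᶜ.card := Finset.card_nbij' σ σ
      (fun u hu => Finset.mem_coe.2 (Finset.mem_compl.2 ((hR u).1 hu)))
      (fun u hu => by
        have h2 := Finset.mem_compl.1 (Finset.mem_coe.1 hu)
        have h3 := hR u
        simp only [Finset.mem_coe]
        tauto) (fun u _ => hσσ u) (fun u _ => hσσ u)
    have h2 := Finset.card_add_card_compl R
    omega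
  let f : V → ℝ := fun u => distSum (σ u) + distSum u
  obtain ⟨e₁, he₁, hmin₁⟩ := Finset.exists_min_image R f (by rw [← Finset.card_pos]; omega)
  have hcard₁ := Finset.card_erase_of_mem he₁
  obtain ⟨e₂, he₂, hmin₂⟩ := Finset.exists_min_image (R.erase e₁) f
    (by rw [← Finset.card_pos]; omega)
  have hcard₂ := Finset.card_erase_of_mem he₂
  let L : List V := C.filter fun u => u ∈ (R.erase e₁).erase e₂
  have hL : ∀ u, u ∈ L ↔ u ∈ (R.erase e₁).erase e₂ := fun u => by
    simp only [L, List.mem_filter, decide_eq_true_eq]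
    exact ⟨fun h => h.2, fun h => ⟨hmem u, h⟩⟩
  have hLlen : L.length = N := by
    have h1 : L.Nodup := hnodup.filter _
    have h2 : L.toFinset = (R.erase e₁).erase e₂ := by
      ext u
      rw [List.mem_toFinset, hL]
    rw [← List.toFinset_card_of_nodup h1, h2]
    omega
  let B : List V := L ++ [e₂, e₁]
  have hBlen : B.length = N + 2 := by simp [B, hLlen]
  have hBmem : ∀ u ∈ R, u ∈ B := fun u hu => by
    simp only [B, List.mem_append, hL, Finset.mem_erase, List.mem_cons]
    tauto
  -- The list is indexed from 0: its entry j − 1 becomes team 2j, and the mate of that entry becomes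
  -- team 2j − 1. The default `e₁` is never used for 1 ≤ i ≤ 2(N + 2).
  let t : ℕ → V := fun i => if i % 2 = 0 then B.getD (i / 2 - 1) e₁ else σ (B.getD (i / 2) e₁)
  have ht_even : ∀ j, 1 ≤ j → t (2 * j) = B.getD (j - 1) e₁ := fun j hj => by
    simp only [t]
    rw [if_pos (by omega), Nat.mul_div_cancel_left _ two_pos]
  have ht_odd : ∀ j, 1 ≤ j → t (2 * j - 1) = σ (B.getD (j - 1) e₁) := fun j hj => by
    simp only [t]
    rw [if_neg (by omega), show (2 * j - 1) / 2 = j - 1 by omega]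
  have hB₁ : B.getD (N + 1) e₁ = e₁ := by
    simp [B, List.getD_eq_getElem?_getD, hLlen]
  have hB₂ : B.getD N e₁ = e₂ := by
    simp [B, List.getD_eq_getElem?_getD, hLlen]
  have hBL : ∀ (i : ℕ) (hi : i < L.length), B.getD i e₁ = L[i] := fun i hi => by
    simp [B, List.getD_eq_getElem?_getD, List.getElem?_append, hi]
  have hpair : ∀ j, 1 ≤ j → distSum (t (2 * j - 1)) + distSum (t (2 * j)) =
      f (B.getD (j - 1) e₁) := fun j hj => by
    rw [ht_even j hj, ht_odd j hj]
  have hm : 2 * (N + 2) / 2 = N + 2 := by omega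
  have hsurj : Set.SurjOn t (Set.Icc 1 (2 * (N + 2))) Set.univ := by
    have hmain : ∀ u ∈ R, ∃ j, 1 ≤ j ∧ j ≤ N + 2 ∧ B.getD (j - 1) e₁ = u := fun u hu => by
      obtain ⟨i, hi, rfl⟩ := List.getElem_of_mem (hBmem u hu)
      refine ⟨i + 1, by omega, by omega, ?_⟩
      rw [Nat.add_sub_cancel, List.getD_eq_getElem _ _ hi]
    intro v _
    by_cases hv : v ∈ R
    · obtain ⟨j, h1, h2, rfl⟩ := hmain v hv
      exact ⟨2 * j, ⟨by omega, by omega⟩, ht_even j h1⟩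
    · obtain ⟨j, h1, h2, h3⟩ := hmain (σ v) (by
        have := hR v
        tauto)
      refine ⟨2 * j - 1, ⟨by omega, by omega⟩, ?_⟩
      rw [ht_odd j h1, h3, hσσ]
  refine ⟨t, ⟨⟨fun _ _ => Set.mem_univ _, ?_, hsurj⟩, ?_, ?_, ?_, ?_⟩⟩
  · have himg : (Finset.Icc 1 (2 * (N + 2))).image t = Finset.univ := by
      rw [Finset.eq_univ_iff_forall]
      intro v
      obtain ⟨i, hi, rfl⟩ := hsurj (Set.mem_univ v)
      exact Finset.mem_image_of_mem t (Finset.mem_Icc.2 hi)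
    have hinj : Set.InjOn t (Finset.Icc 1 (2 * (N + 2)) : Finset ℕ) :=
      Finset.injOn_of_card_image_eq (by
        rw [himg, Finset.card_univ, hV, Nat.card_Icc, Nat.add_sub_cancel])
    rwa [Finset.coe_Icc] at hinj
  · intro i hi
    rw [Finset.mem_Icc] at hi
    rw [ht_even i hi.1, ht_odd i hi.1, hadj]
    exact ⟨Finset.mem_univ _, hσσ _⟩
  · have h1 := hpair (N + 2) (by omega)
    have h2 := hpair (N + 1) (by omega)
    rw [show N + 2 - 1 = N + 1 by omega, hB₁] at h1
    rw [show N + 1 - 1 = N by omega, hB₂] at h2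
    rw [h1, show 2 * (N + 2) - 3 = 2 * (N + 1) - 1 by omega,
      show 2 * (N + 2) - 2 = 2 * (N + 1) by omega, h2]
    exact hmin₁ e₂ (Finset.mem_of_mem_erase he₂)
  · intro i hi
    rw [hm, Finset.mem_Icc] at hi
    have h2 := hpair (N + 1) (by omega)
    rw [show N + 1 - 1 = N by omega, hB₂] at h2
    rw [show 2 * (N + 2) - 3 = 2 * (N + 1) - 1 by omega,
      show 2 * (N + 2) - 2 = 2 * (N + 1) by omega, h2, hpair i hi.1, hBL (i - 1) (by omega)]
    exact hmin₂ _ (Finset.mem_of_mem_erase ((hL _).1 (List.getElem_mem _)))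
  · refine ⟨C, List.IsRotated.refl C, ?_⟩
    have h : (List.range (2 * (N + 2) / 2 - 2)).map (fun i => t (2 * (i + 1))) = L := by
      refine List.ext_getElem (by simp [hLlen, hm]) fun i h1 h2 => ?_
      simp only [List.getElem_map, List.getElem_range]
      rw [ht_even (i + 1) (by omega), Nat.add_sub_cancel, hBL i h2]
    rw [h]
    exact List.filter_sublist

theorem exists_isOutput {N : ℕ} (hV : Fintype.card V = 2 * (N + 2)) :
    ∃ S : Schedule V, IsOutput (2 * (N + 2)) S := by
  obtain ⟨M, hM⟩ := exists_isMinMatchingOn (Finset.univ : Finset V)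
    (by rw [Finset.card_univ, hV]; exact even_two_mul _)
  rw [Finset.coe_univ] at hM
  obtain ⟨C, hC⟩ := exists_isChristofidesCycle (V := V) (by omega)
  obtain ⟨t, ht⟩ := exists_isNumbering hV hM hC
  exact ⟨_, M, C, t, hM, hC, ht, rfl⟩

end Output

/-! ### The cost of the tournament -/

/-- The cyclic successor on `1, …, 2 * q + 3`. -/
def cycSucc (q x : ℕ) : ℕ := if x = 2 * q + 3 then 1 else x + 1

/-- The cyclic predecessor on `1, …, 2 * q + 3`. -/
def cycPred (q x : ℕ) : ℕ := if x = 1 then 2 * q + 3 else x - 1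

theorem sum_cycSucc (q : ℕ) (g : ℕ → ℝ) :
    ∑ x ∈ Finset.Icc 1 (2 * q + 3), g (cycSucc q x) = ∑ x ∈ Finset.Icc 1 (2 * q + 3), g x := by
  refine Finset.sum_nbij' (cycSucc q) (cycPred q) ?_ ?_ ?_ ?_ (fun _ _ => rfl) <;>
  · intro x hx
    simp only [Finset.mem_Icc, cycSucc, cycPred] at hx ⊢
    split_ifs <;> omega

theorem cycPred_cycSucc {q x : ℕ} (hx : x ∈ Finset.Icc 1 (2 * q + 3)) :
    cycPred q (cycSucc q x) = x := by
  simp only [Finset.mem_Icc, cycSucc, cycPred] at hx ⊢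
  split_ifs <;> omega

theorem sum_cycPred (q : ℕ) (f : ℕ → ℕ → ℝ) :
    ∑ x ∈ Finset.Icc 1 (2 * q + 3), f x (cycPred q x) =
      ∑ x ∈ Finset.Icc 1 (2 * q + 3), f (cycSucc q x) x := by
  rw [← sum_cycSucc q fun x => f x (cycPred q x)]
  exact Finset.sum_congr rfl fun x hx => by rw [cycPred_cycSucc hx]

/-- `c v a` bounds the part of the travel of team `v` due to its visit to team `a`, beyond the
distance `δ v a`: if `v` proceeds from `a` directly to `b`, the way back and forth is saved. -/
structure TourCost (q : ℕ) (δ c : ℕ → ℕ → ℝ) : Prop where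
  nonneg : ∀ a b, 0 ≤ δ a b
  self : ∀ a, δ a a = 0
  symm : ∀ a b, δ a b = δ b a
  triangle : ∀ a b d, δ a d ≤ δ a b + δ b d
  le : ∀ v a, c v a ≤ δ v a
  step : ∀ k v a b, 1 ≤ k → k + 1 ≤ 8 * q + 18 → (a, v) ∈ zhaoXiao (4 * q + 10) k →
    (b, v) ∈ zhaoXiao (4 * q + 10) (k + 1) → c v a + δ v b ≤ δ a b

namespace TourCost

variable {q : ℕ} {δ c : ℕ → ℕ → ℝ}

/-- The step inequality with δ weakened to c for the second visit: a trip to two teams costs at most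
the distance between them. Only team n − 1, whose chain of visits is telescoped, uses the stronger
form. -/
theorem pair_le (h : TourCost q δ c) {k l v a b : ℕ} (hk : 1 ≤ k) (hkl : l = k + 1)
    (hl : l ≤ 8 * q + 18) (ha : (a, v) ∈ zhaoXiao (4 * q + 10) k)
    (hb : (b, v) ∈ zhaoXiao (4 * q + 10) l) : c v a + c v b ≤ δ a b := by
  subst hkl
  have := h.step k v a b hk hl ha hb
  have := h.le v b
  linarith

/-- The sum of `c` over the ordered pairs of a team of super-team `i` and one of super-team `j`. -/
def block (c : ℕ → ℕ → ℝ) (i j : ℕ) : ℝ :=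
  c (2 * i - 1) (2 * j - 1) + c (2 * i - 1) (2 * j) + c (2 * i) (2 * j - 1) + c (2 * i) (2 * j)

theorem block_mono (h : TourCost q δ c) (i j : ℕ) : block c i j ≤ block δ i j := by
  have := h.le (2 * i - 1) (2 * j - 1)
  have := h.le (2 * i - 1) (2 * j)
  have := h.le (2 * i) (2 * j - 1)
  have := h.le (2 * i) (2 * j)
  simp only [block]
  linarith

theorem block_symm (h : TourCost q δ c) (i j : ℕ) : block δ i j = block δ j i := by
  simp only [block]
  rw [h.symm (2 * i - 1) (2 * j - 1), h.symm (2 * i - 1) (2 * j), h.symm (2 * i) (2 * j - 1),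
    h.symm (2 * i) (2 * j)]
  ring

theorem block_self (h : TourCost q δ c) (i : ℕ) : block δ i i = 2 * δ (2 * i - 1) (2 * i) := by
  simp only [block]
  rw [h.self, h.self, h.symm (2 * i) (2 * i - 1)]
  ring

/-! ### Trips in normal and left super-games -/

theorem block_normal_tail (h : TourCost q δ c) {k x y : ℕ} (hk : k + 4 ≤ 8 * q + 18)
    (hg : ∀ r, 1 ≤ r → r ≤ 4 → normalGames x y r ⊆ zhaoXiao (4 * q + 10) (k + r)) :
    block c x y ≤ 2 * δ (2 * y - 1) (2 * y) := by
  have h1 := hg 1 (by omega) (by omega)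
  have h2 := hg 2 (by omega) (by omega)
  simp only [normalGames, par, cross, Finset.insert_subset_iff, Finset.singleton_subset_iff]
    at h1 h2
  have a := h.pair_le (by omega) rfl (by omega) h1.1 h2.2
  have b := h.pair_le (by omega) rfl (by omega) h1.2 h2.1
  have := h.symm (2 * y) (2 * y - 1)
  simp only [block]
  linarith

theorem block_normal_head (h : TourCost q δ c) {k x y : ℕ} (hk : k + 4 ≤ 8 * q + 18)
    (hg : ∀ r, 1 ≤ r → r ≤ 4 → normalGames x y r ⊆ zhaoXiao (4 * q + 10) (k + r)) :
    block c y x ≤ 2 * δ (2 * x - 1) (2 * x) := by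
  have h1 := hg 3 (by omega) (by omega)
  have h2 := hg 4 (by omega) (by omega)
  simp only [normalGames, par, cross, Finset.insert_subset_iff, Finset.singleton_subset_iff]
    at h1 h2
  have a := h.pair_le (by omega) rfl (by omega) h1.1 h2.2
  have b := h.pair_le (by omega) rfl (by omega) h1.2 h2.1
  have := h.symm (2 * x) (2 * x - 1)
  simp only [block]
  linarith

/-- Only the head has its two away games on consecutive days. The tail plays away on the first and
the last day, and its visits are estimated by plain distances. -/
theorem block_left_head (h : TourCost q δ c) {k x y : ℕ} (hk : k + 4 ≤ 8 * q + 18)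
    (hg : ∀ r, 1 ≤ r → r ≤ 4 → leftGames x y r ⊆ zhaoXiao (4 * q + 10) (k + r)) :
    block c y x ≤ 2 * δ (2 * x - 1) (2 * x) := by
  have h1 := hg 2 (by omega) (by omega)
  have h2 := hg 3 (by omega) (by omega)
  simp only [leftGames, par, cross, Finset.insert_subset_iff, Finset.singleton_subset_iff]
    at h1 h2
  have a := h.pair_le (by omega) rfl (by omega) h1.2 h2.1
  have b := h.pair_le (by omega) rfl (by omega) h1.1 h2.2
  have := h.symm (2 * x) (2 * x - 1)
  simp only [block]
  linarith

theorem block_normal (h : TourCost q δ c) {i j : ℕ} (hi : 1 ≤ i) (hij : i + 2 ≤ j)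
    (hj : j ≤ 2 * q + 3) (hji : j ≤ i + (2 * q + 1)) :
    block c i j ≤ 2 * δ (2 * j - 1) (2 * j) ∧ block c j i ≤ 2 * δ (2 * i - 1) (2 * i) := by
  rcases exists_normalSuperGame hi hij hj hji with ⟨s, hs, hs', hg⟩ | ⟨s, hs, hs', hg⟩
  · exact ⟨h.block_normal_tail (by omega) hg, h.block_normal_head (by omega) hg⟩
  · exact ⟨h.block_normal_head (by omega) hg, h.block_normal_tail (by omega) hg⟩

theorem block_left_even (h : TourCost q δ c) {i : ℕ} (hi : 1 ≤ i) (hi' : i ≤ 2 * q + 2)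
    (hpar : i % 2 = 0) : block c (2 * q + 4) i ≤ 2 * δ (2 * i - 1) (2 * i) :=
  h.block_left_head (k := 4 * (2 * q + 3 - i)) (by omega) fun _ hr hr' =>
    leftmost_even_subset hi hi' hpar hr hr'

theorem block_left_odd (h : TourCost q δ c) {i : ℕ} (hi : 1 ≤ i) (hi' : i ≤ 2 * q + 3)
    (hpar : i % 2 = 1) : block c i (2 * q + 4) ≤ 2 * δ (4 * q + 7) (4 * q + 8) := by
  have e : 2 * (2 * q + 4) = 4 * q + 8 := by omega
  have e' : 4 * q + 8 - 1 = 4 * q + 7 := by omega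
  by_cases h1 : i = 1
  · subst h1
    obtain ⟨-, g2, g3, g4⟩ := specialLeft_mem q
    have a := h.pair_le (by omega) rfl (by omega) g2.2 g3.1
    have b := h.pair_le (by omega) rfl (by omega) g3.2 g4.1
    have := h.symm (4 * q + 8) (4 * q + 7)
    simp only [block, e, e']
    norm_num
    linarith
  by_cases hN : i = 2 * q + 3
  · subst hN
    have := h.block_normal_tail (k := 0) (x := 2 * q + 3) (y := 2 * q + 4) (by omega)
      fun r hr hr' => by simpa using leftmost_normal_subset (q := q) hr hr'
    rwa [e, e'] at this
  · have := h.block_left_head (k := 4 * (2 * q + 3 - i)) (by omega) fun _ hr hr' =>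
      leftmost_odd_subset (q := q) (i := i) (by omega) (by omega) hpar hr hr'
    rwa [e, e'] at this

theorem pair_le_rev (h : TourCost q δ c) {k l v a b : ℕ} (hk : 1 ≤ k) (hkl : l = k + 1)
    (hl : l ≤ 8 * q + 18) (ha : (a, v) ∈ zhaoXiao (4 * q + 10) l)
    (hb : (b, v) ∈ zhaoXiao (4 * q + 10) k) : c v a + c v b ≤ δ a b := by
  rw [add_comm, h.symm]
  exact h.pair_le hk hkl hl hb ha

/-! ### Trips among neighbouring super-teams and super-team m -/

/-- The two-game trips of the types 3 and 4. They are the same before and after the wrap up to the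
order of the two visits, which does not matter. The third and fourth trips combine a neighbour with
a team of super-team m; these are the ones charged to D(n) and D(n − 1). -/
theorem even_pairs (h : TourCost q δ c) {x : ℕ} (hx : 1 ≤ x) (hx' : x ≤ 2 * q + 2)
    (hpar : x % 2 = 0) :
    c (2 * x) (4 * q + 10) + c (2 * x) (4 * q + 9) ≤ δ (4 * q + 10) (4 * q + 9) ∧
    c (2 * x - 1) (2 * (x + 1)) + c (2 * x - 1) (2 * (x + 1) - 1) ≤
      δ (2 * (x + 1)) (2 * (x + 1) - 1) ∧
    c (2 * (x + 1)) (2 * x - 1) + c (2 * (x + 1)) (4 * q + 10) ≤ δ (2 * x - 1) (4 * q + 10) ∧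
    c (2 * (x + 1) - 1) (2 * x - 1) + c (2 * (x + 1) - 1) (4 * q + 9) ≤
      δ (2 * x - 1) (4 * q + 9) ∧
    c (4 * q + 10) (2 * x) + c (4 * q + 10) (2 * (x + 1)) ≤ δ (2 * x) (2 * (x + 1)) := by
  by_cases hl : x ≤ q + 1
  · obtain ⟨hA, hB⟩ := fourDays_mem fun r => right_low_even_subset (r := r) hx hl hpar
    have a1 := hA (4 * q + 10) (2 * x) (by simp [rightType])
    have a2 := hA (2 * (x + 1)) (2 * x - 1) (by simp [rightType])
    have a3 := hA (2 * (x + 1) - 1) (4 * q + 9) (by simp [rightType])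
    have b1 := hB (4 * q + 9) (2 * x) (by simp [rightType])
    have b2 := hB (2 * (x + 1) - 1) (2 * x - 1) (by simp [rightType])
    have b3 := hB (2 * (x + 1)) (4 * q + 10) (by simp [rightType])
    exact ⟨h.pair_le (by omega) rfl (by omega) a1.1 b1.1,
      h.pair_le (by omega) rfl (by omega) a2.1 b2.1,
      h.pair_le (by omega) rfl (by omega) a2.2 b3.2,
      h.pair_le_rev (by omega) rfl (by omega) b2.2 a3.2,
      h.pair_le_rev (by omega) rfl (by omega) a1.2 b3.1⟩
  · obtain ⟨hA, hB⟩ := fourDays_rev_mem fun r =>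
      right_high_even_subset (r := r) (by omega : q + 2 ≤ x) hx' hpar
    have a1 := hA (4 * q + 9) (2 * x) (by simp [rightType])
    have a2 := hA (2 * (x + 1) - 1) (2 * x - 1) (by simp [rightType])
    have a3 := hA (2 * (x + 1)) (4 * q + 10) (by simp [rightType])
    have b1 := hB (4 * q + 10) (2 * x) (by simp [rightType])
    have b2 := hB (2 * (x + 1)) (2 * x - 1) (by simp [rightType])
    have b3 := hB (2 * (x + 1) - 1) (4 * q + 9) (by simp [rightType])
    exact ⟨h.pair_le_rev (by omega) rfl (by omega) b1.2 a1.2,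
      h.pair_le_rev (by omega) rfl (by omega) b2.2 a2.2,
      h.pair_le_rev (by omega) rfl (by omega) b2.1 a3.1,
      h.pair_le (by omega) rfl (by omega) a2.1 b3.1,
      h.pair_le (by omega) rfl (by omega) b1.1 a3.2⟩

theorem odd_pairs (h : TourCost q δ c) {x : ℕ} (hx : 1 ≤ x) (hx' : x ≤ 2 * q + 2)
    (hpar : x % 2 = 1) :
    c (2 * (x + 1)) (2 * x - 1) + c (2 * (x + 1)) (2 * x) ≤ δ (2 * x - 1) (2 * x) ∧
    c (2 * (x + 1) - 1) (4 * q + 10) + c (2 * (x + 1) - 1) (4 * q + 9) ≤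
      δ (4 * q + 10) (4 * q + 9) ∧
    c (2 * x - 1) (2 * (x + 1)) + c (2 * x - 1) (4 * q + 10) ≤ δ (2 * (x + 1)) (4 * q + 10) ∧
    c (2 * x) (2 * (x + 1)) + c (2 * x) (4 * q + 9) ≤ δ (2 * (x + 1)) (4 * q + 9) ∧
    c (4 * q + 10) (2 * x - 1) + c (4 * q + 10) (2 * (x + 1) - 1) ≤
      δ (2 * x - 1) (2 * (x + 1) - 1) := by
  by_cases hl : x ≤ q + 1
  · obtain ⟨hA, hB⟩ := fourDays_rev_mem fun r => right_low_odd_subset (r := r) hx hl hpar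
    have a1 := hA (2 * (x + 1)) (2 * x - 1) (by simp [rightType])
    have a2 := hA (4 * q + 9) (2 * x) (by simp [rightType])
    have a3 := hA (2 * (x + 1) - 1) (4 * q + 10) (by simp [rightType])
    have b1 := hB (4 * q + 10) (2 * x - 1) (by simp [rightType])
    have b2 := hB (2 * (x + 1)) (2 * x) (by simp [rightType])
    have b3 := hB (2 * (x + 1) - 1) (4 * q + 9) (by simp [rightType])
    exact ⟨h.pair_le (by omega) rfl (by omega) a1.1 b2.1,
      h.pair_le (by omega) rfl (by omega) a3.1 b3.1,
      h.pair_le (by omega) rfl (by omega) a1.2 b1.2,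
      h.pair_le_rev (by omega) rfl (by omega) b2.2 a2.2,
      h.pair_le (by omega) rfl (by omega) b1.1 a3.2⟩
  · obtain ⟨hA, hB⟩ := fourDays_mem fun r =>
      right_high_odd_subset (r := r) (by omega : q + 2 ≤ x) hx' hpar
    have a1 := hA (4 * q + 10) (2 * x - 1) (by simp [rightType])
    have a2 := hA (2 * (x + 1)) (2 * x) (by simp [rightType])
    have a3 := hA (2 * (x + 1) - 1) (4 * q + 9) (by simp [rightType])
    have b1 := hB (2 * (x + 1)) (2 * x - 1) (by simp [rightType])
    have b2 := hB (4 * q + 9) (2 * x) (by simp [rightType])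
    have b3 := hB (2 * (x + 1) - 1) (4 * q + 10) (by simp [rightType])
    exact ⟨h.pair_le_rev (by omega) rfl (by omega) b1.2 a2.2,
      h.pair_le_rev (by omega) rfl (by omega) b3.2 a3.2,
      h.pair_le_rev (by omega) rfl (by omega) b1.1 a1.1,
      h.pair_le (by omega) rfl (by omega) a2.1 b2.1,
      h.pair_le_rev (by omega) rfl (by omega) a1.2 b3.1⟩

/-- Here four trips involve super-team m, and they touch teams 1, 2, n − 5 and n − 4. The
super-teams 1 and m − 2 are thus the only odd ones that receive charges. -/
theorem wrap_pairs (h : TourCost q δ c) :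
    c (4 * q + 5) (4 * q + 10) + c (4 * q + 5) 1 ≤ δ (4 * q + 10) 1 ∧
    c (4 * q + 6) 2 + c (4 * q + 6) (4 * q + 9) ≤ δ 2 (4 * q + 9) ∧
    c 2 (4 * q + 6) + c 2 (4 * q + 10) ≤ δ (4 * q + 6) (4 * q + 10) ∧
    c 1 (4 * q + 5) + c 1 (4 * q + 9) ≤ δ (4 * q + 5) (4 * q + 9) ∧
    c (4 * q + 10) (4 * q + 5) + c (4 * q + 10) 2 ≤ δ (4 * q + 5) 2 := by
  obtain ⟨hA, hB⟩ := fourDays_mem fun r => right_wrap_subset (q := q) (r := r)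
  have a1 := hA (4 * q + 10) (4 * q + 5) (by simp [rightType]; omega)
  have a2 := hA 2 (4 * q + 6) (by simp [rightType]; omega)
  have a3 := hA 1 (4 * q + 9) (by simp [rightType])
  have b1 := hB (4 * q + 9) (4 * q + 6) (by simp [rightType]; omega)
  have b2 := hB 1 (4 * q + 5) (by simp [rightType]; omega)
  have b3 := hB 2 (4 * q + 10) (by simp [rightType])
  exact ⟨h.pair_le (by omega) rfl (by omega) a1.1 b2.1,
    h.pair_le (by omega) rfl (by omega) a2.1 b1.1,
    h.pair_le (by omega) rfl (by omega) a2.2 b3.2,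
    h.pair_le_rev (by omega) rfl (by omega) b2.2 a3.2,
    h.pair_le_rev (by omega) rfl (by omega) a1.2 b3.1⟩

theorem even_last_pair (h : TourCost q δ c) {x : ℕ} (hx : 1 ≤ x) (hx' : x ≤ 2 * q + 2)
    (hpar : x % 2 = 0) :
    c (2 * x) (2 * (x + 1) - 1) + c (2 * x) (2 * (x + 1)) ≤
      δ (2 * (x + 1) - 1) (2 * (x + 1)) := by
  by_cases hl : x = 2 * q + 2
  · subst hl
    obtain ⟨-, ⟨-, g3, -⟩, ⟨-, g4, -⟩, -⟩ := lastOuter_mem q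
    have e1 : 2 * (2 * q + 2) = 4 * q + 4 := by omega
    have e2 : 2 * (2 * q + 2 + 1) - 1 = 4 * q + 5 := by omega
    have e3 : 2 * (2 * q + 2 + 1) = 4 * q + 6 := by omega
    rw [e1, e2, e3]
    exact h.pair_le (by omega) rfl (by omega) g3 g4
  · obtain ⟨i, rfl⟩ : ∃ i, x = 2 * i := ⟨x / 2, by omega⟩
    obtain ⟨-, ⟨g3, -⟩, ⟨-, g4⟩, -⟩ := lastInner_mem (q := q) (h := i) (by omega) (by omega)
    have e1 : 2 * (2 * i) = 4 * i := by omega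
    have e2 : 2 * (2 * i + 1) - 1 = 4 * i + 1 := by omega
    have e3 : 2 * (2 * i + 1) = 4 * i + 2 := by omega
    rw [e1, e2, e3]
    exact h.pair_le (by omega) rfl (by omega) g3 g4

theorem odd_last_pairs (h : TourCost q δ c) {x : ℕ} (hx : 1 ≤ x) (hx' : x ≤ 2 * q + 2)
    (hpar : x % 2 = 1) :
    c (2 * x - 1) (2 * (x + 1) - 1) + c (2 * x - 1) (2 * x) ≤ δ (2 * (x + 1) - 1) (2 * x) ∧
    c (2 * (x + 1) - 1) (2 * x - 1) + c (2 * (x + 1) - 1) (2 * x) ≤ δ (2 * x - 1) (2 * x) := by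
  obtain ⟨g2, -⟩ := lastMates_mem (q := q) (i := x) hx (by omega)
  by_cases hl : x = 1
  · subst hl
    obtain ⟨⟨g1, -, -⟩, -, ⟨g4, -, -⟩, ⟨g5, -, -⟩⟩ := lastOuter_mem q
    exact ⟨h.pair_le (by omega) rfl (by omega) g1 g2, h.pair_le (by omega) rfl (by omega) g4 g5⟩
  · obtain ⟨i, rfl⟩ : ∃ i, x = 2 * i + 1 := ⟨x / 2, by omega⟩
    obtain ⟨⟨g1, -⟩, -, ⟨g4, -⟩, ⟨-, g5⟩⟩ := lastInner_mem (q := q) (h := i) (by omega) (by omega)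
    have e1 : 2 * (2 * i + 1) - 1 = 4 * i + 1 := by omega
    have e2 : 2 * (2 * i + 1) = 4 * i + 2 := by omega
    have e3 : 2 * (2 * i + 1 + 1) - 1 = 4 * i + 3 := by omega
    rw [e1, e2] at g2
    rw [e1, e2, e3]
    exact ⟨h.pair_le (by omega) rfl (by omega) g1 g2, h.pair_le (by omega) rfl (by omega) g4 g5⟩

/-- The trip of team 2 goes from 3 to n − 5. It joins visits to both neighbours of super-team 1,
which is why the estimates at x = 1 and at the wrap have to be combined. -/
theorem wrap_last_pairs (h : TourCost q δ c) :
    c 2 3 + c 2 (4 * q + 5) ≤ δ 3 (4 * q + 5) ∧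
    c (4 * q + 5) 2 + c (4 * q + 5) (4 * q + 6) ≤ δ 2 (4 * q + 6) := by
  obtain ⟨g2, -⟩ := lastMates_mem (q := q) (i := 2 * q + 3) (by omega) (by omega)
  obtain ⟨⟨-, -, g1⟩, ⟨g3, -, -⟩, ⟨-, -, g4⟩, -⟩ := lastOuter_mem q
  have e1 : 2 * (2 * q + 3) - 1 = 4 * q + 5 := by omega
  have e2 : 2 * (2 * q + 3) = 4 * q + 6 := by omega
  rw [e1, e2] at g2
  exact ⟨h.pair_le (by omega) rfl (by omega) g3 g4, h.pair_le (by omega) rfl (by omega) g1 g2⟩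

/-! ### The away games of team n − 1 -/

/-- The first of the two teams among `2 * x` and `2 * cycSucc q x - 1` that team `n - 1` visits in
the slot in which it plays super-teams `x` and `cycSucc q x`. -/
def firstVisit (q x : ℕ) : ℕ :=
  if (x % 2 = 0 ↔ x ≤ q + 1) then 2 * cycSucc q x - 1 else 2 * x

/-- The second of the two teams among `2 * x` and `2 * cycSucc q x - 1` that team `n - 1` visits in
the slot in which it plays super-teams `x` and `cycSucc q x`. -/
def secondVisit (q x : ℕ) : ℕ :=
  if (x % 2 = 0 ↔ x ≤ q + 1) then 2 * x else 2 * cycSucc q x - 1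

theorem visits_low {x : ℕ} (hx : 1 ≤ x) (hx' : x ≤ q + 1) :
    (firstVisit q x, 4 * q + 9) ∈ zhaoXiao (4 * q + 10) (4 * (q + 1 - x) + 1) ∧
    (secondVisit q x, 4 * q + 9) ∈ zhaoXiao (4 * q + 10) (4 * (q + 1 - x) + 4) := by
  have hs : cycSucc q x = x + 1 := if_neg (by omega)
  rcases Nat.mod_two_eq_zero_or_one x with hp | hp
  · obtain ⟨hA, hB⟩ := fourDays_mem fun r => right_low_even_subset (r := r) hx hx' hp
    have a3 := hA (2 * (x + 1) - 1) (4 * q + 9) (by simp [rightType])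
    have b1 := hB (4 * q + 9) (2 * x) (by simp [rightType])
    have hi : (x % 2 = 0 ↔ x ≤ q + 1) := iff_of_true hp hx'
    rw [firstVisit, secondVisit, if_pos hi, if_pos hi, hs]
    exact ⟨a3.1, b1.2⟩
  · obtain ⟨hA, hB⟩ := fourDays_rev_mem fun r => right_low_odd_subset (r := r) hx hx' hp
    have a2 := hA (4 * q + 9) (2 * x) (by simp [rightType])
    have b3 := hB (2 * (x + 1) - 1) (4 * q + 9) (by simp [rightType])
    have hi : ¬ (x % 2 = 0 ↔ x ≤ q + 1) := fun hi => by omega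
    rw [firstVisit, secondVisit, if_neg hi, if_neg hi, hs]
    exact ⟨a2.1, b3.2⟩

theorem visits_high {x : ℕ} (hx : q + 2 ≤ x) (hx' : x ≤ 2 * q + 3) :
    (firstVisit q x, 4 * q + 9) ∈ zhaoXiao (4 * q + 10) (4 * (3 * q + 4 - x) + 1) ∧
    (secondVisit q x, 4 * q + 9) ∈ zhaoXiao (4 * q + 10) (4 * (3 * q + 4 - x) + 4) := by
  by_cases hN : x = 2 * q + 3
  · subst hN
    obtain ⟨hA, hB⟩ := fourDays_mem fun r => right_wrap_subset (q := q) (r := r)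
    have a3 := hA 1 (4 * q + 9) (by simp [rightType])
    have b1 := hB (4 * q + 9) (2 * (2 * q + 3)) (by simp [rightType])
    have hi : ((2 * q + 3) % 2 = 0 ↔ 2 * q + 3 ≤ q + 1) := iff_of_false (by omega) (by omega)
    have e : 4 * (3 * q + 4 - (2 * q + 3)) = 4 * q + 4 := by omega
    rw [firstVisit, secondVisit, if_pos hi, if_pos hi, e, cycSucc, if_pos rfl]
    exact ⟨a3.1, b1.2⟩
  have hs : cycSucc q x = x + 1 := if_neg hN
  rcases Nat.mod_two_eq_zero_or_one x with hp | hp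
  · obtain ⟨hA, hB⟩ := fourDays_rev_mem fun r =>
      right_high_even_subset (r := r) hx (by omega) hp
    have a1 := hA (4 * q + 9) (2 * x) (by simp [rightType])
    have b3 := hB (2 * (x + 1) - 1) (4 * q + 9) (by simp [rightType])
    have hi : ¬ (x % 2 = 0 ↔ x ≤ q + 1) := fun hi => by omega
    rw [firstVisit, secondVisit, if_neg hi, if_neg hi, hs]
    exact ⟨a1.1, b3.2⟩
  · obtain ⟨hA, hB⟩ := fourDays_mem fun r =>
      right_high_odd_subset (r := r) hx (by omega) hp
    have a3 := hA (2 * (x + 1) - 1) (4 * q + 9) (by simp [rightType])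
    have b2 := hB (4 * q + 9) (2 * x) (by simp [rightType])
    have hi : (x % 2 = 0 ↔ x ≤ q + 1) := iff_of_false (by omega) (by omega)
    rw [firstVisit, secondVisit, if_pos hi, if_pos hi, hs]
    exact ⟨a3.1, b2.2⟩

/-- From one slot to the next one, team `n - 1` travels from the second visited team of `x` to
the first visited team of `cycPred q x`. -/
theorem visits_step (h : TourCost q δ c) {x : ℕ} (hx : 1 ≤ x) (hx' : x ≤ 2 * q + 3)
    (hxq : x ≠ q + 2) :
    c (4 * q + 9) (secondVisit q x) + δ (4 * q + 9) (firstVisit q (cycPred q x)) ≤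
      δ (secondVisit q x) (firstVisit q (cycPred q x)) := by
  by_cases hl : x ≤ q + 1
  · by_cases h1 : x = 1
    · have e : cycPred q x = 2 * q + 3 := if_pos h1
      have hb := (visits_high (q := q) (x := 2 * q + 3) (by omega) le_rfl).1
      rw [e]
      -- Team n − 1 is away on the first and the last day of each slot, so its trips straddle slot
      -- boundaries: the first visit for the predecessor of x comes on the day after the second
      -- visit for x.
      have e' : 4 * (3 * q + 4 - (2 * q + 3)) + 1 = 4 * (q + 1 - x) + 4 + 1 := by omega
      rw [e'] at hb
      exact h.step _ _ _ _ (by omega) (by omega) (visits_low hx hl).2 hb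
    · have e : cycPred q x = x - 1 := if_neg h1
      have hb := (visits_low (q := q) (x := x - 1) (by omega) (by omega)).1
      rw [e]
      have e' : 4 * (q + 1 - (x - 1)) + 1 = 4 * (q + 1 - x) + 4 + 1 := by omega
      rw [e'] at hb
      exact h.step _ _ _ _ (by omega) (by omega) (visits_low hx hl).2 hb
  · have e : cycPred q x = x - 1 := if_neg (by omega)
    have hb := (visits_high (q := q) (x := x - 1) (by omega) (by omega)).1
    rw [e]
    have e' : 4 * (3 * q + 4 - (x - 1)) + 1 = 4 * (3 * q + 4 - x) + 4 + 1 := by omega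
    rw [e'] at hb
    exact h.step _ _ _ _ (by omega) (by omega) (visits_high (by omega) hx').2 hb

theorem visits_last (h : TourCost q δ c) :
    c (4 * q + 9) (secondVisit q (q + 2)) + δ (4 * q + 9) (4 * q + 10) ≤
      δ (secondVisit q (q + 2)) (4 * q + 10) := by
  have ha := (visits_high (q := q) (x := q + 2) (by omega) (by omega)).2
  have hb := (lastFour_mem q).1.2
  have e : 8 * q + 13 = 4 * (3 * q + 4 - (q + 2)) + 4 + 1 := by omega
  rw [e] at hb
  exact h.step _ _ _ _ (by omega) (by omega) ha hb

/-- The distance between the mates of super-teams `x` and `x + 1`. -/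
def transition (q : ℕ) (δ : ℕ → ℕ → ℝ) (x : ℕ) : ℝ :=
  if x = 2 * q + 3 then 0 else δ (2 * x - 1) (2 * (x + 1) - 1) + δ (2 * x) (2 * (x + 1))

/-- Away from x = q + 2, the condition that selects the visiting order alternates between x and its
predecessor. Hence either both visited teams are even-numbered, in super-teams x and x − 1, or both
are odd-numbered, in x + 1 and x. The other term of the bound is slack. -/
theorem second_last_team_step (h : TourCost q δ c) {x : ℕ} (hx : 1 ≤ x) (hx' : x ≤ 2 * q + 3)
    (hxq : x ≠ q + 2) :
    δ (secondVisit q x) (firstVisit q (cycPred q x)) ≤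
      (if x = 2 * q + 3 then 0 else δ (2 * x - 1) (2 * (x + 1) - 1)) +
        (if cycPred q x = 2 * q + 3 then 0 else
          δ (2 * cycPred q x) (2 * (cycPred q x + 1))) := by
  have hF : 0 ≤ (if x = 2 * q + 3 then 0 else δ (2 * x - 1) (2 * (x + 1) - 1)) := by
    split_ifs
    exacts [le_rfl, h.nonneg _ _]
  have hG : 0 ≤ (if cycPred q x = 2 * q + 3 then 0 else
      δ (2 * cycPred q x) (2 * (cycPred q x + 1))) := by
    split_ifs
    exacts [le_rfl, h.nonneg _ _]
  by_cases hi : (x % 2 = 0 ↔ x ≤ q + 1)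
  · refine le_add_of_nonneg_of_le hF ?_
    have hp : cycPred q x = x - 1 := if_neg (by rintro rfl; simp at hi)
    have hj : ¬ ((x - 1) % 2 = 0 ↔ x - 1 ≤ q + 1) := by omega
    rw [secondVisit, if_pos hi, hp, firstVisit, if_neg hj, if_neg (by omega), h.symm,
      show x - 1 + 1 = x by omega]
  · refine le_add_of_le_of_nonneg ?_ hG
    have hs : cycSucc q x = x + 1 := if_neg (by omega)
    have hf : firstVisit q (cycPred q x) = 2 * x - 1 := by
      by_cases h1 : x = 1
      · rw [cycPred, if_pos h1, firstVisit, if_pos (by omega), cycSucc, if_pos rfl, h1]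
      · rw [cycPred, if_neg h1, firstVisit, if_pos (by omega), cycSucc, if_neg (by omega)]
        omega
    rw [secondVisit, if_neg hi, hf, hs, if_neg (by omega), h.symm]

/-- The cost of team `n - 1`. -/
theorem second_last_team (h : TourCost q δ c) :
    ∑ x ∈ Finset.Icc 1 (2 * q + 3), (c (4 * q + 9) (2 * x - 1) + c (4 * q + 9) (2 * x)) ≤
      ∑ x ∈ Finset.Icc 1 (2 * q + 3), transition q δ x +
        (δ (4 * q + 9) (firstVisit q (q + 1)) + δ (secondVisit q (q + 2)) (4 * q + 10)) := by
  set F : ℕ → ℝ := fun x => if x = 2 * q + 3 then 0 else δ (2 * x - 1) (2 * (x + 1) - 1)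
  set G : ℕ → ℝ := fun x => if x = 2 * q + 3 then 0 else δ (2 * x) (2 * (x + 1))
  set β : ℕ → ℝ := fun x => δ (4 * q + 9) (firstVisit q x)
  -- The chain of visits starts with x = q + 1 in slot 1 and ends with x = q + 2 in slot 2q + 3,
  -- before the game at team n on the first day of the last slot. E pays for these two ends.
  set E : ℝ := δ (4 * q + 9) (firstVisit q (q + 1)) + δ (secondVisit q (q + 2)) (4 * q + 10)
  -- The first visit costs at most β x, and the step after the second visit gives back β at the
  -- predecessor. Summed over the cycle, the β terms cancel.
  have hpt : ∀ x ∈ Finset.Icc 1 (2 * q + 3),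
      c (4 * q + 9) (2 * cycSucc q x - 1) + c (4 * q + 9) (2 * x) ≤
        F x + G (cycPred q x) + (β x - β (cycPred q x)) + if x = q + 2 then E else 0 := by
    intro x hx
    obtain ⟨hx1, hx2⟩ := Finset.mem_Icc.1 hx
    have hv : c (4 * q + 9) (2 * cycSucc q x - 1) + c (4 * q + 9) (2 * x) =
        c (4 * q + 9) (firstVisit q x) + c (4 * q + 9) (secondVisit q x) := by
      unfold firstVisit secondVisit
      split_ifs
      · rfl
      · exact add_comm _ _
    have hb := h.le (4 * q + 9) (firstVisit q x)
    rw [hv]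
    by_cases hxq : x = q + 2
    · have hl := h.visits_last
      have hF : 0 ≤ F x := by
        simp only [F]
        split_ifs
        exacts [le_rfl, h.nonneg _ _]
      have hG : 0 ≤ G (cycPred q x) := by
        simp only [G]
        split_ifs
        exacts [le_rfl, h.nonneg _ _]
      have hp : cycPred q x = q + 1 := by rw [cycPred, if_neg (by omega)]; omega
      have := h.nonneg (4 * q + 9) (4 * q + 10)
      rw [if_pos hxq, hp]
      rw [hp] at hG
      rw [← hxq] at hl
      simp only [E, β]
      rw [← hxq]
      linarith
    · have h1 := h.visits_step hx1 hx2 hxq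
      have h2 := h.second_last_team_step hx1 hx2 hxq
      rw [if_neg hxq]
      simp only [F, G, β]
      linarith
  have hsum := Finset.sum_le_sum hpt
  have hG := sum_cycPred q fun _ y => G y
  have hβ := sum_cycPred q fun _ y => β y
  have hc := sum_cycSucc q fun x => c (4 * q + 9) (2 * x - 1)
  have htr : ∑ x ∈ Finset.Icc 1 (2 * q + 3), transition q δ x =
      ∑ x ∈ Finset.Icc 1 (2 * q + 3), F x + ∑ x ∈ Finset.Icc 1 (2 * q + 3), G x := by
    rw [← Finset.sum_add_distrib]
    refine Finset.sum_congr rfl fun x _ => ?_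
    simp only [F, G, transition]
    split_ifs
    exacts [(add_zero _).symm, rfl]
  simp only [Finset.sum_add_distrib, Finset.sum_sub_distrib, Finset.sum_ite_eq'] at hsum ⊢
  rw [hc, hG, hβ, if_pos (Finset.mem_Icc.2 ⟨by omega, by omega⟩)] at hsum
  rw [htr]
  linarith

/-! ### The costs of right super-games, with the mates' games and the adjacent games of the last
slot -/

/-- The costs of the games of super-teams `i` and `m`, without the travel of team `n - 1`, in the
right super-game of super-teams `i` and `cycSucc q i`. -/
def rightTail (q : ℕ) (c : ℕ → ℕ → ℝ) (i : ℕ) : ℝ :=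
  if i % 2 = 0 then
    c (2 * i) (4 * q + 10) + c (2 * i) (4 * q + 9) + c (4 * q + 10) (2 * i)
  else c (2 * i - 1) (4 * q + 10) + c (2 * i) (4 * q + 9) + c (4 * q + 10) (2 * i - 1)

/-- The costs of the games of super-teams `i` and `m`, without the travel of team `n - 1`, in the
right super-game of super-teams `cycPred q i` and `i`. -/
def rightHead (q : ℕ) (c : ℕ → ℕ → ℝ) (i : ℕ) : ℝ :=
  if i % 2 = 0 then
    c (2 * i - 1) (4 * q + 10) + c (2 * i - 1) (4 * q + 9) + c (4 * q + 10) (2 * i - 1)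
  else c (2 * i) (4 * q + 10) + c (2 * i - 1) (4 * q + 9) + c (4 * q + 10) (2 * i)

/-- The part of the costs in `rightTail` that is charged to super-team `m`. -/
def chargeTail (q : ℕ) (δ : ℕ → ℕ → ℝ) (i : ℕ) : ℝ :=
  if i % 2 = 0 then δ (2 * i - 1) (4 * q + 10) + δ (2 * i - 1) (4 * q + 9)
  else if i = 2 * q + 3 then δ (2 * i) (4 * q + 10) + δ (2 * i - 1) (4 * q + 9) else 0

/-- The part of the costs in `rightHead` that is charged to super-team `m`. -/
def chargeHead (q : ℕ) (δ : ℕ → ℕ → ℝ) (i : ℕ) : ℝ :=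
  if i % 2 = 0 then δ (2 * i) (4 * q + 10) + δ (2 * i) (4 * q + 9)
  else if i = 1 then δ (2 * i - 1) (4 * q + 10) + δ (2 * i) (4 * q + 9) else 0

/-- The costs of the games of super-team `x`, `cycSucc q x` and `m` in a right super-game, except
for the travel of team `n - 1` to super-teams `x` and `cycSucc q x`. -/
def rightCost (q : ℕ) (c : ℕ → ℕ → ℝ) (x : ℕ) : ℝ :=
  block c x x + block c x (cycSucc q x) + block c (cycSucc q x) x + rightTail q c x +
    rightHead q c (cycSucc q x)

/-- The bound for the costs of a right super-game. -/
def rightBound (q : ℕ) (δ : ℕ → ℕ → ℝ) (x : ℕ) : ℝ :=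
  5 * δ (2 * x) (2 * cycSucc q x) + (if x % 2 = 0 then 3 else 5) * δ (2 * x - 1) (2 * x) +
    4 * δ (2 * cycSucc q x - 1) (2 * cycSucc q x) + δ (4 * q + 9) (4 * q + 10) +
    chargeTail q δ x + chargeHead q δ (cycSucc q x)

/-- Every trip is rewritten by triangle inequalities into the cycle edge between the even-numbered
teams, the matching edges of x and x + 1, the edge of super-team m, and the charges. The five cycle
edges come from the visits of 2x + 1 and 2x + 2 to 2x, the trip of team n, and the two terms of the
transition of team n − 1. -/
theorem rightCost_even (h : TourCost q δ c) {x : ℕ} (hx : 1 ≤ x) (hx' : x ≤ 2 * q + 2)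
    (hpar : x % 2 = 0) : rightCost q c x + transition q δ x ≤ rightBound q δ x := by
  have hs : cycSucc q x = x + 1 := if_neg (by omega)
  obtain ⟨a1, a2, a3, a4, a5⟩ := h.even_pairs hx hx' hpar
  have a6 := h.even_last_pair hx hx' hpar
  have b1 := h.block_mono x x
  rw [h.block_self] at b1
  have b2 := h.le (2 * (x + 1) - 1) (2 * x)
  have b3 := h.le (2 * (x + 1)) (2 * x)
  have t1 := h.triangle (2 * (x + 1) - 1) (2 * (x + 1)) (2 * x)
  have t2 := h.triangle (2 * x - 1) (2 * x) (2 * (x + 1) - 1)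
  have t3 := h.triangle (2 * x) (2 * (x + 1)) (2 * (x + 1) - 1)
  have s1 := h.symm (2 * (x + 1)) (2 * x)
  have s2 := h.symm (2 * (x + 1)) (2 * (x + 1) - 1)
  have s3 := h.symm (4 * q + 10) (4 * q + 9)
  rw [rightCost, rightBound, transition, hs, if_neg (by omega), if_pos hpar, rightTail, if_pos hpar,
    rightHead, if_neg (by omega), chargeTail, if_pos hpar, chargeHead, if_neg (by omega),
    if_neg (by omega), block.eq_def c x (x + 1), block.eq_def c (x + 1) x]
  linarith

/-- The correction is nonpositive by the triangle inequality. It is kept because at x = 1 its term c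
2 3 is also part of the trip of team 2 to 3 and n − 5. -/
theorem rightCost_odd (h : TourCost q δ c) {x : ℕ} (hx : 1 ≤ x) (hx' : x ≤ 2 * q + 2)
    (hpar : x % 2 = 1) :
    rightCost q c x + transition q δ x ≤ rightBound q δ x + (c (2 * x) (2 * (x + 1) - 1) -
      δ (2 * x) (2 * (x + 1)) - δ (2 * (x + 1) - 1) (2 * (x + 1))) := by
  have hs : cycSucc q x = x + 1 := if_neg (by omega)
  obtain ⟨a1, a2, a3, a4, a5⟩ := h.odd_pairs hx hx' hpar
  obtain ⟨a6, a7⟩ := h.odd_last_pairs hx hx' hpar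
  have b1 := h.le (2 * x) (2 * x - 1)
  have b2 := h.le (2 * x) (2 * x)
  have b3 := h.le (2 * x - 1) (2 * x - 1)
  rw [h.self] at b2 b3
  have t1 := h.triangle (2 * (x + 1) - 1) (2 * (x + 1)) (2 * x)
  have t2 := h.triangle (2 * x - 1) (2 * x) (2 * (x + 1) - 1)
  have t3 := h.triangle (2 * x) (2 * (x + 1)) (2 * (x + 1) - 1)
  have s1 := h.symm (2 * (x + 1)) (2 * x)
  have s2 := h.symm (2 * (x + 1)) (2 * (x + 1) - 1)
  have s3 := h.symm (4 * q + 10) (4 * q + 9)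
  have s4 := h.symm (2 * x) (2 * x - 1)
  rw [rightCost, rightBound, transition, hs, if_neg (by omega), if_neg (by omega), rightTail,
    if_neg (by omega), rightHead, if_pos (by omega), chargeTail, if_neg (by omega),
    if_neg (by omega), chargeHead, if_pos (by omega)]
  simp only [block]
  linarith

/-- The trip of team 2 bounds its visit to n − 5 by δ(3, n − 5) − c(2, 3), and the path 3, 4, 2, n −
5 explains the excess. The transition is 0 here, which leaves a surplus of δ(1, 2). -/
theorem rightCost_wrap (h : TourCost q δ c) :
    rightCost q c (2 * q + 3) + transition q δ (2 * q + 3) ≤ rightBound q δ (2 * q + 3) +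
      (δ 2 4 + δ 3 4 - c 2 3 - δ 1 2) := by
  have hs : cycSucc q (2 * q + 3) = 1 := if_pos rfl
  obtain ⟨a1, a2, a3, a4, a5⟩ := h.wrap_pairs
  obtain ⟨a6, a7⟩ := h.wrap_last_pairs
  have e1 : 2 * (2 * q + 3) - 1 = 4 * q + 5 := by omega
  have e2 : 2 * (2 * q + 3) = 4 * q + 6 := by omega
  have b1 := h.le (4 * q + 6) (4 * q + 5)
  have b2 := h.le (4 * q + 6) (4 * q + 6)
  have b3 := h.le (4 * q + 5) (4 * q + 5)
  have b4 := h.le 1 (4 * q + 6)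
  have b5 := h.le (4 * q + 6) 1
  rw [h.self] at b2 b3
  have t1 := h.triangle (4 * q + 6) 2 1
  have t2 := h.triangle (4 * q + 5) (4 * q + 6) 2
  have t3 := h.triangle 3 4 (4 * q + 5)
  have t4 := h.triangle 4 2 (4 * q + 5)
  have s1 := h.symm 1 2
  have s2 := h.symm (4 * q + 6) (4 * q + 5)
  have s3 := h.symm 1 (4 * q + 6)
  have s4 := h.symm 2 (4 * q + 6)
  have s5 := h.symm 2 (4 * q + 5)
  have s6 := h.symm 4 2
  have s7 := h.symm (4 * q + 10) 1
  have n1 := h.nonneg 1 2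
  have n2 := h.nonneg (4 * q + 5) (4 * q + 6)
  have n3 := h.nonneg (4 * q + 9) (4 * q + 10)
  rw [rightCost, rightBound, transition, hs, if_pos rfl, if_neg (by omega), rightTail,
    if_neg (by omega), rightHead, if_neg (by omega), chargeTail, if_neg (by omega),
    if_pos rfl, chargeHead, if_neg (by omega), if_pos rfl, e1, e2]
  simp only [block, e2]
  norm_num
  linarith

theorem sum_rightCost (h : TourCost q δ c) :
    ∑ x ∈ Finset.Icc 1 (2 * q + 3), (rightCost q c x + transition q δ x) ≤
      ∑ x ∈ Finset.Icc 1 (2 * q + 3), rightBound q δ x - δ 1 2 := by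
  -- The corrections at x = 1 and at the wrap cancel up to −δ(1, 2); all others are dropped.
  set z : ℕ → ℝ := fun x => (if x = 1 then c 2 3 - δ 2 4 - δ 3 4 else 0) +
    if x = 2 * q + 3 then δ 2 4 + δ 3 4 - c 2 3 - δ 1 2 else 0
  have hz : ∀ x ∈ Finset.Icc 1 (2 * q + 3),
      rightCost q c x + transition q δ x ≤ rightBound q δ x + z x := by
    intro x hx
    obtain ⟨hx1, hx2⟩ := Finset.mem_Icc.1 hx
    simp only [z]
    by_cases hN : x = 2 * q + 3
    · rw [if_neg (by omega), if_pos hN, zero_add, hN]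
      exact h.rightCost_wrap
    rw [if_neg hN, add_zero]
    rcases Nat.mod_two_eq_zero_or_one x with hp | hp
    · rw [if_neg (by omega), add_zero]
      exact h.rightCost_even hx1 (by omega) hp
    · have ho := h.rightCost_odd hx1 (by omega) hp
      split_ifs with h1
      · subst h1
        exact ho
      · have a := h.le (2 * x) (2 * (x + 1) - 1)
        have b := h.triangle (2 * x) (2 * (x + 1)) (2 * (x + 1) - 1)
        have s := h.symm (2 * (x + 1)) (2 * (x + 1) - 1)
        linarith
  refine (Finset.sum_le_sum hz).trans_eq ?_
  rw [Finset.sum_add_distrib]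
  simp only [z]
  rw [Finset.sum_add_distrib, Finset.sum_ite_eq', Finset.sum_ite_eq',
    if_pos (Finset.mem_Icc.2 ⟨le_rfl, by omega⟩), if_pos (Finset.mem_Icc.2 ⟨by omega, le_rfl⟩)]
  ring

end TourCost

/-! ### The total cost of all visits -/

theorem sum_Icc_two_mul (m : ℕ) (f : ℕ → ℝ) :
    ∑ v ∈ Finset.Icc 1 (2 * m), f v = ∑ i ∈ Finset.Icc 1 m, (f (2 * i - 1) + f (2 * i)) := by
  induction m with
  | zero => simp
  | succ m ih =>
    rw [Finset.sum_Icc_succ_top (by omega), show 2 * (m + 1) = 2 * m + 1 + 1 by omega,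
      Finset.sum_Icc_succ_top (by omega), Finset.sum_Icc_succ_top (by omega), ih]
    simp only [Nat.add_sub_cancel]
    ring

namespace TourCost

variable {q : ℕ} {δ c : ℕ → ℕ → ℝ}

theorem sum_eq_sum_block (m : ℕ) (c : ℕ → ℕ → ℝ) :
    ∑ v ∈ Finset.Icc 1 (2 * m), ∑ a ∈ Finset.Icc 1 (2 * m), c v a =
      ∑ i ∈ Finset.Icc 1 m, ∑ j ∈ Finset.Icc 1 m, block c i j := by
  rw [sum_Icc_two_mul]
  refine Finset.sum_congr rfl fun i _ => ?_
  rw [sum_Icc_two_mul, sum_Icc_two_mul, ← Finset.sum_add_distrib]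
  refine Finset.sum_congr rfl fun j _ => ?_
  simp only [block]
  ring

/-- The distances charged to super-team `m` in the right super-games, and those of the first and of
the last game of team `n - 1` in the right super-games. -/
theorem sum_charge (h : TourCost q δ c) :
    ∑ i ∈ Finset.Icc 1 (2 * q + 3), (chargeTail q δ i + chargeHead q δ i) +
        (δ (4 * q + 9) (firstVisit q (q + 1)) + δ (secondVisit q (q + 2)) (4 * q + 10)) ≤
      ∑ i ∈ Finset.Icc 1 (2 * q + 3), block δ i (2 * q + 5) + δ 1 2 := by
  have e1 : 4 * q + 10 - 1 = 4 * q + 9 := by omega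
  have e2 : 2 * (2 * q + 5) = 4 * q + 10 := by omega
  -- What the charges leave of the distances between super-teams i and m: nothing for even i, half
  -- of them for i = 1 and i = 2q + 3, and everything for other odd i. The two ends of the chain of
  -- team n − 1 lie in odd super-teams and fit into this remainder.
  set w : ℕ → ℝ := fun i => block δ i (2 * q + 5) - (chargeTail q δ i + chargeHead q δ i)
  have hw : ∀ i, 0 ≤ w i := by
    intro i
    have n1 := h.nonneg (2 * i - 1) (4 * q + 9)
    have n2 := h.nonneg (2 * i - 1) (4 * q + 10)
    have n3 := h.nonneg (2 * i) (4 * q + 9)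
    have n4 := h.nonneg (2 * i) (4 * q + 10)
    simp only [w, block, chargeTail, chargeHead, e1, e2]
    split_ifs <;> first | omega | linarith
  have hodd : ∀ i, i % 2 = 1 → i ≠ 1 → i ≠ 2 * q + 3 → w i = block δ i (2 * q + 5) := by
    intro i hi h1 h2
    simp only [w, chargeTail, chargeHead]
    rw [if_neg (by omega), if_neg h2, if_neg (by omega), if_neg h1]
    ring
  suffices hs : δ (4 * q + 9) (firstVisit q (q + 1)) + δ (secondVisit q (q + 2)) (4 * q + 10) ≤
      ∑ i ∈ Finset.Icc 1 (2 * q + 3), w i + δ 1 2 by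
    simp only [w, Finset.sum_sub_distrib] at hs
    linarith
  have hsub : ∀ s : Finset ℕ, s ⊆ Finset.Icc 1 (2 * q + 3) →
      ∑ i ∈ s, w i ≤ ∑ i ∈ Finset.Icc 1 (2 * q + 3), w i := fun s hs =>
    Finset.sum_le_sum_of_subset_of_nonneg hs fun i _ _ => hw i
  have n12 := h.nonneg 1 2
  rcases Nat.mod_two_eq_zero_or_one q with hq | hq
  · have f1 : firstVisit q (q + 1) = 2 * (q + 1) := if_neg (by omega)
    have f2 : secondVisit q (q + 2) = 2 * (q + 3) - 1 := by
      rw [secondVisit, if_neg (by omega), cycSucc, if_neg (by omega)]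
    have hs := hsub {q + 1, q + 3} (by
      intro i hi
      simp only [Finset.mem_insert, Finset.mem_singleton] at hi
      exact Finset.mem_Icc.2 ⟨by omega, by omega⟩)
    rw [Finset.sum_pair (by omega)] at hs
    rw [f1, f2, h.symm (4 * q + 9)]
    -- For n = 10 the odd super-teams concerned are 1 and m − 2, which are already half charged:
    -- δ(2, 9) is not left over, but δ(1, 9) is. The difference is at most δ(1, 2), the surplus from
    -- the wrap.
    by_cases h0 : q = 0
    · subst h0
      have t := h.triangle 2 1 9
      have s := h.symm 2 1
      have n1 := h.nonneg 2 10
      have n2 := h.nonneg 6 9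
      have v1 : w 1 = δ 1 9 + δ 2 10 := by
        simp only [w, block, chargeTail, chargeHead]
        norm_num
        ring
      have v3 : w 3 = δ 5 10 + δ 6 9 := by
        simp only [w, block, chargeTail, chargeHead]
        norm_num
        ring
      norm_num at hs ⊢
      linarith
    · have v1 := hodd (q + 1) (by omega) (by omega) (by omega)
      have v3 := hodd (q + 3) (by omega) (by omega) (by omega)
      simp only [block, e1, e2] at v1 v3
      have n1 := h.nonneg (2 * (q + 1) - 1) (4 * q + 9)
      have n2 := h.nonneg (2 * (q + 1) - 1) (4 * q + 10)
      have n4 := h.nonneg (2 * (q + 1)) (4 * q + 10)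
      have m1 := h.nonneg (2 * (q + 3) - 1) (4 * q + 9)
      have m3 := h.nonneg (2 * (q + 3)) (4 * q + 9)
      have m4 := h.nonneg (2 * (q + 3)) (4 * q + 10)
      linarith
  · have f1 : firstVisit q (q + 1) = 2 * (q + 2) - 1 := by
      rw [firstVisit, if_pos (by omega), cycSucc, if_neg (by omega)]
    have f2 : secondVisit q (q + 2) = 2 * (q + 2) := if_pos (by omega)
    have hs := hsub {q + 2} (by
      intro i hi
      simp only [Finset.mem_singleton] at hi
      exact Finset.mem_Icc.2 ⟨by omega, by omega⟩)
    rw [Finset.sum_singleton] at hs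
    have v2 := hodd (q + 2) (by omega) (by omega) (by omega)
    simp only [block, e1, e2] at v2
    have n2 := h.nonneg (2 * (q + 2) - 1) (4 * q + 10)
    have n3 := h.nonneg (2 * (q + 2)) (4 * q + 9)
    rw [f1, f2, h.symm (4 * q + 9)]
    linarith

/-- The costs within super-teams `1, …, m - 2`. -/
theorem sum_inner (h : TourCost q δ c) :
    ∑ i ∈ Finset.Icc 1 (2 * q + 3), ∑ j ∈ Finset.Icc 1 (2 * q + 3), block c i j ≤
      ∑ i ∈ Finset.Icc 1 (2 * q + 3),
        (block c i i + block c i (cycSucc q i) + block c (cycSucc q i) i) +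
      4 * q * ∑ i ∈ Finset.Icc 1 (2 * q + 3), δ (2 * i - 1) (2 * i) := by
  -- The excess over two matching edges is nonpositive unless j is i or a cyclic neighbour of i. Of
  -- the 2(2q + 3) copies of each matching edge, the three exceptional j take away six, which leaves
  -- 4q.
  set D : ℕ → ℕ → ℝ := fun i j => block c i j - 2 * δ (2 * j - 1) (2 * j)
  have hD : ∀ i ∈ Finset.Icc 1 (2 * q + 3), ∑ j ∈ Finset.Icc 1 (2 * q + 3), D i j ≤
      D i i + D i (cycSucc q i) + D i (cycPred q i) := by
    intro i hi
    obtain ⟨hi1, hi2⟩ := Finset.mem_Icc.1 hi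
    have hsub : {i, cycSucc q i, cycPred q i} ⊆ Finset.Icc 1 (2 * q + 3) := by
      intro j hj
      simp only [Finset.mem_insert, Finset.mem_singleton, cycSucc, cycPred] at hj
      rw [Finset.mem_Icc]
      split_ifs at hj <;> omega
    have hsum : ∑ j ∈ ({i, cycSucc q i, cycPred q i} : Finset ℕ), D i j =
        D i i + D i (cycSucc q i) + D i (cycPred q i) := by
      have h1 : cycSucc q i ≠ cycPred q i := by
        unfold cycSucc cycPred
        split_ifs <;> omega
      have h2 : i ∉ ({cycSucc q i, cycPred q i} : Finset ℕ) := by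
        simp only [Finset.mem_insert, Finset.mem_singleton, cycSucc, cycPred]
        split_ifs <;> omega
      rw [Finset.sum_insert h2, Finset.sum_pair h1, add_assoc]
    rw [← hsum, ← Finset.sum_sdiff hsub]
    refine add_le_of_nonpos_left (Finset.sum_nonpos fun j hj => sub_nonpos.2 ?_)
    simp only [Finset.mem_sdiff, Finset.mem_Icc, Finset.mem_insert, Finset.mem_singleton, cycSucc,
      cycPred] at hj
    obtain ⟨⟨hj1, hj2⟩, hj⟩ := hj
    rcases lt_trichotomy i j with hij | hij | hij
    · exact (h.block_normal hi1 (by split_ifs at hj <;> omega) hj2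
        (by split_ifs at hj <;> omega)).1
    · omega
    · exact (h.block_normal hj1 (by split_ifs at hj <;> omega) hi2
        (by split_ifs at hj <;> omega)).2
  have hsum := Finset.sum_le_sum hD
  have hp := sum_cycPred q D
  have hs := sum_cycSucc q fun i => δ (2 * i - 1) (2 * i)
  simp only [D, Finset.sum_sub_distrib, Finset.sum_add_distrib, ← Finset.mul_sum,
    Finset.sum_const, Nat.card_Icc, nsmul_eq_mul] at hsum hp
  simp only [Finset.sum_add_distrib]
  rw [hs] at hsum
  push_cast at hsum
  norm_num at hsum
  linarith

/-- The costs between super-team `m - 1` and super-teams `1, …, m - 2`. -/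
theorem sum_left (h : TourCost q δ c) :
    ∑ i ∈ Finset.Icc 1 (2 * q + 3), (block c i (2 * q + 4) + block c (2 * q + 4) i) ≤
      ∑ i ∈ Finset.Icc 1 (2 * q + 3), (block δ i (2 * q + 4) +
        ((if i % 2 = 0 then 2 else 0) * δ (2 * i - 1) (2 * i) +
          2 * δ (4 * q + 7) (4 * q + 8))) := by
  refine Finset.sum_le_sum fun i hi => ?_
  obtain ⟨hi1, hi2⟩ := Finset.mem_Icc.1 hi
  have n := h.nonneg (4 * q + 7) (4 * q + 8)
  rcases Nat.mod_two_eq_zero_or_one i with hp | hp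
  · have a := h.block_left_even hi1 (by omega) hp
    have b := h.block_mono i (2 * q + 4)
    rw [if_pos hp]
    linarith
  · have a := h.block_left_odd hi1 hi2 hp
    have b := h.block_mono (2 * q + 4) i
    rw [h.block_symm (2 * q + 4) i] at b
    rw [if_neg (by omega)]
    linarith

theorem block_right (q : ℕ) (c : ℕ → ℕ → ℝ) (i : ℕ) :
    block c i (2 * q + 5) + block c (2 * q + 5) i = rightTail q c i + rightHead q c i +
      (c (4 * q + 9) (2 * i - 1) + c (4 * q + 9) (2 * i)) := by
  have e1 : 4 * q + 10 - 1 = 4 * q + 9 := by omega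
  have e2 : 2 * (2 * q + 5) = 4 * q + 10 := by omega
  simp only [block, rightTail, rightHead, e1, e2]
  split_ifs <;> ring

/-- The total cost of the tournament. -/
theorem sum_le (h : TourCost q δ c) :
    ∑ v ∈ Finset.Icc 1 (4 * q + 10), ∑ a ∈ Finset.Icc 1 (4 * q + 10), c v a ≤
      ∑ a ∈ Finset.Icc 1 (4 * q + 10),
        (δ a (4 * q + 7) + δ a (4 * q + 8) + (δ a (4 * q + 9) + δ a (4 * q + 10))) +
      5 * ∑ x ∈ Finset.Icc 1 (2 * q + 3), δ (2 * x) (2 * cycSucc q x) +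
      (4 * q + 9) * ∑ i ∈ Finset.Icc 1 (2 * q + 5), δ (2 * i - 1) (2 * i) := by
  have e1 : 4 * q + 10 - 1 = 4 * q + 9 := by omega
  have e2 : 2 * (2 * q + 5) = 4 * q + 10 := by omega
  have e3 : 4 * q + 8 - 1 = 4 * q + 7 := by omega
  have e4 : 2 * (2 * q + 4) = 4 * q + 8 := by omega
  have hE : ∑ a ∈ Finset.Icc 1 (4 * q + 10),
      (δ a (4 * q + 7) + δ a (4 * q + 8) + (δ a (4 * q + 9) + δ a (4 * q + 10))) =
      ∑ i ∈ Finset.Icc 1 (2 * q + 5), (block δ i (2 * q + 4) + block δ i (2 * q + 5)) := by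
    rw [← e2, sum_Icc_two_mul]
    refine Finset.sum_congr rfl fun i _ => ?_
    simp only [block, e1, e2, e3, e4]
    ring
  have hT : ∑ v ∈ Finset.Icc 1 (4 * q + 10), ∑ a ∈ Finset.Icc 1 (4 * q + 10), c v a =
      ∑ i ∈ Finset.Icc 1 (2 * q + 5), ∑ j ∈ Finset.Icc 1 (2 * q + 5), block c i j := by
    rw [← e2, sum_eq_sum_block]
  have peel : ∀ f : ℕ → ℝ, ∑ i ∈ Finset.Icc 1 (2 * q + 5), f i =
      ∑ i ∈ Finset.Icc 1 (2 * q + 3), f i + f (2 * q + 4) + f (2 * q + 5) := fun f => by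
    rw [Finset.sum_Icc_succ_top (by omega), Finset.sum_Icc_succ_top (by omega)]
  have hin := h.sum_inner
  have hl := h.sum_left
  have hc := h.sum_charge
  have ht := h.second_last_team
  have hr := h.sum_rightCost
  have hright : ∑ i ∈ Finset.Icc 1 (2 * q + 3), (block c i (2 * q + 5) + block c (2 * q + 5) i) =
      ∑ i ∈ Finset.Icc 1 (2 * q + 3), (rightTail q c i + rightHead q c i +
      (c (4 * q + 9) (2 * i - 1) + c (4 * q + 9) (2 * i))) :=
    Finset.sum_congr rfl fun i _ => block_right q c i
  have hM := sum_cycSucc q fun i => δ (2 * i - 1) (2 * i)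
  have hh := sum_cycSucc q (rightHead q c)
  have hh' := sum_cycSucc q (chargeHead q δ)
  -- The right super-games use 3 or 5 matching edges of i as the first index, and the left
  -- super-games 2 or 0 according to the same parity; together always 5. With 4 as the second index
  -- and 4q from the normal super-games this makes 4q + 9.
  have hpar : ∑ i ∈ Finset.Icc 1 (2 * q + 3),
      ((if i % 2 = 0 then (3 : ℝ) else 5) * δ (2 * i - 1) (2 * i)) +
      ∑ i ∈ Finset.Icc 1 (2 * q + 3),
        ((if i % 2 = 0 then (2 : ℝ) else 0) * δ (2 * i - 1) (2 * i)) =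
      5 * ∑ i ∈ Finset.Icc 1 (2 * q + 3), δ (2 * i - 1) (2 * i) := by
    rw [← Finset.sum_add_distrib, Finset.mul_sum]
    refine Finset.sum_congr rfl fun i _ => ?_
    split_ifs <;> ring
  -- The visits among the last four teams are not estimated beyond plain distances, which are part
  -- of their values D.
  have c1 := h.block_mono (2 * q + 4) (2 * q + 4)
  have c2 := h.block_mono (2 * q + 4) (2 * q + 5)
  have c3 := h.block_mono (2 * q + 5) (2 * q + 4)
  have c4 := h.block_mono (2 * q + 5) (2 * q + 5)
  have n1 := h.nonneg (4 * q + 7) (4 * q + 8)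
  have n2 := h.nonneg (4 * q + 9) (4 * q + 10)
  have n3 := mul_nonneg (Nat.cast_nonneg (α := ℝ) q) n2
  rw [hE, hT]
  simp only [peel, e1, e2, e3, e4]
  simp only [rightCost, rightBound, Finset.sum_add_distrib, ← Finset.mul_sum, Finset.sum_const,
    Nat.card_Icc, nsmul_eq_mul, Nat.add_sub_cancel, Nat.cast_add, Nat.cast_mul, Nat.cast_ofNat]
    at hin hl hc ht hr hright ⊢
  rw [hM, hh, hh'] at hr
  linarith

end TourCost

/-! ### The approximation ratio -/

theorem sum_eq_sum_Icc [Fintype V] {n : ℕ} {t : ℕ → V}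
    (ht : Set.BijOn t (Set.Icc 1 n) Set.univ) (f : V → ℝ) :
    ∑ v, f v = ∑ i ∈ Finset.Icc 1 n, f (t i) := by
  symm
  refine Finset.sum_nbij t (fun _ _ => Finset.mem_univ _) ?_ ?_ (fun _ _ => rfl)
  · simpa using ht.injOn
  · simpa using ht.surjOn

/-- The passage from metric data to the abstract cost: a direct step from a to b makes the saving
after a at least the detour of a and b. -/
theorem tourCost_of_feasible [PseudoMetricSpace V] [DecidableEq (V × V)] {q : ℕ} {t : ℕ → V}
    (hS : IsFeasible 2 (4 * q + 10)
      (fun k => (zhaoXiao (4 * q + 10) k).image (Prod.map t t))) :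
    TourCost q (fun a b => dist (t a) (t b)) (fun v a => dist (t v) (t a) -
      saving (4 * q + 10) (fun k => (zhaoXiao (4 * q + 10) k).image (Prod.map t t)) (t v) (t a)) where
  nonneg _ _ := dist_nonneg
  self _ := dist_self _
  symm _ _ := dist_comm _ _
  triangle _ _ _ := dist_triangle _ _ _
  le v a := sub_le_self _ (saving_nonneg _ _ _ _)
  step k v a b hk hk' ha hb := by
    have := detour_le_saving (v := t v) (a := t a) (b := t b) hS hk (by omega)
      (Finset.mem_image_of_mem (Prod.map t t) ha) (Finset.mem_image_of_mem (Prod.map t t) hb)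
    simp only [detour] at this
    linarith

variable [Fintype V] [PseudoMetricSpace V]

/-- The four teams of the super-teams `m - 1` and `m` have small values `D`. -/
theorem IsNumbering.distSum_le {q : ℕ} {M : (⊤ : SimpleGraph V).Subgraph} {C : List V}
    {t : ℕ → V} (h : IsNumbering (4 * q + 10) M C t) :
    (4 * q + 10) * (distSum (t (4 * q + 7)) + distSum (t (4 * q + 8)) +
      (distSum (t (4 * q + 9)) + distSum (t (4 * q + 10)))) ≤ 4 * ∑ v : V, distSum v := by
  have h1 := h.smallest
  have h2 := h.second_smallest
  have e : (4 * q + 10) / 2 - 2 = 2 * q + 3 := by omega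
  rw [e] at h2
  simp only [show 4 * q + 10 - 1 = 4 * q + 9 by omega, show 4 * q + 10 - 3 = 4 * q + 7 by omega,
    show 4 * q + 10 - 2 = 4 * q + 8 by omega] at h1 h2
  have hs := Finset.card_nsmul_le_sum (Finset.Icc 1 (2 * q + 3))
    (fun i => distSum (t (2 * i - 1)) + distSum (t (2 * i))) _ h2
  rw [sum_eq_sum_Icc h.bijOn, show 4 * q + 10 = 2 * (2 * q + 3 + 1 + 1) by omega, sum_Icc_two_mul,
    Finset.sum_Icc_succ_top (by omega), Finset.sum_Icc_succ_top (by omega)]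
  simp only [show 4 * q + 8 - 1 = 4 * q + 7 by omega,
    show 2 * (2 * q + 3 + 1) = 4 * q + 8 by omega,
    show 4 * q + 10 - 1 = 4 * q + 9 by omega,
    show 2 * (2 * q + 3 + 1 + 1) = 4 * q + 10 by omega]
  rw [Nat.card_Icc, Nat.add_sub_cancel, nsmul_eq_mul] at hs
  push_cast at hs
  have hq : (0 : ℝ) ≤ q := Nat.cast_nonneg q
  -- If A ≥ B are the sums of D over the super-teams m − 1 and m, then Δ ≥ (2q + 4)A + B, and 4Δ −
  -- n(A + B) is at least (4q + 6)(A − B). The product with q is supplied for `linarith`.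
  have := mul_le_mul_of_nonneg_left h1 hq
  linarith

theorem IsNumbering.sum_mates {n : ℕ} {M : (⊤ : SimpleGraph V).Subgraph} {C : List V}
    {t : ℕ → V} {τ : V → V} (h : IsNumbering (2 * n) M C t)
    (hτ : ∀ u v, M.Adj u v ↔ u ∈ Finset.univ ∧ τ u = v) :
    ∑ u, dist u (τ u) = 2 * ∑ i ∈ Finset.Icc 1 n, dist (t (2 * i - 1)) (t (2 * i)) := by
  rw [sum_eq_sum_Icc h.bijOn, sum_Icc_two_mul, Finset.mul_sum]
  refine Finset.sum_congr rfl fun i hi => ?_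
  have hm := h.mates i (by rwa [Nat.mul_div_cancel_left _ two_pos])
  rw [((hτ _ _).1 hm).2, ((hτ _ _).1 hm.symm).2, dist_comm (t (2 * i))]
  ring

/-- The length of the Hamiltonian cycle through the teams `t 2, t 4, …, t (n - 4)`. -/
theorem IsNumbering.cycle_le {q : ℕ} {M : (⊤ : SimpleGraph V).Subgraph} {C : List V}
    {t : ℕ → V} (h : IsNumbering (4 * q + 10) M C t) :
    ∑ x ∈ Finset.Icc 1 (2 * q + 3), dist (t (2 * x)) (t (2 * cycSucc q x)) ≤ closedLen C := by
  obtain ⟨C', ⟨k, rfl⟩, hsub⟩ := h.cyclic_order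
  have e : (4 * q + 10) / 2 - 2 = 2 * q + 2 + 1 := by omega
  rw [e] at hsub
  have hl := closedLen_mono hsub
  rw [closedLen_rotate, closedLen_map_range] at hl
  refine le_of_eq_of_le ?_ hl
  rw [sum_Icc_one, Finset.sum_range_succ]
  congr 1
  · refine Finset.sum_congr rfl fun i hi => ?_
    have := Finset.mem_range.1 hi
    rw [cycSucc, if_neg (by omega)]
  · rw [cycSucc, if_pos rfl]

theorem travel_output_le {q : ℕ} (hV : Fintype.card V = 4 * q + 10)
    [DecidableEq (V × V)] {M : (⊤ : SimpleGraph V).Subgraph} {C : List V} {t : ℕ → V}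
    (hM : IsMinMatchingOn Set.univ M) (hC : IsChristofidesCycle C)
    (ht : IsNumbering (4 * q + 10) M C t) :
    (4 * q + 10) * travel (4 * q + 10)
        (fun k => (zhaoXiao (4 * q + 10) k).image (Prod.map t t)) ≤
      (4 * q + 19) * (∑ v : V, distSum v + (4 * q + 10) * graphLen M.spanningCoe) := by
  have hS : IsFeasible 2 (4 * q + 10)
      (fun k => (zhaoXiao (4 * q + 10) k).image (Prod.map t t)) := isFeasible_image ht.bijOn
  obtain ⟨τ, hτ, hτM⟩ := exists_isPairing_of_isMatching (U := Finset.univ)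
    (by rw [hM.1, Finset.coe_univ]) hM.2.1
  have hd := two_mul_graphLen_matching hτM
  have hmates := IsNumbering.sum_mates (n := 2 * q + 5)
    (by rwa [show 2 * (2 * q + 5) = 4 * q + 10 by omega]) hτM
  have hcyc := ht.cycle_le
  -- The bound on C holds for every v; summing over v gives n times the length of C at most 2n d(M)
  -- + Δ.
  have hlen := Finset.card_nsmul_le_sum Finset.univ
    (fun v : V => ∑ u : V, dist u (τ u) + distSum v) (closedLen C) fun v _ => closedLen_le hC hτ v
  have hE := ht.distSum_le
  have hsum := (tourCost_of_feasible hS).sum_le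
  rw [travel_eq hS]
  have hdist : ∀ v : V, distSum v = ∑ a ∈ Finset.Icc 1 (4 * q + 10), dist (t a) v := fun v => by
    rw [distSum, sum_eq_sum_Icc ht.bijOn]
    exact Finset.sum_congr rfl fun _ _ => dist_comm _ _
  have hcost : ∑ v : V, (2 * distSum v - ∑ a, saving (4 * q + 10)
      (fun k => (zhaoXiao (4 * q + 10) k).image (Prod.map t t)) v a) = ∑ v : V, distSum v +
      ∑ v ∈ Finset.Icc 1 (4 * q + 10), ∑ a ∈ Finset.Icc 1 (4 * q + 10),
        (dist (t v) (t a) - saving (4 * q + 10)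
          (fun k => (zhaoXiao (4 * q + 10) k).image (Prod.map t t)) (t v) (t a)) := by
    rw [sum_eq_sum_Icc ht.bijOn, sum_eq_sum_Icc ht.bijOn, ← Finset.sum_add_distrib]
    refine Finset.sum_congr rfl fun v _ => ?_
    rw [Finset.sum_sub_distrib, sum_eq_sum_Icc ht.bijOn, distSum, sum_eq_sum_Icc ht.bijOn]
    ring
  rw [hcost]
  simp only [Finset.sum_add_distrib, ← hdist] at hsum
  simp only [Finset.sum_add_distrib, Finset.sum_const, Finset.card_univ, hV, nsmul_eq_mul] at hlen
  push_cast at hlen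
  have hq : (0 : ℝ) ≤ 4 * q + 10 := by positivity
  have h1 := mul_le_mul_of_nonneg_left hsum hq
  have h2 := mul_le_mul_of_nonneg_left hcyc hq
  have h3 : ∑ i ∈ Finset.Icc 1 (2 * q + 5), dist (t (2 * i - 1)) (t (2 * i)) =
    graphLen M.spanningCoe := by linarith
  rw [h3] at h1
  rw [← hd] at hlen
  nlinarith

end TTP

theorem theorem1 {V : Type*} [Fintype V] [PseudoMetricSpace V] (n : ℕ)
    (hV : Fintype.card V = n) (hn : 10 ≤ n) (hmod : n % 4 = 2) :
    (∃ S : TTP.Schedule V, TTP.IsOutput n S) ∧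
      ∀ S : TTP.Schedule V, TTP.IsOutput n S →
        TTP.IsFeasible 2 n S ∧
          ∀ S' : TTP.Schedule V, TTP.IsFeasible 2 n S' →
            TTP.travel n S ≤ (1 + 9 / (n : ℝ)) * TTP.travel n S' := by
  classical
  obtain ⟨q, rfl⟩ : ∃ q, n = 4 * q + 10 := ⟨(n - 10) / 4, by omega⟩
  refine ⟨?_, ?_⟩
  · have e : 2 * (2 * q + 3 + 2) = 4 * q + 10 := by omega
    have h := TTP.exists_isOutput (N := 2 * q + 3) (by rw [hV, e])
    rwa [e] at h
  rintro S ⟨M, C, t, hM, hC, ht, rfl⟩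
  refine ⟨TTP.isFeasible_image ht.bijOn, fun S' hS' => ?_⟩
  have hup := TTP.travel_output_le hV hM hC ht
  have hlow := TTP.le_travel hS' hV ⟨2 * q + 5, by omega⟩ hM
  push_cast at hlow ⊢
  have hq : (0 : ℝ) < 4 * q + 10 := by positivity
  -- Here 1 + 9/n = (4q + 19)/(4q + 10), so both bounds are compared after multiplication by n.
  have h1 := mul_le_mul_of_nonneg_left hlow (by positivity : (0 : ℝ) ≤ 4 * q + 19)
  rw [show (1 + 9 / (4 * q + 10 : ℝ)) = (4 * q + 19) / (4 * q + 10) by field_simp; ring,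
    div_mul_eq_mul_div, le_div_iff₀ hq, mul_comm]
  exact hup.trans h1
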